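/- Let $\mathcal H_L=(\mathbb C^2)^{\otimes n}$ with $d=2^n$, let $\mathcal H_{A_1}$ and the reference $\mathcal H_r$ be copies of $\mathcal H_L$, let $\mathcal H_A=\mathcal H_{A_1}\otimes\mathcal H_{A_2}$ with $\dim\mathcal H_{A_2}=d_\chi\ge 1$, and let $\mathcal H_{\bar A}$ be finite-dimensional. Let $|\chi\rangle\in\mathcal H_{A_2}\otimes\mathcal H_{\bar A}$ have flat, full-rank entanglement spectrum, i.e. $\chi:=\operatorname{Tr}_{\bar A}|\chi\rangle\langle\chi|=I/d_\chi$. Let $V^{(0)}:\mathcal H_L\to\mathcal H_A\otimes\mathcal H_{\bar A}$ be an exact subsystem erasure-correcting code: there are unitaries $R^{(0)}_A$ on $\mathcal H_A$ and $R^{(0)}_{\bar A}$ on $\mathcal H_{\bar A}$ with $R^{(0)}_AR^{(0)}_{\bar A}V^{(0)}|\psi\rangle=|\psi\rangle_{A_1}|\chi\rangle_{A_2\bar A}$ for all $\psi$. Let $W$ be a Hermitian operator on $\mathcal H_A\otimes\mathcal H_{\bar A}$ and, for $\epsilon\in\mathbb R$, let $V^{(\epsilon)}=e^{i\epsilon W}V^{(0)}$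 be the skewed code. For unitaries $R=(R_A,R_{\bar A})$ let $\mathcal N_R^{(\epsilon)}(\sigma)=\operatorname{Tr}_{A_2\bar A}\big(R_AR_{\bar A}V^{(\epsilon)}\sigma V^{(\epsilon)\dagger}R_{\bar A}^\dagger R_A^\dagger\big)$. With $S$ the von Neumann entropy and $|\Phi\rangle=d^{-1/2}\sum_i|i\rangle_L|i\rangle_r$, call $R$ optimal for $V^{(\epsilon)}$ if it maximizes, over all pairs of unitaries, the coherent information $$I_c(\mathcal N_R^{(\epsilon)})=S\big(\operatorname{Tr}_r[(\mathcal N_R^{(\epsilon)}\otimes \mathrm{id}_r)(|\Phi\rangle\langle\Phi|)]\big)-S\big((\mathcal N_R^{(\epsilon)}\otimes \mathrm{id}_r)(|\Phi\rangle\langle\Phi|)\big).$$ For an optimal $R^*$, the proto-area entropy of a logical state $\sigma$ is $S_{PA}(\epsilon,\sigma)=S\big(\operatorname{Tr}_{\bar A}[V^{(\epsilon)}\sigma V^{(\epsilon)\dagger}]\big)-S\big(\mathcal N^{(\epsilon)}_{R^*}(\sigma)\big)$, and $\langle S_{PA}\rangle(\epsilon,\sigma)=\int S_{PA}(\epsilon,U\sigma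 U^\dagger)\,dU$ is its average over normalized Haar measure on the unitaries of $\mathcal H_L$. For $\theta\in(0,\pi/2)^n$ let $\sigma_\theta$ be the mixed bulk state purified by the product of Bell-like pairs $\bigotimes_{k=1}^n(\cos\theta_k|00\rangle+\sin\theta_k|11\rangle)$ between bulk and reference qubits, and let $s(\theta_k)$ be the entropy of the $k$-th bulk qubit, so that the bulk entropy is $S(\sigma_\theta)=\sum_ks(\theta_k)$. Then optimal recoveries exist for every $\epsilon$, and there is a function $G$ of $\theta$ (depending on the code and on $W$, but not on the choice of optimal recoveries) such that, for every choice $\epsilon\mapsto R^{*(\epsilon)}$ of optimal recoveries and every $\theta\in(0,\pi/2)^n$, $$\langle S_{PA}\rangle(\epsilon,\sigma_\theta)=S(\chi)+\epsilon^2G(\theta)+o(\epsilon^2)\qquad(\epsilon\to0),$$ and this leading correction increases monotonically with the bulk entropy: 1. if $s(\theta_k)\le s(\theta'_k)$ for every $k$, then $G(\theta)\le G(\theta')$; 2. either $G$ is constant on $(0,\pi/2)^n$, or the inequality in 1 is strict whenever $s(\theta_k)<s(\theta'_k)$ for at least one $k$; 3. for identical pairs, $\theta=(t,\dots,t)$ and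 $\theta'=(t',\dots,t')$ with $t,t'\in(0,\pi/2)$, if $S(\sigma_\theta)\le S(\sigma_{\theta'})$ then $G(\theta)\le G(\theta')$. -/

import Mathlib

open scoped Kronecker Matrix Topology

/-! ### Matrices as operators on finite-dimensional Hilbert spaces -/

/-- The unitary group carries its Borel sigma-algebra. -/
noncomputable instance unitaryGroupMeasurableSpace {m : Type*} [Fintype m] [DecidableEq m] :
    MeasurableSpace (Matrix.unitaryGroup m ℂ) :=
  borel _

instance unitaryGroupBorelSpace {m : Type*} [Fintype m] [DecidableEq m] :
    BorelSpace (Matrix.unitaryGroup m ℂ) :=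
  ⟨rfl⟩

instance unitaryGroupCompactSpace {m : Type*} [Fintype m] [DecidableEq m] :
    CompactSpace (Matrix.unitaryGroup m ℂ) := by
  refine isCompact_iff_compactSpace.mp ?_
  have hK : IsCompact (Set.univ.pi fun _ : m => Set.univ.pi fun _ : m =>
      Metric.closedBall (0 : ℂ) 1) :=
    isCompact_univ_pi fun _ => isCompact_univ_pi fun _ => isCompact_closedBall _ _
  refine hK.of_isClosed_subset ?_ ?_
  · have h : ((Matrix.unitaryGroup m ℂ : Submonoid (Matrix m m ℂ)) : Set (Matrix m m ℂ)) =
        {A | A * star A = 1} := by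
      ext A
      exact Matrix.mem_unitaryGroup_iff
    rw [h]
    exact isClosed_eq (by fun_prop) continuous_const
  · intro A hA i _ j _
    simpa using entry_norm_bound_of_unitary hA i j

/-- The normalized Haar measure on the unitary group. -/
noncomputable def haarUnitary (m : Type*) [Fintype m] [DecidableEq m] :
    MeasureTheory.Measure (Matrix.unitaryGroup m ℂ) :=
  MeasureTheory.Measure.haarMeasure ⊤

/-- The partial trace over the second tensor factor. -/
def ptraceSnd {a b : Type*} [Fintype b] (X : Matrix (a × b) (a × b) ℂ) : Matrix a a ℂ :=
  fun i j => ∑ k, X (i, k) (j, k)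

/-- The operator `|v⟩⟨v|`. -/
def ketbra {a : Type*} (v : a → ℂ) : Matrix a a ℂ :=
  Matrix.vecMulVec v (star v)

/-- The von Neumann entropy `-Tr (ρ log ρ)`, through the functional calculus of the function
`x ↦ -x log x`. -/
noncomputable def vnEntropy {a : Type*} [Fintype a] [DecidableEq a] (ρ : Matrix a a ℂ) : ℝ :=
  (cfc Real.negMulLog ρ).trace.re

/-! ### Codes, recovery and proto-area

Index types: `l` for the logical space `H_L` and for its copies `A₁` and `r`; `κ` for `A₂`;
`β` for the complementary region `Ā` (the factor `Ā₁` is trivial, so `Ā = Ā₂`).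
The boundary region `A` has the Hilbert space with index type `l × κ`. -/

section Code

variable {l κ β : Type*} [Fintype l] [DecidableEq l] [Fintype κ] [DecidableEq κ]
  [Fintype β] [DecidableEq β]

/-- The map `|ψ⟩ ↦ |ψ⟩_{A₁} ⊗ |χ⟩_{A₂ Ā}`. -/
def attachResource (χ : κ × β → ℂ) : Matrix ((l × κ) × β) l ℂ :=
  fun x i => if x.1.1 = i then χ (x.1.2, x.2) else 0

/-- `V` is an exact subsystem erasure-correcting code with resource state `χ`: some recovery
unitaries on `A` and on `Ā` take `V |ψ⟩` to `|ψ⟩_{A₁} ⊗ |χ⟩_{A₂ Ā}` for every `ψ`. -/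
def IsExactCode (V : Matrix ((l × κ) × β) l ℂ) (χ : κ × β → ℂ) : Prop :=
  ∃ (RA : Matrix.unitaryGroup (l × κ) ℂ) (RB : Matrix.unitaryGroup β ℂ),
    ((RA : Matrix (l × κ) (l × κ) ℂ) ⊗ₖ (RB : Matrix β β ℂ)) * V = attachResource χ

/-- The entanglement spectrum of `χ` across `A₂` and `Ā` is flat and of full rank on `A₂`:
the reduced state on `A₂` is maximally mixed. -/
def IsFlat (χ : κ × β → ℂ) : Prop :=
  ptraceSnd (ketbra χ) = ((Fintype.card κ : ℂ)⁻¹) • (1 : Matrix κ κ ℂ)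

/-- The skewed encoding `exp (i ε W) V`. -/
noncomputable def skewed (W : Matrix ((l × κ) × β) ((l × κ) × β) ℂ)
    (V : Matrix ((l × κ) × β) l ℂ) (ε : ℝ) : Matrix ((l × κ) × β) l ℂ :=
  NormedSpace.exp ((Complex.I * (ε : ℂ)) • W) * V

/-- The encoding-recovery channel
`σ ↦ Tr_{A₂ Ā} ((RA ⊗ RB) V σ V† (RA ⊗ RB)†)` from `L` to `A₁`. -/
def recoveryChannel (V : Matrix ((l × κ) × β) l ℂ) (RA : Matrix.unitaryGroup (l × κ) ℂ)
    (RB : Matrix.unitaryGroup β ℂ) (σ : Matrix l l ℂ) : Matrix l l ℂ :=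
  let K : Matrix ((l × κ) × β) l ℂ :=
    ((RA : Matrix (l × κ) (l × κ) ℂ) ⊗ₖ (RB : Matrix β β ℂ)) * V
  ptraceSnd (ptraceSnd (K * σ * Kᴴ))

/-- `N ⊗ id_r`, applied to an operator on `L ⊗ r`. -/
def tensorRef (N : Matrix l l ℂ → Matrix l l ℂ) (X : Matrix (l × l) (l × l) ℂ) :
    Matrix (l × l) (l × l) ℂ :=
  fun x y => N (fun i j => X (i, x.2) (j, y.2)) x.1 y.1

/-- The maximally entangled state `d^{-1/2} ∑ᵢ |i⟩_L |i⟩_r`. -/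
noncomputable def maxEntangled (l : Type*) [Fintype l] [DecidableEq l] : l × l → ℂ :=
  fun x => if x.1 = x.2 then ((Real.sqrt (Fintype.card l))⁻¹ : ℝ) else 0

/-- The coherent information of `N`, evaluated on the maximally entangled input. -/
noncomputable def coherentInfo (N : Matrix l l ℂ → Matrix l l ℂ) : ℝ :=
  vnEntropy (ptraceSnd (tensorRef N (ketbra (maxEntangled l)))) -
    vnEntropy (tensorRef N (ketbra (maxEntangled l)))

/-- `(RA, RB)` is an optimal recovery for the encoding `V`: it maximizes the coherent information
of the encoding-recovery channel. -/
def IsOptimalRecovery (V : Matrix ((l × κ) × β) l ℂ) (RA : Matrix.unitaryGroup (l × κ) ℂ)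
    (RB : Matrix.unitaryGroup β ℂ) : Prop :=
  ∀ (RA' : Matrix.unitaryGroup (l × κ) ℂ) (RB' : Matrix.unitaryGroup β ℂ),
    coherentInfo (recoveryChannel V RA' RB') ≤ coherentInfo (recoveryChannel V RA RB)

/-- The proto-area entropy `S(ρ_A) - S(σ_{A₁})` of the logical state `σ`, for the recovery
`(RA, RB)`; here `ρ_A = Tr_Ā (V σ V†)` and `σ_{A₁}` is the recovered bulk state. -/
noncomputable def protoArea (V : Matrix ((l × κ) × β) l ℂ) (RA : Matrix.unitaryGroup (l × κ) ℂ)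
    (RB : Matrix.unitaryGroup β ℂ) (σ : Matrix l l ℂ) : ℝ :=
  vnEntropy (ptraceSnd (V * σ * Vᴴ)) - vnEntropy (recoveryChannel V RA RB σ)

/-- The proto-area entropy averaged over the bulk states `U σ U†`, with `U` Haar distributed on
the unitaries of the logical space. -/
noncomputable def avgProtoArea (V : Matrix ((l × κ) × β) l ℂ)
    (RA : Matrix.unitaryGroup (l × κ) ℂ) (RB : Matrix.unitaryGroup β ℂ) (σ : Matrix l l ℂ) : ℝ :=
  ∫ U : Matrix.unitaryGroup l ℂ,
    protoArea V RA RB ((U : Matrix l l ℂ) * σ * (U : Matrix l l ℂ)ᴴ) ∂(haarUnitary l)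

end Code

/-! ### Bell-like bulk states -/

/-- The product `⊗ₖ (cos θₖ |00⟩ + sin θₖ |11⟩)` of Bell-like pairs, shared between `n` bulk
qubits (first index) and `n` reference qubits (second index). -/
noncomputable def bellLike {n : ℕ} (θ : Fin n → ℝ) : (Fin n → Fin 2) × (Fin n → Fin 2) → ℂ :=
  fun x => ∏ k, if x.1 k = x.2 k then
    (if x.1 k = 0 then (Real.cos (θ k) : ℂ) else (Real.sin (θ k) : ℂ)) else 0

/-- The mixed bulk state of `n` qubits purified by `bellLike θ`. -/
noncomputable def bulkState {n : ℕ} (θ : Fin n → ℝ) :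
    Matrix (Fin n → Fin 2) (Fin n → Fin 2) ℂ :=
  ptraceSnd (ketbra (bellLike θ))

/-- The entropy of one bulk qubit that shares a Bell-like pair of angle `t` with the reference. -/
noncomputable def pairEntropy (t : ℝ) : ℝ :=
  vnEntropy (bulkState fun _ : Fin 1 => t)

/-- The angles for which every bulk qubit has a reduced state of full rank. -/
def fullRankAngles (n : ℕ) : Set (Fin n → ℝ) :=
  {θ | ∀ k, θ k ∈ Set.Ioo 0 (Real.pi / 2)}

/-! Local unitaries on A and Ā can be absorbed into W and into the recovery, so the unperturbed code
may be taken to be ψ ↦ ψ ⊗ χ. The entropy of ρ_A does not depend on the recovery at all and may be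
computed along any convenient one. The first-order perturbation iW of the code splits
(`exists_normalForm`) into iX with X Hermitian on A, a change of the resource state, and an
irreducible part A₀G. Here A₀ is the unperturbed code read as an operator from r ⊗ Ā to A, and G is
Hermitian with vanishing partial trace over r. Undoing X by exp(-iεX) gives a comparison recovery K₀
whose infidelity is ε²‖A₀G‖²/d + o(ε²) (`fid_expansion`).

Both entropies in the proto-area are expanded to second order around a diagonal state p
(`vnEntropy_expansion`) and averaged over the unitaries. Because χ is flat, the linear term for A is
the same functional as the one for A₁, and its Haar average is (1 - F) s(p), where F is the
entanglement fidelity and s(p) depends on p alone (`integral_entropyShift`). An optimally recovered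
state differs from the input by O(ε²), up to a unitary of A₁ that no entropy sees, so its quadratic
term is negligible; the state of A moves at order ε and contributes ε² times the average of
`hessian`. The linear terms cancel as soon as the comparison recovery and the optimal recovery have
the same infidelity up to o(ε²).

That equality is proved from two sides. Upper bound: the marginal entropy in the coherent
information varies only by O(ε²), while a Choi state with top eigenvalue 1 - δ has entropy δ
log(1/δ) + O(δ). The logarithm dominates, so beating the comparison recovery forces δ ≤ (p + o(1))
ε² with the comparison coefficient p (`eventually_le_of_entropy_le`). The polar part of the matrix
of the top eigenvector is then a unitary of A₁ whose undoing leaves infidelity at most δ + O(δ²)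
(`exists_correction`). Lower bound: `infid_le_of_recovery` pairs the error of any recovery with A₀G
and applies Cauchy-Schwarz; the directions reachable by recoveries are orthogonal to A₀G to first
order.

After averaging, G(θ) = C - q ∑ k(pᵢ, pⱼ) with q ≥ 0 and k(x, y) = (x + y)² (log x - log y)/(x - y).
The kernel k is the perspective of an even, strictly convex function, hence jointly convex. Raising
the entropy of one qubit mixes the distribution with its image under the flip of that bit, and the
flip preserves the double sum, so convexity lowers the sum (`kernelSum_mix_le`). The case q = 0
gives constant G; otherwise monotonicity is strict. -/

open Filter Asymptotics MeasureTheory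

set_option linter.unusedSectionVars false

/-! ### Entropy: continuity, unitary invariance, expansion to second order -/

section Entropy

variable {m : Type*} [Fintype m] [DecidableEq m]

open scoped Matrix.Norms.L2Operator in
theorem continuous_cfc_of_isHermitian {X : Type*} [TopologicalSpace X] {f : ℝ → ℝ}
    (hf : Continuous f) {a : X → Matrix m m ℂ} (ha : Continuous a)
    (hH : ∀ x, (a x).IsHermitian) : Continuous fun x => cfc f (a x) :=
  Continuous.cfc_of_mem_nhdsSet (s := Set.univ) f Filter.univ_mem ha
    (fun x => (hH x).isSelfAdjoint) hf.continuousOn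

theorem tendsto_cfc_of_isHermitian {X : Type*} {F : Filter X} {f : ℝ → ℝ} (hf : Continuous f)
    {a : X → Matrix m m ℂ} {a₀ : Matrix m m ℂ} (ha : Tendsto a F (𝓝 a₀))
    (hH : ∀ x, (a x).IsHermitian) (hH₀ : a₀.IsHermitian) :
    Tendsto (fun x => cfc f (a x)) F (𝓝 (cfc f a₀)) := by
  have hc : Continuous fun b : {b : Matrix m m ℂ // b.IsHermitian} => cfc f b.1 :=
    continuous_cfc_of_isHermitian hf continuous_subtype_val fun b => b.2
  have ht : Tendsto (fun x => (⟨a x, hH x⟩ : {b : Matrix m m ℂ // b.IsHermitian})) F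
      (𝓝 ⟨a₀, hH₀⟩) := by
    rw [tendsto_subtype_rng]; exact ha
  exact (hc.tendsto ⟨a₀, hH₀⟩).comp ht

theorem continuous_vnEntropy {X : Type*} [TopologicalSpace X] {a : X → Matrix m m ℂ}
    (ha : Continuous a) (hH : ∀ x, (a x).IsHermitian) : Continuous fun x => vnEntropy (a x) := by
  have h := continuous_cfc_of_isHermitian Real.continuous_negMulLog ha hH
  unfold vnEntropy
  exact Complex.continuous_re.comp h.matrix_trace

theorem vnEntropy_eq_sum {A : Matrix m m ℂ} (hA : A.IsHermitian) :
    vnEntropy A = ∑ i, Real.negMulLog (hA.eigenvalues i) := by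
  unfold vnEntropy
  rw [hA.cfc_eq, Matrix.IsHermitian.cfc, Unitary.conjStarAlgAut_apply, Matrix.trace_mul_comm,
    ← Matrix.mul_assoc]
  simp [Matrix.trace]

theorem vnEntropy_conj {A : Matrix m m ℂ} (hA : A.IsHermitian) (u : Matrix.unitaryGroup m ℂ) :
    vnEntropy ((u : Matrix m m ℂ) * A * (u : Matrix m m ℂ)ᴴ) = vnEntropy A := by
  have h := StarAlgHomClass.map_cfc (R := ℝ) (Unitary.conjStarAlgAut ℝ (Matrix m m ℂ) u)
    Real.negMulLog A Real.continuous_negMulLog.continuousOn ?_ hA.isSelfAdjoint ?_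
  · simp only [Unitary.conjStarAlgAut_apply] at h
    unfold vnEntropy
    rw [← Matrix.star_eq_conjTranspose, ← h, Matrix.trace_mul_comm, ← Matrix.mul_assoc]
    simp
  · have : Continuous fun x : Matrix m m ℂ =>
      (u : Matrix m m ℂ) * x * (star u : Matrix.unitaryGroup m ℂ) := by fun_prop
    exact this
  · exact (Matrix.isHermitian_mul_mul_conjTranspose _ hA).isSelfAdjoint

/-- The eigenvector unitary V intertwines the diagonal matrix with the matrix of eigenvalues.
Entrywise this says aᵢ = λⱼ wherever Vᵢⱼ ≠ 0, so f can be applied on both sides. -/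
theorem cfc_diagonal_ofReal (f : ℝ → ℝ) (a : m → ℝ) :
    cfc f (Matrix.diagonal fun i => (a i : ℂ)) = Matrix.diagonal fun i => (f (a i) : ℂ) := by
  have hA : (Matrix.diagonal fun i => (a i : ℂ)).IsHermitian := by
    rw [Matrix.isHermitian_diagonal_iff]
    intro i; simp [IsSelfAdjoint]
  set V : Matrix m m ℂ := (hA.eigenvectorUnitary : Matrix m m ℂ) with hV
  have hVV : V * star V = 1 := Unitary.coe_mul_star_self hA.eigenvectorUnitary
  have hVV' : star V * V = 1 := Unitary.coe_star_mul_self hA.eigenvectorUnitary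
  have h1 : (Matrix.diagonal fun i => (a i : ℂ)) * V =
      V * Matrix.diagonal (fun i => (hA.eigenvalues i : ℂ)) := by
    have h := hA.spectral_theorem
    rw [Unitary.conjStarAlgAut_apply, ← hV] at h
    conv_lhs => rw [h]
    rw [Matrix.mul_assoc, hVV', Matrix.mul_one]
    rfl
  have h2 : (Matrix.diagonal fun i => (f (a i) : ℂ)) * V =
      V * Matrix.diagonal (fun i => (f (hA.eigenvalues i) : ℂ)) := by
    ext i j
    have h3 := congrFun (congrFun h1 i) j
    rw [Matrix.diagonal_mul, Matrix.mul_diagonal] at h3 ⊢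
    by_cases h0 : V i j = 0
    · simp [h0]
    · rw [mul_comm] at h3
      have h4 := mul_left_cancel₀ h0 h3
      rw [Complex.ofReal_inj.mp h4, mul_comm]
  rw [hA.cfc_eq, Matrix.IsHermitian.cfc, Unitary.conjStarAlgAut_apply, ← hV]
  calc V * Matrix.diagonal (fun i => (f (hA.eigenvalues i) : ℂ)) * star V
      = (Matrix.diagonal fun i => (f (a i) : ℂ)) * (V * star V) := by
        rw [← h2, Matrix.mul_assoc]
    _ = _ := by rw [hVV, Matrix.mul_one]

theorem vnEntropy_diagonal (a : m → ℝ) :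
    vnEntropy (Matrix.diagonal fun i => (a i : ℂ)) = ∑ i, Real.negMulLog (a i) := by
  unfold vnEntropy
  rw [cfc_diagonal_ofReal]
  simp [Matrix.trace]

/-- The second divided difference `f[a, a, x]` of `f = negMulLog`. -/
noncomputable def negMulLogDD (a x : ℝ) : ℝ :=
  if x = a then -(2 * a)⁻¹ else
    (Real.negMulLog x - Real.negMulLog a + (Real.log a + 1) * (x - a)) / (x - a) ^ 2

theorem negMulLog_eq_DD (a x : ℝ) :
    Real.negMulLog x = Real.negMulLog a - (Real.log a + 1) * (x - a) +
      (x - a) * negMulLogDD a x * (x - a) := by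
  unfold negMulLogDD
  split_ifs with h
  · simp [h]
  · have : x - a ≠ 0 := sub_ne_zero.mpr h
    field_simp
    ring

/-- Continuity on the whole line, zero included, allows the functional calculus on a perturbed
matrix with no control of the sign of its spectrum. The value filled in at a is half the second
derivative. -/
theorem continuous_negMulLogDD {a : ℝ} (ha : 0 < a) : Continuous (negMulLogDD a) := by
  rw [continuous_iff_continuousAt]
  intro x
  have hN : Continuous fun x => Real.negMulLog x - Real.negMulLog a + (Real.log a + 1) * (x - a) :=
    by have := Real.continuous_negMulLog; fun_prop
  by_cases hx : x = a
  · subst hx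
    have hself : negMulLogDD x x = -(2 * x)⁻¹ := by simp [negMulLogDD]
    rw [continuousAt_iff_punctured_nhds, hself]
    have hpos : ∀ᶠ y in 𝓝[≠] x, y ≠ 0 :=
      (eventually_ne_nhds ha.ne').filter_mono nhdsWithin_le_nhds
    have hlim : Tendsto (fun y => (Real.negMulLog y - Real.negMulLog x +
        (Real.log x + 1) * (y - x)) / (y - x) ^ 2) (𝓝[≠] x) (𝓝 (-(2 * x)⁻¹)) := by
      refine HasDerivAt.lhopital_zero_nhdsNE (f' := fun y => -(Real.log y - Real.log x))
        (g' := fun y => 2 * (y - x)) ?_ ?_ ?_ ?_ ?_ ?_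
      · filter_upwards [hpos] with y hy
        have h1 := (Real.hasDerivAt_negMulLog hy).sub_const (Real.negMulLog x)
        have h2 := ((hasDerivAt_id y).sub_const x).const_mul (Real.log x + 1)
        refine (h1.add h2).congr_deriv ?_
        ring
      · filter_upwards with y
        have h2 := ((hasDerivAt_id y).sub_const x).pow 2
        refine h2.congr_deriv ?_
        simp
      · filter_upwards [self_mem_nhdsWithin] with y hy
        exact mul_ne_zero two_ne_zero (sub_ne_zero.mpr hy)
      · refine (hN.tendsto' x 0 (by simp)).mono_left nhdsWithin_le_nhds
      · refine (Continuous.tendsto' (by fun_prop) x 0 (by simp)).mono_left nhdsWithin_le_nhds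
      · have h := (hasDerivAt_iff_tendsto_slope.mp (Real.hasDerivAt_log ha.ne')).const_mul
          (-(1 / 2) : ℝ)
        have e : -(2 * x)⁻¹ = -(1 / 2) * x⁻¹ := by rw [mul_inv]; ring
        rw [e]
        refine h.congr' ?_
        filter_upwards [self_mem_nhdsWithin] with y hy
        have : y - x ≠ 0 := sub_ne_zero.mpr hy
        rw [slope_def_field]
        field_simp
    refine hlim.congr' ?_
    filter_upwards [self_mem_nhdsWithin] with y hy
    rw [negMulLogDD, if_neg (show y ≠ x from hy)]
  · have h : ContinuousAt (fun y => (Real.negMulLog y - Real.negMulLog a +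
        (Real.log a + 1) * (y - a)) / (y - a) ^ 2) x :=
      hN.continuousAt.div (by fun_prop) (pow_ne_zero 2 (sub_ne_zero.mpr hx))
    refine h.congr ?_
    filter_upwards [eventually_ne_nhds hx] with y hy
    rw [negMulLogDD, if_neg hy]

/-- Exact second-order expansion of the entropy around a diagonal matrix. -/
theorem vnEntropy_eq_klein {B : Matrix m m ℂ} (hB : B.IsHermitian) {a : m → ℝ}
    (ha : ∀ i, 0 < a i) :
    vnEntropy B = vnEntropy (Matrix.diagonal fun i => (a i : ℂ))
      - ∑ i, (Real.log (a i) + 1) * ((B i i).re - a i)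
      + (∑ i, ∑ j, ∑ k, (B - Matrix.diagonal fun i => (a i : ℂ)) i j *
          cfc (negMulLogDD (a i)) B j k *
          (B - Matrix.diagonal fun i => (a i : ℂ)) k i).re := by
  -- Each diagonal entry is expanded around its own base point aᵢ. Row i and column i of B - aᵢ
  -- coincide with those of B minus the diagonal matrix, so B need not commute with that matrix.
  have key : ∀ i, cfc Real.negMulLog B i i = (Real.negMulLog (a i) : ℂ)
      - ((Real.log (a i) + 1 : ℝ) : ℂ) * (B i i - a i) +
      ∑ j, ∑ k, (B - Matrix.diagonal fun i => (a i : ℂ)) i j *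
          cfc (negMulLogDD (a i)) B j k * (B - Matrix.diagonal fun i => (a i : ℂ)) k i := by
    intro i
    have hBs : IsSelfAdjoint B := hB.isSelfAdjoint
    have hc := continuous_negMulLogDD (ha i)
    have e : cfc Real.negMulLog B = (Real.negMulLog (a i) : ℝ) • (1 : Matrix m m ℂ)
        - (Real.log (a i) + 1 : ℝ) • (B - (a i : ℝ) • (1 : Matrix m m ℂ))
        + (B - (a i : ℝ) • (1 : Matrix m m ℂ)) * cfc (negMulLogDD (a i)) B *
          (B - (a i : ℝ) • (1 : Matrix m m ℂ)) := by
      have hsub : cfc (fun x => x - a i) B = B - (a i : ℝ) • (1 : Matrix m m ℂ) := by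
        rw [cfc_sub (fun x => x) (fun _ => a i), cfc_id' ℝ B, cfc_const (a i) B,
          Algebra.algebraMap_eq_smul_one]
      rw [← hsub]
      rw [cfc_congr (g := fun x => (Real.negMulLog (a i) - (Real.log (a i) + 1) * (x - a i)) +
        ((x - a i) * negMulLogDD (a i) x) * (x - a i)) (fun x _ => negMulLog_eq_DD (a i) x)]
      rw [cfc_add _ (fun x => Real.negMulLog (a i) - (Real.log (a i) + 1) * (x - a i))
        (fun x => ((x - a i) * negMulLogDD (a i) x) * (x - a i))]
      rw [cfc_mul (fun x => ((x - a i) * negMulLogDD (a i) x)) (fun x => (x - a i)),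
        cfc_mul (fun x => (x - a i)) (fun x => negMulLogDD (a i) x)]
      rw [cfc_sub (fun _ => Real.negMulLog (a i)) (fun x => (Real.log (a i) + 1) * (x - a i)),
        cfc_const_mul (Real.log (a i) + 1) (fun x => x - a i) B,
        cfc_const (Real.negMulLog (a i)) B, Algebra.algebraMap_eq_smul_one]
    have hl : ∀ j, (B - (a i : ℝ) • (1 : Matrix m m ℂ)) i j =
        (B - Matrix.diagonal fun i => (a i : ℂ)) i j := by
      intro j
      by_cases h : i = j
      · subst h; simp
      · simp [h]
    have hr : ∀ j, (B - (a i : ℝ) • (1 : Matrix m m ℂ)) j i =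
        (B - Matrix.diagonal fun i => (a i : ℂ)) j i := by
      intro j
      by_cases h : j = i
      · subst h; simp
      · simp [h]
    rw [e, Matrix.add_apply, Matrix.mul_apply]
    congr 1
    · simp
    · simp_rw [Matrix.mul_apply, hl, hr, Finset.sum_mul]
      rw [Finset.sum_comm]
  unfold vnEntropy
  rw [cfc_diagonal_ofReal, Matrix.trace, Matrix.trace]
  simp only [Matrix.diag_apply, Matrix.diagonal_apply_eq]
  simp_rw [key]
  simp only [Complex.re_sum, Complex.add_re, Complex.sub_re, Complex.re_ofReal_mul,
    Complex.ofReal_re, Finset.sum_add_distrib, Finset.sum_sub_distrib]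

/-- Second-order expansion of the entropy around a positive diagonal matrix. -/
theorem vnEntropy_expansion {B : ℝ → Matrix m m ℂ} (hB : ∀ ε, (B ε).IsHermitian) {a : m → ℝ}
    (ha : ∀ i, 0 < a i)
    (hΔ : ∀ i j, (fun ε => (B ε - Matrix.diagonal fun i => (a i : ℂ)) i j) =O[𝓝 0]
      fun ε : ℝ => ε) :
    (fun ε => vnEntropy (B ε) - (vnEntropy (Matrix.diagonal fun i => (a i : ℂ))
      - ∑ i, (Real.log (a i) + 1) * ((B ε i i).re - a i)
      + ∑ i, ∑ j, ‖(B ε - Matrix.diagonal fun i => (a i : ℂ)) i j‖ ^ 2 *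
          negMulLogDD (a i) (a j))) =o[𝓝 0] fun ε : ℝ => ε ^ 2 := by
  set D : Matrix m m ℂ := Matrix.diagonal fun i => (a i : ℂ) with hD
  have hDH : D.IsHermitian := by
    rw [hD, Matrix.isHermitian_diagonal_iff]
    intro i; simp [IsSelfAdjoint]
  have hlim : Tendsto B (𝓝 0) (𝓝 D) := by
    refine tendsto_pi_nhds.mpr fun i => tendsto_pi_nhds.mpr fun j => ?_
    have h : Tendsto (fun ε => (B ε - D) i j) (𝓝 0) (𝓝 0) := (hΔ i j).trans_tendsto tendsto_id
    simpa using h.add_const (D i j)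
  -- The two outer factors of the remainder are O(ε) each, so mere continuity of the functional
  -- calculus makes the error of freezing the middle factor o(ε²).
  have hcfc : ∀ i j k, (fun ε => cfc (negMulLogDD (a i)) (B ε) j k -
      cfc (negMulLogDD (a i)) D j k) =o[𝓝 0] fun _ : ℝ => (1 : ℝ) := by
    intro i j k
    rw [isLittleO_one_iff]
    have h := tendsto_cfc_of_isHermitian (continuous_negMulLogDD (ha i)) hlim hB hDH
    have h2 := ((tendsto_pi_nhds.mp (tendsto_pi_nhds.mp h j) k)).sub_const
      (cfc (negMulLogDD (a i)) D j k)
    simpa using h2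
  have hterm : ∀ i j k, (fun ε => (B ε - D) i j * (cfc (negMulLogDD (a i)) (B ε) j k -
      cfc (negMulLogDD (a i)) D j k) * (B ε - D) k i) =o[𝓝 0] fun ε : ℝ => ε ^ 2 := by
    intro i j k
    have h := ((hΔ i j).mul_isLittleO (hcfc i j k)).mul_isBigO (hΔ k i)
    refine h.congr_right fun ε => by ring
  have hsum : (fun ε => (∑ i, ∑ j, ∑ k, (B ε - D) i j * (cfc (negMulLogDD (a i)) (B ε) j k -
      cfc (negMulLogDD (a i)) D j k) * (B ε - D) k i).re) =o[𝓝 0] fun ε : ℝ => ε ^ 2 := by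
    have h : (fun ε => ∑ i, ∑ j, ∑ k, (B ε - D) i j * (cfc (negMulLogDD (a i)) (B ε) j k -
      cfc (negMulLogDD (a i)) D j k) * (B ε - D) k i) =o[𝓝 0] fun ε : ℝ => ε ^ 2 :=
      IsLittleO.fun_sum fun i _ => IsLittleO.fun_sum fun j _ => IsLittleO.fun_sum fun k _ =>
        hterm i j k
    refine IsBigO.trans_isLittleO (IsBigO.of_bound 1 ?_) h
    filter_upwards with ε
    rw [one_mul, Real.norm_eq_abs]
    exact Complex.abs_re_le_norm _
  refine hsum.congr_left fun ε => ?_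
  rw [vnEntropy_eq_klein (hB ε) ha, ← hD]
  have hconj : ∀ i j, (B ε - D) j i = starRingEnd ℂ ((B ε - D) i j) := fun i j =>
    (((hB ε).sub hDH).apply j i).symm
  have hquad : ∑ i, ∑ j, ‖(B ε - D) i j‖ ^ 2 * negMulLogDD (a i) (a j) =
      (∑ i, ∑ j, ∑ k, (B ε - D) i j * cfc (negMulLogDD (a i)) D j k * (B ε - D) k i).re := by
    rw [Complex.re_sum]
    refine Finset.sum_congr rfl fun i _ => ?_
    rw [Complex.re_sum]
    refine Finset.sum_congr rfl fun j _ => ?_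
    rw [hD, cfc_diagonal_ofReal, ← hD, Finset.sum_eq_single j]
    · rw [Matrix.diagonal_apply_eq, hconj i j, mul_right_comm, Complex.mul_conj,
        Complex.normSq_eq_norm_sq, ← Complex.ofReal_mul, Complex.ofReal_re]
    · intro k _ hk
      rw [Matrix.diagonal_apply_ne _ hk.symm]; simp
    · simp
  rw [hquad]
  simp only [mul_sub, sub_mul, Finset.sum_sub_distrib, Complex.sub_re]
  ring

/-- From f[a,a,x] = (f[a,x] - f'(a))/(x - a) and its mirror image, the f[a,x] cancel and the divided
difference of f' = -log - 1 is left. -/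
theorem negMulLogDD_add_of_ne {a x : ℝ} (h : x ≠ a) :
    negMulLogDD a x + negMulLogDD x a = -((Real.log x - Real.log a) / (x - a)) := by
  have : x - a ≠ 0 := sub_ne_zero.mpr h
  have : a - x ≠ 0 := sub_ne_zero.mpr h.symm
  unfold negMulLogDD
  rw [if_neg h, if_neg h.symm, ← neg_sub x a]
  field_simp
  ring

end Entropy

/-! ### Haar averages over the unitary group -/

section Haar

variable {m : Type*} [Fintype m] [DecidableEq m]

instance haarUnitary_isHaarMeasure : (haarUnitary m).IsHaarMeasure := by
  unfold haarUnitary; infer_instance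

instance haarUnitary_isProbabilityMeasure : IsProbabilityMeasure (haarUnitary m) :=
  ⟨Measure.haarMeasure_self (K₀ := (⊤ : TopologicalSpace.PositiveCompacts _))⟩

/-- A right translate is again a Haar probability measure, and such a measure is unique. -/
instance haarUnitary_isMulRightInvariant : (haarUnitary m).IsMulRightInvariant :=
  ⟨fun g => by
    have : IsProbabilityMeasure (Measure.map (· * g) (haarUnitary m)) :=
      Measure.isProbabilityMeasure_map (by fun_prop)
    exact Measure.isHaarMeasure_eq_of_isProbabilityMeasure _ _⟩

theorem integrable_haarUnitary {f : Matrix.unitaryGroup m ℂ → ℝ} (hf : Continuous f) :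
    Integrable f (haarUnitary m) :=
  hf.integrable_of_hasCompactSupport (HasCompactSupport.of_compactSpace f)

/-- The matrix `U† M U`. -/
def conjU (U : Matrix.unitaryGroup m ℂ) (M : Matrix m m ℂ) : Matrix m m ℂ :=
  (U : Matrix m m ℂ)ᴴ * M * (U : Matrix m m ℂ)

theorem conjU_mul (U W : Matrix.unitaryGroup m ℂ) (M : Matrix m m ℂ) :
    conjU (U * W) M = conjU W (conjU U M) := by
  simp [conjU, Matrix.mul_assoc, Matrix.conjTranspose_mul]

theorem continuous_conjU (M : Matrix m m ℂ) :
    Continuous fun U : Matrix.unitaryGroup m ℂ => conjU U M := by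
  unfold conjU
  fun_prop

theorem continuous_conjU_apply (M : Matrix m m ℂ) (i j : m) :
    Continuous fun U : Matrix.unitaryGroup m ℂ => conjU U M i j :=
  (continuous_conjU M).matrix_elem i j

theorem unitary_mul_conjTranspose (U : Matrix.unitaryGroup m ℂ) :
    (U : Matrix m m ℂ) * (U : Matrix m m ℂ)ᴴ = 1 := Unitary.coe_mul_star_self U

theorem unitary_conjTranspose_mul (U : Matrix.unitaryGroup m ℂ) :
    (U : Matrix m m ℂ)ᴴ * (U : Matrix m m ℂ) = 1 := Unitary.coe_star_mul_self U

theorem trace_conjU (U : Matrix.unitaryGroup m ℂ) (M : Matrix m m ℂ) :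
    (conjU U M).trace = M.trace := by
  rw [conjU, Matrix.trace_mul_comm, ← Matrix.mul_assoc, unitary_mul_conjTranspose, Matrix.one_mul]

theorem sum_norm_sq_eq_trace {p q : Type*} [Fintype p] [Fintype q] (M : Matrix p q ℂ) :
    ((∑ i, ∑ j, ‖M i j‖ ^ 2 : ℝ) : ℂ) = (Mᴴ * M).trace := by
  rw [Finset.sum_comm]
  simp only [Matrix.trace, Matrix.diag_apply, Matrix.mul_apply, Matrix.conjTranspose_apply]
  push_cast
  refine Finset.sum_congr rfl fun i _ => Finset.sum_congr rfl fun j _ => ?_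
  rw [← Complex.conj_mul']; rfl

theorem sum_norm_sq_conjU (U : Matrix.unitaryGroup m ℂ) (M : Matrix m m ℂ) :
    ∑ i, ∑ j, ‖conjU U M i j‖ ^ 2 = ∑ i, ∑ j, ‖M i j‖ ^ 2 := by
  apply Complex.ofReal_injective
  rw [sum_norm_sq_eq_trace, sum_norm_sq_eq_trace]
  have : (conjU U M)ᴴ * conjU U M = conjU U (Mᴴ * M) := by
    simp only [conjU, Matrix.conjTranspose_mul, Matrix.conjTranspose_conjTranspose]
    calc _ = (U : Matrix m m ℂ)ᴴ * Mᴴ * ((U : Matrix m m ℂ) * (U : Matrix m m ℂ)ᴴ) * M * U := by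
          simp only [Matrix.mul_assoc]
      _ = _ := by rw [unitary_mul_conjTranspose]; simp only [Matrix.mul_assoc, Matrix.one_mul]
  rw [this, trace_conjU]

/-- The Haar average of `|⟨i| U† M U |j⟩|²`. -/
noncomputable def haarSq (M : Matrix m m ℂ) (i j : m) : ℝ :=
  ∫ U, ‖conjU U M i j‖ ^ 2 ∂(haarUnitary m)

theorem haarSq_nonneg (M : Matrix m m ℂ) (i j : m) : 0 ≤ haarSq M i j :=
  integral_nonneg fun _ => by positivity

theorem integral_conjU (M : Matrix m m ℂ) (W : Matrix.unitaryGroup m ℂ)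
    (g : Matrix m m ℂ → ℝ) :
    ∫ U, g (conjU W (conjU U M)) ∂(haarUnitary m) = ∫ U, g (conjU U M) ∂(haarUnitary m) := by
  rw [← integral_mul_right_eq_self (fun U => g (conjU U M)) W]
  simp_rw [conjU_mul]

theorem haarSq_perm (M : Matrix m m ℂ) (σ : Equiv.Perm m) (i j : m) :
    haarSq M (σ i) (σ j) = haarSq M i j := by
  have hP : (σ⁻¹).permMatrix ℂ ∈ Matrix.unitaryGroup m ℂ := by
    rw [Matrix.mem_unitaryGroup_iff, Matrix.star_eq_conjTranspose, Matrix.conjTranspose_permMatrix,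
      ← Matrix.permMatrix_mul]
    simp
  have h := integral_conjU M ⟨_, hP⟩ (fun X => ‖X i j‖ ^ 2)
  unfold haarSq
  rw [← h]
  refine integral_congr_ae (Eventually.of_forall fun U => ?_)
  simp only [conjU]
  rw [Matrix.conjTranspose_permMatrix]
  simp [PEquiv.toMatrix_toPEquiv_mul, PEquiv.mul_toMatrix_toPEquiv, Equiv.Perm.permMatrix]
  rfl

theorem haarSq_offDiag (M : Matrix m m ℂ) {i j k l : m} (hij : i ≠ j) (hkl : k ≠ l) :
    haarSq M i j = haarSq M k l := by
  set τ := Equiv.swap i k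
  have h1 : τ i = k := Equiv.swap_apply_left i k
  have h2 : k ≠ τ j := fun h => hij (τ.injective (h1.trans h))
  have h := haarSq_perm M (Equiv.swap (τ j) l * τ) i j
  rw [← h, Equiv.Perm.mul_apply, Equiv.Perm.mul_apply, h1, Equiv.swap_apply_left,
    Equiv.swap_apply_of_ne_of_ne h2 hkl]

theorem haarSq_diag (M : Matrix m m ℂ) (i j : m) : haarSq M i i = haarSq M j j := by
  have h := haarSq_perm M (Equiv.swap i j) i i
  rw [← h, Equiv.swap_apply_left]

/-- A unitary whose `i`-th column is `(e_i + ω e_j) / √2`. -/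
theorem exists_unitary_column {i j : m} (hij : i ≠ j) {ω : ℂ} (hω : ‖ω‖ = 1) :
    ∃ W : Matrix.unitaryGroup m ℂ, ∀ X : Matrix m m ℂ,
      conjU W X i i = (X i i + ω * X i j + starRingEnd ℂ ω * X j i + X j j) / 2 := by
  obtain ⟨s, hs0, hs1, hs⟩ : ∃ s : ℝ, 0 < s ∧ s < 1 ∧ s * s = 1 / 2 :=
    ⟨√(1 / 2), by positivity, by rw [Real.sqrt_lt' one_pos]; norm_num,
      Real.mul_self_sqrt (by norm_num)⟩
  have hsc : (s : ℂ) * s = 1 / 2 := by rw [← Complex.ofReal_mul, hs]; simp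
  have h1s : (1 : ℂ) - s ≠ 0 := by
    rw [← Complex.ofReal_one, ← Complex.ofReal_sub, Complex.ofReal_ne_zero]; linarith
  have hωω : starRingEnd ℂ ω * ω = 1 := by rw [Complex.conj_mul', hω]; simp
  -- Householder reflection: v is eᵢ minus the wanted column s(eᵢ + ω eⱼ), with s = 1/√2. Since ‖v‖²
  -- = 2(1 - s), the matrix 1 - vv†/(1 - s) is a self-adjoint involution and maps eᵢ to that column.
  set v : m → ℂ := Pi.single i (1 - s : ℂ) - Pi.single j (s * ω) with hv
  have hsv : star v = Pi.single i (1 - s : ℂ) - Pi.single j (s * starRingEnd ℂ ω) := by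
    rw [hv, star_sub, Pi.star_single, Pi.star_single]
    simp
  have hvv : star v ⬝ᵥ v = 2 * (1 - s) := by
    rw [hsv, sub_dotProduct, single_dotProduct, single_dotProduct, hv]
    simp only [Pi.sub_apply, Pi.single_eq_same, Pi.single_eq_of_ne hij, Pi.single_eq_of_ne hij.symm]
    linear_combination (2 + starRingEnd ℂ ω * ω - 1) * hsc + 1 / 2 * hωω
  set W : Matrix m m ℂ := 1 - (1 - s : ℂ)⁻¹ • Matrix.vecMulVec v (star v) with hW
  have hWs : star W = W := by
    rw [hW, star_sub, star_one, star_smul, Matrix.star_eq_conjTranspose,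
      Matrix.conjTranspose_vecMulVec, star_star]
    simp
  have hWW : W * star W = 1 := by
    rw [hWs, hW, sub_mul, one_mul, mul_sub, mul_one, smul_mul_smul_comm,
      Matrix.vecMulVec_mul_vecMulVec, hvv, Matrix.vecMulVec_smul, smul_smul]
    rw [show (1 - s : ℂ)⁻¹ * (1 - s : ℂ)⁻¹ * (2 * (1 - s)) = 2 * (1 - s : ℂ)⁻¹ by field_simp,
      two_mul, add_smul]
    abel
  refine ⟨⟨W, Matrix.mem_unitaryGroup_iff.mpr hWW⟩, fun X => ?_⟩
  have hcol : ∀ k, W k i = (Pi.single i (s : ℂ) + Pi.single j (s * ω) : m → ℂ) k := by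
    intro k
    have : W k i = (Pi.single i 1 : m → ℂ) k - v k := by
      rw [hW, Matrix.sub_apply, Matrix.smul_apply, Matrix.vecMulVec_apply, hsv, Matrix.one_apply,
        Pi.single_apply]
      simp only [Pi.sub_apply, Pi.single_eq_same, Pi.single_eq_of_ne hij, smul_eq_mul]
      field_simp
      ring
    rw [this, hv]
    simp only [Pi.sub_apply, Pi.add_apply, Pi.single_apply]
    split_ifs <;> ring
  have hcol' : ∀ k, Wᴴ i k =
      (Pi.single i (s : ℂ) + Pi.single j (s * starRingEnd ℂ ω) : m → ℂ) k := by
    intro k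
    rw [Matrix.conjTranspose_apply, hcol]
    simp only [Pi.add_apply, Pi.single_apply]
    split_ifs <;> simp
  have e1 : conjU ⟨W, Matrix.mem_unitaryGroup_iff.mpr hWW⟩ X i i =
      (Pi.single i (s : ℂ) + Pi.single j (s * starRingEnd ℂ ω) : m → ℂ) ⬝ᵥ X *ᵥ
        (Pi.single i (s : ℂ) + Pi.single j (s * ω) : m → ℂ) := by
    rw [conjU, Matrix.mul_assoc, Matrix.mul_apply, dotProduct]
    refine Finset.sum_congr rfl fun k _ => ?_
    rw [← hcol', Matrix.mul_apply, Matrix.mulVec, dotProduct]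
    simp_rw [← hcol]
  rw [e1, Matrix.mulVec_add, add_dotProduct, single_dotProduct, single_dotProduct,
    Pi.add_apply, Pi.add_apply, Matrix.mulVec_single, Matrix.mulVec_single]
  simp
  linear_combination (X i i + ω * X i j + starRingEnd ℂ ω * X j i
    + starRingEnd ℂ ω * ω * X j j) * hsc + X j j / 2 * hωω

/-- By permutation invariance there are only two unknowns, the diagonal average a and the
off-diagonal average b. The average of Mₖₖ times the conjugate of Mₗₗ has real part a - b for k ≠ l,
so the invariance of the trace and of the Hilbert-Schmidt norm gives two linear equations, solved
for b. -/
theorem haarSq_eq (M : Matrix m m ℂ) {i j : m} (hij : i ≠ j) :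
    haarSq M i j = (Fintype.card m * ∑ i, ∑ j, ‖M i j‖ ^ 2 - ‖M.trace‖ ^ 2) /
      (Fintype.card m * ((Fintype.card m : ℝ) ^ 2 - 1)) := by
  have hcont : ∀ i j, Continuous fun U : Matrix.unitaryGroup m ℂ => conjU U M i j :=
    continuous_conjU_apply M
  set a := haarSq M i i with ha
  set b := haarSq M i j with hb
  set C : m → m → ℝ := fun k l =>
    ∫ U, (conjU U M k k * starRingEnd ℂ (conjU U M l l)).re ∂(haarUnitary m) with hC
  have hCd : ∀ k, C k k = a := by
    intro k
    rw [ha, ← haarSq_diag M k i]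
    refine integral_congr_ae (Eventually.of_forall fun U => ?_)
    simp only [Complex.mul_conj, Complex.normSq_eq_norm_sq, Complex.ofReal_re]
  -- Summing the squared modulus over ω = 1, -1, i, -i removes every cross term except that between
  -- the two diagonal entries, because ω and ω² both sum to zero. This gives 4a = 2a + 2b + 2 C k l.
  have hCo : ∀ k l, k ≠ l → C k l = a - b := by
    intro k l hkl
    have h4 : ∀ ω : ℂ, ‖ω‖ = 1 → a = ∫ U, ‖(conjU U M k k + ω * conjU U M k l +
        starRingEnd ℂ ω * conjU U M l k + conjU U M l l) / 2‖ ^ 2 ∂(haarUnitary m) := by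
      intro ω hω
      obtain ⟨W, hW⟩ := exists_unitary_column hkl hω
      rw [ha, ← haarSq_diag M k i, haarSq, ← integral_conjU M W (fun X => ‖X k k‖ ^ 2)]
      simp_rw [hW]
    have hint : ∀ ω : ℂ, Integrable (fun U => ‖(conjU U M k k + ω * conjU U M k l +
        starRingEnd ℂ ω * conjU U M l k + conjU U M l l) / 2‖ ^ 2) (haarUnitary m) := by
      intro ω
      refine integrable_haarUnitary ?_
      have := hcont k k; have := hcont k l; have := hcont l k; have := hcont l l
      fun_prop
    have hI : ∀ p q, Integrable (fun U => ‖conjU U M p q‖ ^ 2) (haarUnitary m) := fun p q =>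
      integrable_haarUnitary (by have := hcont p q; fun_prop)
    have hIC : Integrable (fun U => (conjU U M k k * starRingEnd ℂ (conjU U M l l)).re)
        (haarUnitary m) := integrable_haarUnitary
          (by have := hcont k k; have := hcont l l; fun_prop)
    have e1 := h4 1 (by simp)
    have e2 := h4 (-1) (by simp)
    have e3 := h4 Complex.I (by simp)
    have e4 := h4 (-Complex.I) (by simp)
    have hsum : 4 * a = ∫ U, (‖conjU U M k k‖ ^ 2 + ‖conjU U M l l‖ ^ 2 + ‖conjU U M k l‖ ^ 2 +
        ‖conjU U M l k‖ ^ 2 + 2 * (conjU U M k k * starRingEnd ℂ (conjU U M l l)).re)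
        ∂(haarUnitary m) := by
      calc 4 * a = a + a + a + a := by ring
        _ = _ := by
          nth_rewrite 1 [e1]
          nth_rewrite 1 [e2]
          nth_rewrite 1 [e3]
          nth_rewrite 1 [e4]
          rw [← integral_add (hint _) (hint _), ← integral_add ((hint _).fun_add (hint _)) (hint _),
            ← integral_add (((hint _).fun_add (hint _)).fun_add (hint _)) (hint _)]
          refine integral_congr_ae (Eventually.of_forall fun U => ?_)
          simp only [← Complex.normSq_eq_norm_sq, Complex.normSq_apply]
          simp
          ring
    rw [integral_add (((((hI _ _).fun_add (hI _ _)).fun_add (hI _ _)).fun_add (hI _ _))) (hIC.const_mul 2),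
      integral_add ((((hI _ _).fun_add (hI _ _)).fun_add (hI _ _))) (hI _ _),
      integral_add (((hI _ _).fun_add (hI _ _))) (hI _ _), integral_add (hI _ _) (hI _ _),
      integral_const_mul] at hsum
    have f1 : haarSq M k k = a := haarSq_diag M k i
    have f2 : haarSq M l l = a := haarSq_diag M l i
    have f3 : haarSq M k l = b := haarSq_offDiag M hkl hij
    have f4 : haarSq M l k = b := haarSq_offDiag M hkl.symm hij
    unfold haarSq at f1 f2 f3 f4
    rw [f1, f2, f3, f4] at hsum
    change C k l = a - b
    simp only [hC]
    linarith
  have htr : ‖M.trace‖ ^ 2 = ∑ k, ∑ l, C k l := by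
    have h1 : ∀ U : Matrix.unitaryGroup m ℂ, ‖M.trace‖ ^ 2 =
        ∑ k, ∑ l, (conjU U M k k * starRingEnd ℂ (conjU U M l l)).re := by
      intro U
      rw [← trace_conjU U M, ← Complex.normSq_eq_norm_sq, ← Complex.ofReal_re (Complex.normSq _),
        ← Complex.mul_conj]
      simp only [Matrix.trace, Matrix.diag_apply, map_sum, Finset.sum_mul_sum, Complex.re_sum]
    have h2 : ‖M.trace‖ ^ 2 = ∫ _U : Matrix.unitaryGroup m ℂ, ‖M.trace‖ ^ 2 ∂(haarUnitary m) := by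
      simp
    rw [h2, integral_congr_ae (Eventually.of_forall h1), integral_finsetSum]
    · refine Finset.sum_congr rfl fun k _ => ?_
      rw [integral_finsetSum]
      exact fun l _ => integrable_haarUnitary
        (by have := hcont k k; have := hcont l l; fun_prop)
    · exact fun k _ => integrable_finsetSum _ fun l _ => integrable_haarUnitary
        (by have := hcont k k; have := hcont l l; fun_prop)
  have hnorm : ∑ k, ∑ l, ‖M k l‖ ^ 2 = ∑ k, ∑ l, haarSq M k l := by
    have h2 : ∑ k, ∑ l, ‖M k l‖ ^ 2 =
        ∫ _U : Matrix.unitaryGroup m ℂ, ∑ k, ∑ l, ‖M k l‖ ^ 2 ∂(haarUnitary m) := by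
      simp
    rw [h2, integral_congr_ae (Eventually.of_forall fun U => (sum_norm_sq_conjU U M).symm),
      integral_finsetSum]
    · refine Finset.sum_congr rfl fun k _ => ?_
      rw [integral_finsetSum]
      · rfl
      exact fun l _ => integrable_haarUnitary (by have := hcont k l; fun_prop)
    · exact fun k _ => integrable_finsetSum _ fun l _ => integrable_haarUnitary
        (by have := hcont k l; fun_prop)
  have hsumif : ∀ (g : m → m → ℝ) (x y : ℝ), (∀ k, g k k = x) → (∀ k l, k ≠ l → g k l = y) →
      ∑ k, ∑ l, g k l = Fintype.card m * (x + (Fintype.card m - 1) * y) := by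
    intro g x y hx hy
    have : ∀ k l, g k l = (if k = l then x - y else 0) + y := by
      intro k l
      split_ifs with h
      · subst h; rw [hx]; ring
      · rw [hy k l h]; ring
    simp_rw [this, Finset.sum_add_distrib]
    simp
    ring
  rw [hsumif _ a (a - b) hCd hCo] at htr
  rw [hsumif _ a b (fun k => haarSq_diag M k i) (fun k l h => haarSq_offDiag M h hij)] at hnorm
  have hcard : (1 : ℝ) < Fintype.card m := by
    exact_mod_cast Fintype.one_lt_card_iff.mpr ⟨i, j, hij⟩
  rw [htr, hnorm, eq_div_iff (by nlinarith [sq_nonneg ((Fintype.card m : ℝ) - 1)] )]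
  ring

end Haar

/-! ### Encodings, their Kraus operators and output states -/

section Encoding

variable {l κ β : Type*} [Fintype l] [DecidableEq l] [Fintype κ] [DecidableEq κ]
  [Fintype β] [DecidableEq β]

/-- The Kraus operator of `K` for the environment basis vector `(c, b)`. -/
def kraus (K : Matrix ((l × κ) × β) l ℂ) (c : κ) (b : β) : Matrix l l ℂ :=
  fun i j => K ((i, c), b) j

/-- `K` conjugated by a unitary of the logical space: `(U† ⊗ 1 ⊗ 1) K U`. -/
def rot (U : Matrix.unitaryGroup l ℂ) (K : Matrix ((l × κ) × β) l ℂ) :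
    Matrix ((l × κ) × β) l ℂ :=
  fun x j => conjU U (kraus K x.1.2 x.2) x.1.1 j

/-- The state of `A` produced by the encoding `K`. -/
def outA (K : Matrix ((l × κ) × β) l ℂ) (σ : Matrix l l ℂ) : Matrix (l × κ) (l × κ) ℂ :=
  ptraceSnd (K * σ * Kᴴ)

/-- The state of `A₁` produced by the encoding `K`. -/
def chan (K : Matrix ((l × κ) × β) l ℂ) (σ : Matrix l l ℂ) : Matrix l l ℂ :=
  ptraceSnd (outA K σ)

/-- The entanglement fidelity of `chan K`. -/
noncomputable def fid (K : Matrix ((l × κ) × β) l ℂ) : ℝ :=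
  (∑ c, ∑ b, ‖(kraus K c b).trace‖ ^ 2) / (Fintype.card l : ℝ) ^ 2

theorem ptraceSnd_isHermitian {a b : Type*} [Fintype b] {X : Matrix (a × b) (a × b) ℂ}
    (hX : X.IsHermitian) : (ptraceSnd X).IsHermitian := by
  ext i j
  simp only [ptraceSnd, Matrix.conjTranspose_apply, star_sum]
  exact Finset.sum_congr rfl fun k _ => hX.apply _ _

theorem trace_ptraceSnd {a b : Type*} [Fintype a] [Fintype b] (X : Matrix (a × b) (a × b) ℂ) :
    (ptraceSnd X).trace = X.trace := by
  simp [ptraceSnd, Matrix.trace, Fintype.sum_prod_type]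

theorem outA_isHermitian (K : Matrix ((l × κ) × β) l ℂ) {σ : Matrix l l ℂ}
    (hσ : σ.IsHermitian) : (outA K σ).IsHermitian :=
  ptraceSnd_isHermitian (Matrix.isHermitian_mul_mul_conjTranspose K hσ)

theorem chan_isHermitian (K : Matrix ((l × κ) × β) l ℂ) {σ : Matrix l l ℂ}
    (hσ : σ.IsHermitian) : (chan K σ).IsHermitian :=
  ptraceSnd_isHermitian (outA_isHermitian K hσ)

theorem rot_eq (U : Matrix.unitaryGroup l ℂ) (K : Matrix ((l × κ) × β) l ℂ) :
    rot U K = (((U : Matrix l l ℂ)ᴴ ⊗ₖ (1 : Matrix κ κ ℂ)) ⊗ₖ (1 : Matrix β β ℂ)) * K *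
      (U : Matrix l l ℂ) := by
  ext x j
  obtain ⟨⟨i, c⟩, b⟩ := x
  simp only [rot, conjU, kraus, Matrix.mul_apply, Fintype.sum_prod_type,
    Matrix.kroneckerMap_apply, Matrix.one_apply]
  refine Finset.sum_congr rfl fun k _ => ?_
  congr 1
  refine Finset.sum_congr rfl fun i' _ => ?_
  rw [Finset.sum_eq_single c, Finset.sum_eq_single b] <;> simp +contextual [eq_comm]

theorem ptraceSnd_kronecker_one {a b : Type*} [Fintype a] [Fintype b] [DecidableEq b]
    (R : Matrix a a ℂ) (X : Matrix (a × b) (a × b) ℂ) :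
    ptraceSnd ((R ⊗ₖ (1 : Matrix b b ℂ)) * X * (R ⊗ₖ (1 : Matrix b b ℂ))ᴴ) =
      R * ptraceSnd X * Rᴴ := by
  ext x y
  have h1 : ∀ k, ((R ⊗ₖ (1 : Matrix b b ℂ)) * X * (R ⊗ₖ (1 : Matrix b b ℂ))ᴴ) (x, k) (y, k) =
      ∑ y', (∑ x', R x x' * X (x', k) (y', k)) * star (R y y') := by
    intro k
    simp only [Matrix.mul_apply, Fintype.sum_prod_type, Matrix.conjTranspose_apply,
      Matrix.kroneckerMap_apply, Matrix.one_apply]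
    refine Finset.sum_congr rfl fun y' _ => ?_
    rw [Finset.sum_eq_single k]
    · simp
    · intro b _ hb; simp [hb.symm]
    · simp
  simp only [ptraceSnd, h1, Matrix.mul_apply, Matrix.conjTranspose_apply]
  rw [Finset.sum_comm]
  refine Finset.sum_congr rfl fun y' _ => ?_
  rw [← Finset.sum_mul, Finset.sum_comm]
  simp only [Finset.mul_sum]

theorem ptraceSnd_one_kronecker {a b : Type*} [Fintype a] [DecidableEq a] [Fintype b]
    [DecidableEq b] (R : Matrix.unitaryGroup b ℂ) (X : Matrix (a × b) (a × b) ℂ) :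
    ptraceSnd (((1 : Matrix a a ℂ) ⊗ₖ (R : Matrix b b ℂ)) * X *
      ((1 : Matrix a a ℂ) ⊗ₖ (R : Matrix b b ℂ))ᴴ) = ptraceSnd X := by
  ext x y
  set Y : Matrix b b ℂ := fun k k' => X (x, k) (y, k') with hY
  have h1 : ∀ k, (((1 : Matrix a a ℂ) ⊗ₖ (R : Matrix b b ℂ)) * X *
      ((1 : Matrix a a ℂ) ⊗ₖ (R : Matrix b b ℂ))ᴴ) (x, k) (y, k) =
      ((R : Matrix b b ℂ) * Y * (R : Matrix b b ℂ)ᴴ) k k := by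
    intro k
    simp only [Matrix.mul_apply, Fintype.sum_prod_type, Matrix.conjTranspose_apply,
      Matrix.kroneckerMap_apply, Matrix.one_apply]
    rw [Finset.sum_eq_single y]
    · refine Finset.sum_congr rfl fun k' _ => ?_
      rw [Finset.sum_eq_single x]
      · simp [hY]
      · intro b _ hb; simp [hb.symm]
      · simp
    · intro b _ hb; simp [hb.symm]
    · simp
  simp only [ptraceSnd, h1]
  change ((R : Matrix b b ℂ) * Y * (R : Matrix b b ℂ)ᴴ).trace = Y.trace
  rw [Matrix.trace_mul_comm, ← Matrix.mul_assoc, unitary_conjTranspose_mul, Matrix.one_mul]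

theorem outA_kronecker_mul (RA : Matrix (l × κ) (l × κ) ℂ) (RB : Matrix.unitaryGroup β ℂ)
    (K : Matrix ((l × κ) × β) l ℂ) (σ : Matrix l l ℂ) :
    outA ((RA ⊗ₖ (RB : Matrix β β ℂ)) * K) σ = RA * outA K σ * RAᴴ := by
  have h : RA ⊗ₖ (RB : Matrix β β ℂ) =
      (RA ⊗ₖ (1 : Matrix β β ℂ)) * ((1 : Matrix (l × κ) (l × κ) ℂ) ⊗ₖ (RB : Matrix β β ℂ)) := by
    rw [← Matrix.mul_kronecker_mul, Matrix.mul_one, Matrix.one_mul]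
  unfold outA
  rw [← ptraceSnd_one_kronecker RB (K * σ * Kᴴ), ← ptraceSnd_kronecker_one, h]
  simp only [Matrix.conjTranspose_mul, Matrix.mul_assoc]

theorem chan_kronecker_mul (u : Matrix l l ℂ) (K : Matrix ((l × κ) × β) l ℂ) (σ : Matrix l l ℂ) :
    chan (((u ⊗ₖ (1 : Matrix κ κ ℂ)) ⊗ₖ (1 : Matrix β β ℂ)) * K) σ = u * chan K σ * uᴴ := by
  have h := outA_kronecker_mul (u ⊗ₖ (1 : Matrix κ κ ℂ)) (1 : Matrix.unitaryGroup β ℂ) K σ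
  rw [Submonoid.coe_one] at h
  unfold chan
  rw [h, ptraceSnd_kronecker_one]

theorem outA_mul (K : Matrix ((l × κ) × β) l ℂ) (U : Matrix l l ℂ) (σ : Matrix l l ℂ) :
    outA (K * U) σ = outA K (U * σ * Uᴴ) := by
  unfold outA
  simp only [Matrix.conjTranspose_mul, Matrix.mul_assoc]

theorem kronecker_unitary {a b : Type*} [Fintype a] [DecidableEq a] [Fintype b] [DecidableEq b]
    (R : Matrix.unitaryGroup a ℂ) (S : Matrix.unitaryGroup b ℂ) :
    ((R : Matrix a a ℂ) ⊗ₖ (S : Matrix b b ℂ)) ∈ Matrix.unitaryGroup (a × b) ℂ :=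
  Matrix.kronecker_mem_unitary R.2 S.2

theorem vnEntropy_outA_kronecker (RA : Matrix.unitaryGroup (l × κ) ℂ)
    (RB : Matrix.unitaryGroup β ℂ) (K : Matrix ((l × κ) × β) l ℂ) {σ : Matrix l l ℂ}
    (hσ : σ.IsHermitian) :
    vnEntropy (outA (((RA : Matrix (l × κ) (l × κ) ℂ) ⊗ₖ (RB : Matrix β β ℂ)) * K) σ) =
      vnEntropy (outA K σ) := by
  rw [outA_kronecker_mul, vnEntropy_conj (outA_isHermitian K hσ)]

theorem vnEntropy_chan_kronecker (u : Matrix.unitaryGroup l ℂ)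
    (K : Matrix ((l × κ) × β) l ℂ) {σ : Matrix l l ℂ} (hσ : σ.IsHermitian) :
    vnEntropy (chan ((((u : Matrix l l ℂ) ⊗ₖ (1 : Matrix κ κ ℂ)) ⊗ₖ (1 : Matrix β β ℂ)) * K) σ) =
      vnEntropy (chan K σ) := by
  rw [chan_kronecker_mul, vnEntropy_conj (chan_isHermitian K hσ)]

theorem isHermitian_conj_unitary (U : Matrix l l ℂ) {σ : Matrix l l ℂ}
    (hσ : σ.IsHermitian) : (U * σ * Uᴴ).IsHermitian :=
  Matrix.isHermitian_mul_mul_conjTranspose U hσ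

theorem vnEntropy_outA_rot (U : Matrix.unitaryGroup l ℂ) (K : Matrix ((l × κ) × β) l ℂ)
    {σ : Matrix l l ℂ} (hσ : σ.IsHermitian) :
    vnEntropy (outA (rot U K) σ) =
      vnEntropy (outA K ((U : Matrix l l ℂ) * σ * (U : Matrix l l ℂ)ᴴ)) := by
  rw [rot_eq, outA_mul]
  exact vnEntropy_outA_kronecker ⟨_, kronecker_unitary (star U) (1 : Matrix.unitaryGroup κ ℂ)⟩ 1 K
    (isHermitian_conj_unitary _ hσ)

theorem vnEntropy_chan_rot (U : Matrix.unitaryGroup l ℂ) (K : Matrix ((l × κ) × β) l ℂ)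
    {σ : Matrix l l ℂ} (hσ : σ.IsHermitian) :
    vnEntropy (chan (rot U K) σ) =
      vnEntropy (chan K ((U : Matrix l l ℂ) * σ * (U : Matrix l l ℂ)ᴴ)) := by
  rw [rot_eq, chan, outA_mul]
  exact vnEntropy_chan_kronecker (star U) K (isHermitian_conj_unitary _ hσ)

theorem rot_conjTranspose_mul (U : Matrix.unitaryGroup l ℂ) (K : Matrix ((l × κ) × β) l ℂ) :
    (rot U K)ᴴ * rot U K = conjU U (Kᴴ * K) := by
  have h := unitary_conjTranspose_mul (⟨_, kronecker_unitary ⟨_, kronecker_unitary (star U)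
    (1 : Matrix.unitaryGroup κ ℂ)⟩ (1 : Matrix.unitaryGroup β ℂ)⟩ :
    Matrix.unitaryGroup ((l × κ) × β) ℂ)
  rw [rot_eq, conjU, Matrix.conjTranspose_mul, Matrix.conjTranspose_mul]
  calc _ = (U : Matrix l l ℂ)ᴴ * (Kᴴ * (((((U : Matrix l l ℂ)ᴴ ⊗ₖ (1 : Matrix κ κ ℂ)) ⊗ₖ
        (1 : Matrix β β ℂ)))ᴴ * (((U : Matrix l l ℂ)ᴴ ⊗ₖ (1 : Matrix κ κ ℂ)) ⊗ₖ
        (1 : Matrix β β ℂ))) * K) * (U : Matrix l l ℂ) := by simp only [Matrix.mul_assoc]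
    _ = _ := by
      rw [show (((((U : Matrix l l ℂ)ᴴ ⊗ₖ (1 : Matrix κ κ ℂ)) ⊗ₖ
        (1 : Matrix β β ℂ)))ᴴ * (((U : Matrix l l ℂ)ᴴ ⊗ₖ (1 : Matrix κ κ ℂ)) ⊗ₖ
        (1 : Matrix β β ℂ))) = 1 from h, Matrix.mul_one]

theorem rot_isometry (U : Matrix.unitaryGroup l ℂ) {K : Matrix ((l × κ) × β) l ℂ}
    (hK : Kᴴ * K = 1) : (rot U K)ᴴ * rot U K = 1 := by
  rw [rot_conjTranspose_mul, hK, conjU, Matrix.mul_one, unitary_conjTranspose_mul]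

theorem outA_diagonal_apply (K : Matrix ((l × κ) × β) l ℂ) (p : l → ℝ) (x y : l × κ) :
    outA K (Matrix.diagonal fun i => (p i : ℂ)) x y =
      ∑ b, ∑ j, K (x, b) j * p j * starRingEnd ℂ (K (y, b) j) := by
  refine Finset.sum_congr rfl fun b _ => ?_
  rw [Matrix.mul_apply]
  simp only [Matrix.mul_diagonal, Matrix.conjTranspose_apply]
  rfl

theorem outA_diagonal_re (K : Matrix ((l × κ) × β) l ℂ) (p : l → ℝ) (x : l × κ) :
    (outA K (Matrix.diagonal fun i => (p i : ℂ)) x x).re = ∑ b, ∑ j, p j * ‖K (x, b) j‖ ^ 2 := by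
  rw [outA_diagonal_apply]
  simp only [Complex.re_sum]
  refine Finset.sum_congr rfl fun b _ => Finset.sum_congr rfl fun j _ => ?_
  rw [mul_right_comm, Complex.mul_conj, Complex.normSq_eq_norm_sq, ← Complex.ofReal_mul,
    Complex.ofReal_re, mul_comm]

theorem chan_diagonal_re (K : Matrix ((l × κ) × β) l ℂ) (p : l → ℝ) (i : l) :
    (chan K (Matrix.diagonal fun i => (p i : ℂ)) i i).re =
      ∑ j, p j * ∑ c, ∑ b, ‖K ((i, c), b) j‖ ^ 2 := by
  simp only [chan]
  rw [ptraceSnd, Complex.re_sum]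
  simp_rw [outA_diagonal_re, Finset.mul_sum]
  rw [Finset.sum_comm (s := (Finset.univ : Finset l))]
  exact Finset.sum_congr rfl fun c _ => Finset.sum_comm

theorem isometry_column {K : Matrix ((l × κ) × β) l ℂ} (hK : Kᴴ * K = 1) (j : l) :
    ∑ i, ∑ c, ∑ b, ‖K ((i, c), b) j‖ ^ 2 = 1 := by
  have h := congrFun (congrFun hK j) j
  rw [Matrix.mul_apply, Matrix.one_apply_eq] at h
  apply Complex.ofReal_injective
  rw [Complex.ofReal_one, ← h]
  push_cast
  simp only [Fintype.sum_prod_type, Matrix.conjTranspose_apply]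
  refine Finset.sum_congr rfl fun i _ => Finset.sum_congr rfl fun c _ =>
    Finset.sum_congr rfl fun b _ => ?_
  rw [← Complex.conj_mul']; rfl

/-- The first-order term in the expansion of the entropy of the output of `rot U K` around the
diagonal state `p`. -/
noncomputable def entropyShift (K : Matrix ((l × κ) × β) l ℂ) (p : l → ℝ)
    (U : Matrix.unitaryGroup l ℂ) : ℝ :=
  ∑ i, Real.log (p i) * ((chan (rot U K) (Matrix.diagonal fun i => (p i : ℂ)) i i).re - p i)

/-- Columns of an isometry have unit norm, so the subtracted pⱼ log pⱼ can be spread over all i with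
the transition weights. The terms i = j then drop out, and only off-diagonal Haar averages are
needed later. -/
theorem entropyShift_eq {K : Matrix ((l × κ) × β) l ℂ} (hK : Kᴴ * K = 1) (p : l → ℝ)
    (U : Matrix.unitaryGroup l ℂ) :
    entropyShift K p U = ∑ i, ∑ j, (Real.log (p i) - Real.log (p j)) * p j *
      ∑ c, ∑ b, ‖conjU U (kraus K c b) i j‖ ^ 2 := by
  have h1 : ∀ j, p j = ∑ i, p j * ∑ c, ∑ b, ‖conjU U (kraus K c b) i j‖ ^ 2 := by
    intro j
    rw [← Finset.mul_sum]
    have := isometry_column (rot_isometry U hK) j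
    simp only [rot] at this
    rw [this, mul_one]
  have h2 : ∑ i, Real.log (p i) * p i = ∑ i, ∑ j, Real.log (p j) * p j *
      ∑ c, ∑ b, ‖conjU U (kraus K c b) i j‖ ^ 2 := by
    rw [Finset.sum_comm]
    refine Finset.sum_congr rfl fun j _ => ?_
    rw [← Finset.mul_sum]
    rw [mul_assoc]
    congr 1
    rw [Finset.mul_sum]
    exact h1 j
  simp only [entropyShift, mul_sub, Finset.sum_sub_distrib, h2, chan_diagonal_re, rot]
  rw [← Finset.sum_sub_distrib]
  refine Finset.sum_congr rfl fun i _ => ?_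
  rw [Finset.mul_sum, ← Finset.sum_sub_distrib]
  exact Finset.sum_congr rfl fun j _ => by ring

theorem continuous_entropyShift {K : Matrix ((l × κ) × β) l ℂ} (hK : Kᴴ * K = 1) (p : l → ℝ) :
    Continuous (entropyShift K p) := by
  have h : entropyShift K p = fun U => ∑ i, ∑ j, (Real.log (p i) - Real.log (p j)) * p j *
      ∑ c, ∑ b, ‖conjU U (kraus K c b) i j‖ ^ 2 := funext fun U => entropyShift_eq hK p U
  rw [h]
  refine continuous_finsetSum _ fun i _ => continuous_finsetSum _ fun j _ =>
    continuous_const.mul (continuous_finsetSum _ fun c _ => continuous_finsetSum _ fun b _ => ?_)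
  exact (continuous_conjU_apply (kraus K c b) i j).norm.pow 2

/-- All off-diagonal averages are equal and are determined by norms and traces of the Kraus
operators. Isometry fixes the total squared norm at d, and the squared traces add up to d² times the
fidelity, so the average sees K only through `fid K`. -/
theorem integral_entropyShift {K : Matrix ((l × κ) × β) l ℂ} (hK : Kᴴ * K = 1) (p : l → ℝ) :
    ∫ U, entropyShift K p U ∂(haarUnitary l) =
      (1 - fid K) * (Fintype.card l / ((Fintype.card l : ℝ) ^ 2 - 1) *
        ∑ i, ∑ j, (Real.log (p i) - Real.log (p j)) * p j) := by
  have hint : ∀ i j c b, Integrable (fun U => ‖conjU U (kraus K c b) i j‖ ^ 2) (haarUnitary l) :=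
    fun i j c b => integrable_haarUnitary ((continuous_conjU_apply (kraus K c b) i j).norm.pow 2)
  have h1 : ∫ U, entropyShift K p U ∂(haarUnitary l) = ∑ i, ∑ j,
      (Real.log (p i) - Real.log (p j)) * p j * ∑ c, ∑ b, haarSq (kraus K c b) i j := by
    simp_rw [entropyShift_eq hK]
    rw [integral_finsetSum _ fun i _ => integrable_finsetSum _ fun j _ =>
      (integrable_finsetSum _ fun c _ => integrable_finsetSum _ fun b _ =>
        hint i j c b).const_mul _]
    refine Finset.sum_congr rfl fun i _ => ?_
    rw [integral_finsetSum _ fun j _ => (integrable_finsetSum _ fun c _ =>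
      integrable_finsetSum _ fun b _ => hint i j c b).const_mul _]
    refine Finset.sum_congr rfl fun j _ => ?_
    rw [integral_const_mul, integral_finsetSum _ fun c _ => integrable_finsetSum _ fun b _ =>
        hint i j c b]
    congr 1
    refine Finset.sum_congr rfl fun c _ => ?_
    rw [integral_finsetSum _ fun b _ => hint i j c b]
    rfl
  have hnorm : ∑ c, ∑ b, ∑ i, ∑ j, ‖kraus K c b i j‖ ^ 2 = Fintype.card l := by
    have : ∑ j, ∑ i, ∑ c, ∑ b, ‖K ((i, c), b) j‖ ^ 2 = Fintype.card l := by
      simp_rw [isometry_column hK]; simp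
    rw [← this]
    calc _ = ∑ c, ∑ i, ∑ b, ∑ j, ‖K ((i, c), b) j‖ ^ 2 :=
          Finset.sum_congr rfl fun c _ => Finset.sum_comm
      _ = ∑ i, ∑ c, ∑ b, ∑ j, ‖K ((i, c), b) j‖ ^ 2 := Finset.sum_comm
      _ = ∑ i, ∑ c, ∑ j, ∑ b, ‖K ((i, c), b) j‖ ^ 2 :=
          Finset.sum_congr rfl fun i _ => Finset.sum_congr rfl fun c _ => Finset.sum_comm
      _ = ∑ i, ∑ j, ∑ c, ∑ b, ‖K ((i, c), b) j‖ ^ 2 :=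
          Finset.sum_congr rfl fun i _ => Finset.sum_comm
      _ = _ := Finset.sum_comm
  rw [h1]
  have h2 : ∀ i j, (Real.log (p i) - Real.log (p j)) * p j * ∑ c, ∑ b, haarSq (kraus K c b) i j =
      (1 - fid K) * (Fintype.card l / ((Fintype.card l : ℝ) ^ 2 - 1) *
        ((Real.log (p i) - Real.log (p j)) * p j)) := by
    intro i j
    by_cases hij : i = j
    · simp [hij]
    have h3 : ∑ c, ∑ b, haarSq (kraus K c b) i j =
        (1 - fid K) * (Fintype.card l / ((Fintype.card l : ℝ) ^ 2 - 1)) := by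
      simp_rw [haarSq_eq _ hij, ← Finset.sum_div, Finset.sum_sub_distrib, ← Finset.mul_sum]
      rw [hnorm, fid]
      have hcard : (1 : ℝ) < Fintype.card l := by
        exact_mod_cast Fintype.one_lt_card_iff.mpr ⟨i, j, hij⟩
      have h0 : (Fintype.card l : ℝ) ^ 2 - 1 ≠ 0 := by nlinarith
      field_simp
    rw [h3]
    ring
  simp_rw [h2, ← Finset.mul_sum]

end Encoding

/-! ### Averaged second-order expansions -/

section Average

variable {l κ β : Type*} [Fintype l] [DecidableEq l] [Fintype κ] [DecidableEq κ]
  [Fintype β] [DecidableEq β]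

/-- An average over the unitary group is `o(ε²)` if the integrand is, along every choice of
unitaries. -/
theorem isLittleO_integral_haarUnitary {g : ℝ → Matrix.unitaryGroup l ℂ → ℝ}
    (hc : ∀ ε, Continuous (g ε))
    (h : ∀ U : ℝ → Matrix.unitaryGroup l ℂ, (fun ε => g ε (U ε)) =o[𝓝 0] fun ε : ℝ => ε ^ 2) :
    (fun ε => ∫ U, g ε U ∂(haarUnitary l)) =o[𝓝 0] fun ε : ℝ => ε ^ 2 := by
  -- For each ε the integrand takes a value below and a value above its mean. Selecting such
  -- unitaries sandwiches the integral between two paths, which replaces any estimate uniform in U.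
  have h1 : ∀ ε, ∃ U, g ε U ≤ ∫ V, g ε V ∂(haarUnitary l) := fun ε =>
    exists_le_integral (integrable_haarUnitary (hc ε))
  have h2 : ∀ ε, ∃ U, ∫ V, g ε V ∂(haarUnitary l) ≤ g ε U := fun ε =>
    exists_integral_le (integrable_haarUnitary (hc ε))
  choose U hU using h1
  choose V hV using h2
  refine IsBigO.trans_isLittleO (IsBigO.of_bound 1 (Eventually.of_forall fun ε => ?_))
    ((h U).norm_left.add (h V).norm_left)
  simp only [Real.norm_eq_abs, one_mul]
  rw [abs_of_nonneg (a := |g ε (U ε)| + |g ε (V ε)|) (by positivity), abs_le]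
  constructor
  · have := neg_abs_le (g ε (U ε)); have := abs_nonneg (g ε (V ε)); linarith [hU ε]
  · have := le_abs_self (g ε (V ε)); have := abs_nonneg (g ε (U ε)); linarith [hV ε]

theorem isBigO_unitary_apply (U : ℝ → Matrix.unitaryGroup l ℂ) (i j : l) (F : Filter ℝ) :
    (fun ε => (U ε : Matrix l l ℂ) i j) =O[F] fun _ => (1 : ℝ) :=
  IsBigO.of_bound 1 (Eventually.of_forall fun ε => by
    simpa using entry_norm_bound_of_unitary (U ε).2 i j)

theorem isBigO_unitary_conjTranspose_apply (U : ℝ → Matrix.unitaryGroup l ℂ) (i j : l)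
    (F : Filter ℝ) :
    (fun ε => (U ε : Matrix l l ℂ)ᴴ i j) =O[F] fun _ => (1 : ℝ) :=
  IsBigO.of_bound 1 (Eventually.of_forall fun ε => by
    simpa using entry_norm_bound_of_unitary (U ε).2 j i)

theorem isBigO_conjU {M : ℝ → Matrix l l ℂ} {g : ℝ → ℝ} {F : Filter ℝ}
    (hM : ∀ i j, (fun ε => M ε i j) =O[F] g) (U : ℝ → Matrix.unitaryGroup l ℂ) (i j : l) :
    (fun ε => conjU (U ε) (M ε) i j) =O[F] g := by
  simp only [conjU, Matrix.mul_apply, Finset.sum_mul]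
  refine IsBigO.fun_sum fun k _ => IsBigO.fun_sum fun k' _ => ?_
  refine (((isBigO_unitary_conjTranspose_apply U i k' F).mul (hM k' k)).mul
    (isBigO_unitary_apply U k j F)).congr_right fun ε => ?_
  ring

theorem isLittleO_conjU {M : ℝ → Matrix l l ℂ} {g : ℝ → ℝ} {F : Filter ℝ}
    (hM : ∀ i j, (fun ε => M ε i j) =o[F] g) (U : ℝ → Matrix.unitaryGroup l ℂ) (i j : l) :
    (fun ε => conjU (U ε) (M ε) i j) =o[F] g := by
  simp only [conjU, Matrix.mul_apply, Finset.sum_mul]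
  refine IsLittleO.fun_sum fun k _ => IsLittleO.fun_sum fun k' _ => ?_
  refine (((isBigO_unitary_conjTranspose_apply U i k' F).mul_isLittleO (hM k' k)).mul_isBigO
    (isBigO_unitary_apply U k j F)).congr_right fun ε => ?_
  ring

theorem isBigO_conj {f : ℝ → ℂ} {g : ℝ → ℝ} {F : Filter ℝ} (h : f =O[F] g) :
    (fun ε => starRingEnd ℂ (f ε)) =O[F] g := by
  rw [← isBigO_norm_left] at h ⊢
  simpa using h

theorem isLittleO_conj {f : ℝ → ℂ} {g : ℝ → ℝ} {F : Filter ℝ} (h : f =o[F] g) :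
    (fun ε => starRingEnd ℂ (f ε)) =o[F] g := by
  rw [← isLittleO_norm_left] at h ⊢
  simpa using h

/-- First-order expansion of a sesquilinear product. -/
theorem isLittleO_mul_conj {f g J J' : ℝ → ℂ} {A A' p : ℂ}
    (hf : (fun ε => f ε - A - ε * J ε) =o[𝓝 0] fun ε : ℝ => ε)
    (hg : (fun ε => g ε - A' - ε * J' ε) =o[𝓝 0] fun ε : ℝ => ε)
    (hJ : J =O[𝓝 0] fun _ : ℝ => (1 : ℝ)) (hJ' : J' =O[𝓝 0] fun _ : ℝ => (1 : ℝ)) :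
    (fun ε => f ε * p * starRingEnd ℂ (g ε) - A * p * starRingEnd ℂ A' -
      ε * (J ε * p * starRingEnd ℂ A' + A * p * starRingEnd ℂ (J' ε))) =o[𝓝 0]
      fun ε : ℝ => ε := by
  have hid : (fun ε : ℝ => ε) =O[𝓝 0] fun _ : ℝ => (1 : ℝ) :=
    (continuous_id.tendsto (0 : ℝ)).isBigO_one ℝ
  have hidc : (fun ε : ℝ => (ε : ℂ)) =O[𝓝 0] fun ε : ℝ => ε :=
    IsBigO.of_bound 1 (Eventually.of_forall fun ε => by simp)
  have hεJ : (fun ε : ℝ => (ε : ℂ) * J ε) =O[𝓝 0] fun ε : ℝ => ε :=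
    (hidc.mul hJ).congr_right fun ε => by ring
  have hg1 : (fun ε => g ε) =O[𝓝 0] fun _ : ℝ => (1 : ℝ) := by
    have h1 : (fun ε : ℝ => (ε : ℂ) * J' ε) =O[𝓝 0] fun _ : ℝ => (1 : ℝ) :=
      ((hidc.mul hJ').congr_right fun ε => by ring).trans hid
    have h2 := ((hg.isBigO.trans hid).add h1).add (isBigO_const_const A' (one_ne_zero' ℝ) (𝓝 0))
    exact h2.congr_left fun ε => by ring
  have t1 : (fun ε => (f ε - A - ε * J ε) * p * starRingEnd ℂ (g ε)) =o[𝓝 0] fun ε : ℝ => ε :=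
    ((hf.mul_isBigO (isBigO_const_const p (one_ne_zero' ℝ) (𝓝 0))).mul_isBigO
      (isBigO_conj hg1)).congr_right fun ε => by ring
  have t2 : (fun ε => A * p * starRingEnd ℂ (g ε - A' - ε * J' ε)) =o[𝓝 0] fun ε : ℝ => ε :=
    (isLittleO_conj hg).const_mul_left (A * p)
  have t3 : (fun ε => (ε * J ε) * p * starRingEnd ℂ (g ε - A')) =o[𝓝 0] fun ε : ℝ => ε := by
    have h1 : (fun ε => g ε - A') =o[𝓝 0] fun _ : ℝ => (1 : ℝ) := by
      have h2 : (fun ε : ℝ => (ε : ℂ) * J' ε) =O[𝓝 0] fun ε : ℝ => ε :=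
        (hidc.mul hJ').congr_right fun ε => by ring
      have h3 : (fun ε : ℝ => ε) =o[𝓝 0] fun _ : ℝ => (1 : ℝ) :=
        (isLittleO_one_iff ℝ).mpr (continuous_id.tendsto (0 : ℝ))
      exact ((hg.isBigO.add h2).trans_isLittleO h3).congr_left fun ε => by ring
    exact ((hεJ.mul (isBigO_const_const p (one_ne_zero' ℝ) (𝓝 0))).mul_isLittleO
      (isLittleO_conj h1)).congr_right fun ε => by ring
  refine ((t1.add t2).add t3).congr_left fun ε => ?_
  simp only [map_sub, map_mul, Complex.conj_ofReal]
  ring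

theorem kraus_attachResource (χ : κ × β → ℂ) (c : κ) (b : β) :
    kraus (attachResource (l := l) χ) c b = χ (c, b) • (1 : Matrix l l ℂ) := by
  ext i j
  simp [kraus, attachResource, Matrix.one_apply]

theorem rot_attachResource (U : Matrix.unitaryGroup l ℂ) (χ : κ × β → ℂ) :
    rot U (attachResource (l := l) χ) = attachResource χ := by
  ext x j
  simp only [rot, kraus_attachResource, conjU, Matrix.mul_smul, Matrix.mul_one,
    Matrix.smul_mul, unitary_conjTranspose_mul]
  simp [attachResource, Matrix.one_apply]

theorem flat_sum {χ : κ × β → ℂ} (hχ : IsFlat χ) (c c' : κ) :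
    ∑ b, χ (c, b) * starRingEnd ℂ (χ (c', b)) = if c = c' then (Fintype.card κ : ℂ)⁻¹ else 0 := by
  have h := congrFun (congrFun hχ c) c'
  simp only [ptraceSnd, ketbra, Matrix.vecMulVec_apply, Matrix.smul_apply, Matrix.one_apply] at h
  rw [show ∑ b, χ (c, b) * starRingEnd ℂ (χ (c', b)) = ∑ b, χ (c, b) * star χ (c', b) from rfl, h]
  simp

/-- The operator on `A` obtained by contracting the `Ā` index of `J` with the resource state. -/
def contract (χ : κ × β → ℂ) (J : Matrix ((l × κ) × β) l ℂ) : Matrix (l × κ) (l × κ) ℂ :=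
  fun x y => ∑ b, J (x, b) y.1 * starRingEnd ℂ (χ (y.2, b))

/-- The `(c, c')` block of an operator on `A₁ ⊗ A₂`. -/
def block (Z : Matrix (l × κ) (l × κ) ℂ) (c c' : κ) : Matrix l l ℂ := fun i j => Z (i, c) (j, c')

/-- The second-order term of the entropy of `A`, before averaging. -/
noncomputable def hessian (Z : Matrix (l × κ) (l × κ) ℂ) (p : l → ℝ)
    (U : Matrix.unitaryGroup l ℂ) : ℝ :=
  ∑ x : l × κ, ∑ y : l × κ, ((p x.1 + p y.1) * ‖conjU U (block Z x.2 y.2) x.1 y.1‖) ^ 2 *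
    negMulLogDD (p x.1 / Fintype.card κ) (p y.1 / Fintype.card κ)

theorem continuous_hessian (Z : Matrix (l × κ) (l × κ) ℂ) (p : l → ℝ) :
    Continuous (hessian Z p) :=
  continuous_finsetSum _ fun x _ => continuous_finsetSum _ fun y _ =>
    ((continuous_const.mul
      (continuous_conjU_apply (block Z x.2 y.2) x.1 y.1).norm).pow 2).mul continuous_const

theorem diagonal_ofReal_isHermitian {m : Type*} [DecidableEq m] (a : m → ℝ) :
    (Matrix.diagonal fun i => (a i : ℂ)).IsHermitian := by
  rw [Matrix.isHermitian_diagonal_iff]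
  intro i; simp [IsSelfAdjoint]

/-- With Z the contraction of J, the two first-order terms of KpK† are Zp and pZ† = pZ, whence the
factor pₓ + p_y. Rotation fixes the unperturbed code, so the unitary only conjugates the blocks of
Z, and the expansion holds along an arbitrary path of unitaries. -/
theorem outA_rot_expansion {χ : κ × β → ℂ} (hχ : IsFlat χ) {K : ℝ → Matrix ((l × κ) × β) l ℂ}
    {J : Matrix ((l × κ) × β) l ℂ}
    (hKJ : ∀ x j, (fun ε => K ε x j - attachResource χ x j - ε * J x j) =o[𝓝 0] fun ε : ℝ => ε)
    (hJ : (contract χ J).IsHermitian) (p : l → ℝ) (U : ℝ → Matrix.unitaryGroup l ℂ)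
    (x y : l × κ) :
    (fun ε => (outA (rot (U ε) (K ε)) (Matrix.diagonal fun i => (p i : ℂ)) -
      Matrix.diagonal fun z : l × κ => ((p z.1 / Fintype.card κ : ℝ) : ℂ)) x y -
      ε * ((p x.1 + p y.1 : ℝ) * conjU (U ε) (block (contract χ J) x.2 y.2) x.1 y.1)) =o[𝓝 0]
      fun ε : ℝ => ε := by
  obtain ⟨i, c⟩ := x
  obtain ⟨i', c'⟩ := y
  have hR : ∀ x j, (fun ε => rot (U ε) (K ε) x j - attachResource χ x j - ε * rot (U ε) J x j)
      =o[𝓝 0] fun ε : ℝ => ε := by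
    intro x j
    have h := isLittleO_conjU (M := fun ε => kraus (K ε - attachResource χ - (ε : ℂ) • J) x.1.2 x.2)
      (fun i j => hKJ ((i, x.1.2), x.2) j) U x.1.1 j
    refine h.congr_left fun ε => ?_
    conv_rhs => rw [← rot_attachResource (U ε) χ]
    simp only [rot]
    rw [show kraus (K ε - attachResource χ - (ε : ℂ) • J) x.1.2 x.2 = kraus (K ε) x.1.2 x.2 -
      kraus (attachResource χ) x.1.2 x.2 - (ε : ℂ) • kraus J x.1.2 x.2 from rfl]
    simp only [conjU, Matrix.mul_sub, Matrix.sub_mul, Matrix.mul_smul, Matrix.smul_mul]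
    rfl
  have hB : ∀ x j, (fun ε => rot (U ε) J x j) =O[𝓝 0] fun _ : ℝ => (1 : ℝ) := fun x j =>
    isBigO_conjU (M := fun _ => kraus J x.1.2 x.2)
      (fun _ _ => isBigO_const_const _ (one_ne_zero' ℝ) _) U x.1.1 j
  have hS := IsLittleO.fun_sum (s := (Finset.univ : Finset β)) fun b _ =>
    IsLittleO.fun_sum (s := (Finset.univ : Finset l)) fun j _ =>
      isLittleO_mul_conj (p := (p j : ℂ)) (hR ((i, c), b) j) (hR ((i', c'), b) j)
        (hB ((i, c), b) j) (hB ((i', c'), b) j)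
  refine hS.congr_left fun ε => ?_
  rw [Matrix.sub_apply, outA_diagonal_apply]
  simp only [Finset.sum_sub_distrib, Finset.sum_add_distrib, mul_add, ← Finset.mul_sum]
  have e1 : ∑ b, ∑ j, attachResource χ ((i, c), b) j * (p j : ℂ) *
      starRingEnd ℂ (attachResource χ ((i', c'), b) j) =
      Matrix.diagonal (fun z : l × κ => ((p z.1 / Fintype.card κ : ℝ) : ℂ)) (i, c) (i', c') := by
    have h1 : ∀ b, ∑ j, attachResource χ ((i, c), b) j * (p j : ℂ) *
      starRingEnd ℂ (attachResource χ ((i', c'), b) j) =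
        (if i = i' then (p i : ℂ) else 0) * (χ (c, b) * starRingEnd ℂ (χ (c', b))) := by
      intro b
      rw [Finset.sum_eq_single i]
      · simp only [attachResource, if_true]
        by_cases h : i = i'
        · subst h; simp; ring
        · simp [h, Ne.symm h]
      · intro j _ hj; simp [attachResource, hj.symm]
      · simp
    simp_rw [h1, ← Finset.mul_sum, flat_sum hχ, Matrix.diagonal_apply, Prod.mk.injEq]
    by_cases h : i = i' <;> by_cases h' : c = c' <;> simp [h, h', div_eq_mul_inv]
  have e2 : ∀ (i i' : l) (c c' : κ), ∑ b, ∑ j, rot (U ε) J ((i, c), b) j * (p j : ℂ) *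
      starRingEnd ℂ (attachResource χ ((i', c'), b) j) =
      p i' * conjU (U ε) (block (contract χ J) c c') i i' := by
    intro i i' c c'
    have h1 : ∀ b, ∑ j, rot (U ε) J ((i, c), b) j * (p j : ℂ) *
        starRingEnd ℂ (attachResource χ ((i', c'), b) j) =
        p i' * (conjU (U ε) (kraus J c b) i i' * starRingEnd ℂ (χ (c', b))) := by
      intro b
      rw [Finset.sum_eq_single i']
      · simp [attachResource, rot]; ring
      · intro j _ hj; simp [attachResource, hj.symm]
      · simp
    simp_rw [h1, ← Finset.mul_sum]
    congr 1
    have h2 : block (contract χ J) c c' = ∑ b, starRingEnd ℂ (χ (c', b)) • kraus J c b := by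
      ext i j
      simp [block, contract, kraus, Matrix.sum_apply, mul_comm]
    rw [h2, conjU, Finset.mul_sum, Finset.sum_mul, Matrix.sum_apply]
    refine Finset.sum_congr rfl fun b _ => ?_
    rw [Matrix.mul_smul, Matrix.smul_mul, Matrix.smul_apply, smul_eq_mul, mul_comm]
    rfl
  have hblock : (block (contract χ J) c' c)ᴴ = block (contract χ J) c c' := by
    ext k k'
    exact hJ.apply (k, c) (k', c')
  have e3 : ∑ b, ∑ j, attachResource χ ((i, c), b) j * (p j : ℂ) *
      starRingEnd ℂ (rot (U ε) J ((i', c'), b) j) =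
      p i * conjU (U ε) (block (contract χ J) c c') i i' := by
    have h := congrArg (starRingEnd ℂ) (e2 i' i c' c)
    rw [map_mul, Complex.conj_ofReal] at h
    have h3 : starRingEnd ℂ (conjU (U ε) (block (contract χ J) c' c) i' i) =
        conjU (U ε) (block (contract χ J) c c') i i' := by
      rw [← hblock]
      change ((conjU (U ε) (block (contract χ J) c' c))ᴴ) i i' = _
      simp only [conjU, Matrix.conjTranspose_mul, Matrix.conjTranspose_conjTranspose,
        Matrix.mul_assoc]
    rw [h3] at h
    rw [← h]
    simp only [map_sum, map_mul, Complex.conj_conj, Complex.conj_ofReal]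
    exact Finset.sum_congr rfl fun b _ => Finset.sum_congr rfl fun j _ => by ring
  rw [e1, e2 i i' c c', e3]
  push_cast
  ring

theorem trace_outA {K : Matrix ((l × κ) × β) l ℂ} (hK : Kᴴ * K = 1) (σ : Matrix l l ℂ) :
    (outA K σ).trace = σ.trace := by
  rw [outA, trace_ptraceSnd, Matrix.trace_mul_comm, ← Matrix.mul_assoc, hK, Matrix.one_mul]

theorem trace_chan {K : Matrix ((l × κ) × β) l ℂ} (hK : Kᴴ * K = 1) (σ : Matrix l l ℂ) :
    (chan K σ).trace = σ.trace := by
  rw [chan, trace_ptraceSnd, trace_outA hK]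

theorem continuous_rot (K : Matrix ((l × κ) × β) l ℂ) :
    Continuous fun U : Matrix.unitaryGroup l ℂ => rot U K :=
  continuous_pi fun _ => continuous_pi fun _ => continuous_conjU_apply _ _ _

theorem continuous_ptraceSnd {a b : Type*} [Fintype b] :
    Continuous (ptraceSnd : Matrix (a × b) (a × b) ℂ → Matrix a a ℂ) :=
  continuous_pi fun i => continuous_pi fun j => continuous_finsetSum _ fun k _ =>
    continuous_id.matrix_elem (i, k) (j, k)

theorem continuous_outA (σ : Matrix l l ℂ) :
    Continuous fun K : Matrix ((l × κ) × β) l ℂ => outA K σ :=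
  continuous_ptraceSnd.comp (by fun_prop)

theorem continuous_chan (σ : Matrix l l ℂ) :
    Continuous fun K : Matrix ((l × κ) × β) l ℂ => chan K σ :=
  continuous_ptraceSnd.comp (continuous_outA σ)

theorem isBigO_id_one : (fun ε : ℝ => ε) =O[𝓝 0] fun _ : ℝ => (1 : ℝ) :=
  (continuous_id.tendsto (0 : ℝ)).isBigO_one ℝ

theorem isBigO_sq_id : (fun ε : ℝ => ε ^ 2) =O[𝓝 0] fun ε : ℝ => ε :=
  (((isBigO_refl (fun ε : ℝ => ε) (𝓝 0)).mul isBigO_id_one).congr_left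
    fun ε => by ring).congr_right fun ε => by ring

/-- The average entropy of `A` to second order. -/
theorem average_vnEntropy_outA [Nonempty κ] {χ : κ × β → ℂ} (hχ : IsFlat χ)
    {K : ℝ → Matrix ((l × κ) × β) l ℂ} (hK : ∀ ε, (K ε)ᴴ * K ε = 1)
    {J : Matrix ((l × κ) × β) l ℂ}
    (hKJ : ∀ x j, (fun ε => K ε x j - attachResource χ x j - ε * J x j) =o[𝓝 0] fun ε : ℝ => ε)
    (hJ : (contract χ J).IsHermitian) {p : l → ℝ} (hp : ∀ i, 0 < p i) (hp1 : ∑ i, p i = 1) :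
    (fun ε => ∫ U, vnEntropy (outA (rot U (K ε)) (Matrix.diagonal fun i => (p i : ℂ)))
        ∂(haarUnitary l) -
      (vnEntropy (Matrix.diagonal fun z : l × κ => ((p z.1 / Fintype.card κ : ℝ) : ℂ)) -
        ∫ U, entropyShift (K ε) p U ∂(haarUnitary l) +
        ε ^ 2 * ∫ U, hessian (contract χ J) p U ∂(haarUnitary l))) =o[𝓝 0]
      fun ε : ℝ => ε ^ 2 := by
  set D : Matrix l l ℂ := Matrix.diagonal fun i => (p i : ℂ) with hD
  have hDH : D.IsHermitian := diagonal_ofReal_isHermitian p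
  set a : l × κ → ℝ := fun z => p z.1 / Fintype.card κ with ha
  set S₀ : ℝ := vnEntropy (Matrix.diagonal fun z => (a z : ℂ)) with hS₀
  have hκ : (0 : ℝ) < Fintype.card κ := by exact_mod_cast Fintype.card_pos
  have hapos : ∀ z, 0 < a z := fun z => div_pos (hp _) hκ
  have hcS : ∀ ε, Continuous fun U => vnEntropy (outA (rot U (K ε)) D) := fun ε =>
    continuous_vnEntropy ((continuous_outA D).comp (continuous_rot (K ε)))
      fun U => outA_isHermitian _ hDH
  have hcL : ∀ ε, Continuous fun U => entropyShift (K ε) p U := fun ε =>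
    continuous_entropyShift (hK ε) p
  have hcQ := continuous_hessian (contract χ J) p
  have main := isLittleO_integral_haarUnitary
    (g := fun ε U => vnEntropy (outA (rot U (K ε)) D) - (S₀ - entropyShift (K ε) p U +
      ε ^ 2 * hessian (contract χ J) p U))
    (fun ε => (hcS ε).sub ((continuous_const.sub (hcL ε)).add (continuous_const.mul hcQ))) ?_
  · refine main.congr_left fun ε => ?_
    rw [integral_sub (integrable_haarUnitary (hcS ε)) (integrable_haarUnitary
      ((continuous_const.fun_sub (hcL ε)).fun_add (continuous_const.fun_mul hcQ))),
      integral_add (integrable_haarUnitary (continuous_const.fun_sub (hcL ε)))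
        (integrable_haarUnitary (continuous_const.fun_mul hcQ)),
      integral_sub (integrable_haarUnitary continuous_const) (integrable_haarUnitary (hcL ε)),
      integral_const_mul]
    simp
  intro U
  have hexp := outA_rot_expansion hχ hKJ hJ p U
  set z : ℝ → (l × κ) → (l × κ) → ℂ := fun ε x y =>
    (p x.1 + p y.1 : ℝ) * conjU (U ε) (block (contract χ J) x.2 y.2) x.1 y.1 with hz
  have hzO : ∀ x y, (fun ε => z ε x y) =O[𝓝 0] fun _ : ℝ => (1 : ℝ) := fun x y =>
    (isBigO_conjU (M := fun _ => block (contract χ J) x.2 y.2)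
      (fun _ _ => isBigO_const_const _ (one_ne_zero' ℝ) _) U x.1 y.1).const_mul_left _
  have hεz : ∀ x y, (fun ε : ℝ => (ε : ℂ) * z ε x y) =O[𝓝 0] fun ε : ℝ => ε := by
    intro x y
    have hidc : (fun ε : ℝ => (ε : ℂ)) =O[𝓝 0] fun ε : ℝ => ε :=
      IsBigO.of_bound 1 (Eventually.of_forall fun ε => by simp)
    exact (hidc.mul (hzO x y)).congr_right fun ε => by ring
  have hΔ : ∀ x y, (fun ε => (outA (rot (U ε) (K ε)) D -
      Matrix.diagonal fun w => (a w : ℂ)) x y) =O[𝓝 0] fun ε : ℝ => ε := by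
    intro x y
    exact ((hexp x y).isBigO.add (hεz x y)).congr_left fun ε => by simp only [hz]; ring
  have hklein := vnEntropy_expansion (fun ε => outA_isHermitian (rot (U ε) (K ε)) hDH) hapos hΔ
  have hquad : (fun ε => ∑ x, ∑ y, ‖(outA (rot (U ε) (K ε)) D -
      Matrix.diagonal fun w => (a w : ℂ)) x y‖ ^ 2 * negMulLogDD (a x) (a y) -
      ε ^ 2 * hessian (contract χ J) p (U ε)) =o[𝓝 0] fun ε : ℝ => ε ^ 2 := by
    have hterm : ∀ x y, (fun ε => (‖(outA (rot (U ε) (K ε)) D -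
        Matrix.diagonal fun w => (a w : ℂ)) x y‖ ^ 2 - ‖(ε : ℂ) * z ε x y‖ ^ 2) *
        negMulLogDD (a x) (a y)) =o[𝓝 0] fun ε : ℝ => ε ^ 2 := by
      intro x y
      have h1 : (fun ε => ‖(outA (rot (U ε) (K ε)) D -
          Matrix.diagonal fun w => (a w : ℂ)) x y‖ - ‖(ε : ℂ) * z ε x y‖) =o[𝓝 0]
          fun ε : ℝ => ε :=
        IsBigO.trans_isLittleO (IsBigO.of_bound 1 (Eventually.of_forall fun ε => by
          rw [one_mul]; exact abs_norm_sub_norm_le _ _)) (hexp x y)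
      have h2 : (fun ε => ‖(outA (rot (U ε) (K ε)) D -
          Matrix.diagonal fun w => (a w : ℂ)) x y‖ + ‖(ε : ℂ) * z ε x y‖) =O[𝓝 0]
          fun ε : ℝ => ε := (hΔ x y).norm_left.add (hεz x y).norm_left
      have h3 := (h1.mul_isBigO h2).mul_isBigO
        (isBigO_const_const (negMulLogDD (a x) (a y)) (one_ne_zero' ℝ) (𝓝 0))
      refine (h3.congr_left fun ε => ?_).congr_right fun ε => ?_
      · ring
      · ring
    have hs := IsLittleO.fun_sum (s := (Finset.univ : Finset (l × κ))) fun x _ =>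
      IsLittleO.fun_sum (s := (Finset.univ : Finset (l × κ))) fun y _ => hterm x y
    refine hs.congr_left fun ε => ?_
    simp only [sub_mul, Finset.sum_sub_distrib]
    congr 1
    rw [hessian, Finset.mul_sum]
    refine Finset.sum_congr rfl fun x _ => ?_
    rw [Finset.mul_sum]
    refine Finset.sum_congr rfl fun y _ => ?_
    have hpp : 0 ≤ p x.1 + p y.1 := (add_pos (hp _) (hp _)).le
    simp only [hz, ha, norm_mul, Complex.norm_real, Real.norm_eq_abs, abs_of_nonneg hpp, mul_pow,
      sq_abs]
    ring
  refine (hklein.add hquad).congr_left fun ε => ?_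
  -- Flatness enters here: log a(i,c) = log pᵢ - log d_χ. The constant multiplies the change of
  -- trace, which is zero, and summing over c turns the rest into the linear term of the state of
  -- A₁.
  have hlin : ∑ x, (Real.log (a x) + 1) * ((outA (rot (U ε) (K ε)) D x x).re - a x) =
      entropyShift (K ε) p (U ε) := by
    have htr : ∑ x, ((outA (rot (U ε) (K ε)) D x x).re - a x) = 0 := by
      have h1 := congrArg Complex.re (trace_outA (rot_isometry (U ε) (hK ε)) D)
      have h2 : (∑ x, a x) = 1 := by
        simp only [ha, Fintype.sum_prod_type, Finset.sum_const, Finset.card_univ, nsmul_eq_mul]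
        rw [← hp1]
        exact Finset.sum_congr rfl fun i _ => by field_simp
      rw [Finset.sum_sub_distrib, h2]
      rw [hD, Matrix.trace_diagonal, ← hD, ← Complex.ofReal_sum, Complex.ofReal_re, hp1,
        Matrix.trace, Complex.re_sum] at h1
      rw [← h1]; simp
    have hlog : ∀ x, (Real.log (a x) + 1) * ((outA (rot (U ε) (K ε)) D x x).re - a x) =
        Real.log (p x.1) * ((outA (rot (U ε) (K ε)) D x x).re - a x) +
        (1 - Real.log (Fintype.card κ)) * ((outA (rot (U ε) (K ε)) D x x).re - a x) := by
      intro x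
      rw [ha, Real.log_div (hp _).ne' hκ.ne']
      ring
    simp_rw [hlog, Finset.sum_add_distrib, ← Finset.mul_sum, htr, mul_zero, add_zero]
    rw [entropyShift, Fintype.sum_prod_type]
    refine Finset.sum_congr rfl fun i _ => ?_
    simp only
    rw [← Finset.mul_sum, Finset.sum_sub_distrib, chan, ptraceSnd, Complex.re_sum]
    congr 2
    simp only [ha, Finset.sum_const, Finset.card_univ, nsmul_eq_mul]
    field_simp
  rw [hlin]
  ring

/-- The average entropy of the recovered state to second order. -/
theorem average_vnEntropy_chan {K : ℝ → Matrix ((l × κ) × β) l ℂ} (hK : ∀ ε, (K ε)ᴴ * K ε = 1)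
    {p : l → ℝ} (hp : ∀ i, 0 < p i)
    (hΔ : ∀ (U : ℝ → Matrix.unitaryGroup l ℂ) i j,
      (fun ε => (chan (rot (U ε) (K ε)) (Matrix.diagonal fun i => (p i : ℂ)) -
        Matrix.diagonal fun i => (p i : ℂ)) i j) =O[𝓝 0] fun ε : ℝ => ε ^ 2) :
    (fun ε => ∫ U, vnEntropy (chan (rot U (K ε)) (Matrix.diagonal fun i => (p i : ℂ)))
        ∂(haarUnitary l) -
      (vnEntropy (Matrix.diagonal fun i => (p i : ℂ)) -
        ∫ U, entropyShift (K ε) p U ∂(haarUnitary l))) =o[𝓝 0] fun ε : ℝ => ε ^ 2 := by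
  set D : Matrix l l ℂ := Matrix.diagonal fun i => (p i : ℂ) with hD
  have hDH : D.IsHermitian := diagonal_ofReal_isHermitian p
  have hcS : ∀ ε, Continuous fun U => vnEntropy (chan (rot U (K ε)) D) := fun ε =>
    continuous_vnEntropy ((continuous_chan D).comp (continuous_rot (K ε)))
      fun U => chan_isHermitian _ hDH
  have hcL : ∀ ε, Continuous fun U => entropyShift (K ε) p U := fun ε =>
    continuous_entropyShift (hK ε) p
  have main := isLittleO_integral_haarUnitary
    (g := fun ε U => vnEntropy (chan (rot U (K ε)) D) - (vnEntropy D - entropyShift (K ε) p U))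
    (fun ε => (hcS ε).sub (continuous_const.sub (hcL ε))) ?_
  · refine main.congr_left fun ε => ?_
    rw [integral_sub (integrable_haarUnitary (hcS ε)) (integrable_haarUnitary
      (continuous_const.fun_sub (hcL ε))),
      integral_sub (integrable_haarUnitary continuous_const) (integrable_haarUnitary (hcL ε))]
    simp
  intro U
  have hklein := vnEntropy_expansion (fun ε => chan_isHermitian (rot (U ε) (K ε)) hDH) hp
    (fun i j => (hΔ U i j).trans isBigO_sq_id)
  have hsq : (fun ε : ℝ => ε ^ 2 * ε ^ 2) =o[𝓝 0] fun ε : ℝ => ε ^ 2 := by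
    have h0 : (fun ε : ℝ => ε ^ 2) =o[𝓝 0] fun _ : ℝ => (1 : ℝ) :=
      (isLittleO_one_iff ℝ).mpr (Continuous.tendsto' (by fun_prop) 0 0 (by simp))
    exact ((isBigO_refl (fun ε : ℝ => ε ^ 2) (𝓝 0)).mul_isLittleO h0).congr_right
      fun ε => by ring
  -- The state moves only at order ε², so its quadratic entropy term is O(ε⁴).
  have hquad : (fun ε => ∑ i, ∑ j, ‖(chan (rot (U ε) (K ε)) D - D) i j‖ ^ 2 *
      negMulLogDD (p i) (p j)) =o[𝓝 0] fun ε : ℝ => ε ^ 2 := by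
    refine IsLittleO.fun_sum fun i _ => IsLittleO.fun_sum fun j _ => ?_
    have h1 := ((hΔ U i j).norm_left.mul (hΔ U i j).norm_left).mul
      (isBigO_const_const (negMulLogDD (p i) (p j)) (one_ne_zero' ℝ) (𝓝 0))
    refine (h1.congr (fun ε => ?_) (fun ε => ?_)).trans_isLittleO hsq
    · rw [sq]
    · ring
  refine (hklein.add hquad).congr_left fun ε => ?_
  have hlin : ∑ i, (Real.log (p i) + 1) * ((chan (rot (U ε) (K ε)) D i i).re - p i) =
      entropyShift (K ε) p (U ε) := by
    have htr : ∑ i, ((chan (rot (U ε) (K ε)) D i i).re - p i) = 0 := by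
      have h1 := congrArg Complex.re (trace_chan (rot_isometry (U ε) (hK ε)) D)
      rw [hD, Matrix.trace_diagonal, ← hD, ← Complex.ofReal_sum, Complex.ofReal_re,
        Matrix.trace, Complex.re_sum] at h1
      rw [Finset.sum_sub_distrib, ← h1]; simp
    simp_rw [add_mul, one_mul, Finset.sum_add_distrib, htr, add_zero]
    rfl
  rw [hlin]
  ring

end Average

/-! ### Normal form of the first-order perturbation -/

section NormalForm

variable {l κ β : Type*} [Fintype l] [DecidableEq l] [Fintype κ] [DecidableEq κ]
  [Fintype β] [DecidableEq β]

theorem hasDerivAt_matrix_mul {a b c : Type*} [Fintype b] {A : ℝ → Matrix a b ℂ}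
    {B : ℝ → Matrix b c ℂ} {A' : Matrix a b ℂ} {B' : Matrix b c ℂ} {t : ℝ}
    (hA : ∀ i j, HasDerivAt (fun ε => A ε i j) (A' i j) t)
    (hB : ∀ i j, HasDerivAt (fun ε => B ε i j) (B' i j) t) (i : a) (j : c) :
    HasDerivAt (fun ε => (A ε * B ε) i j) ((A' * B t + A t * B') i j) t := by
  simp only [Matrix.mul_apply, Matrix.add_apply, ← Finset.sum_add_distrib]
  exact HasDerivAt.fun_sum fun k _ => (hA i k).mul (hB k j)

open scoped Matrix.Norms.L2Operator in
theorem hasDerivAt_exp_apply {m : Type*} [Fintype m] [DecidableEq m] (W : Matrix m m ℂ)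
    (i j : m) :
    HasDerivAt (fun ε : ℝ => NormedSpace.exp ((Complex.I * (ε : ℂ)) • W) i j)
      ((Complex.I • W) i j) 0 := by
  have h := hasDerivAt_exp_smul_const (𝕂 := ℝ) (Complex.I • W) (0 : ℝ)
  have h2 := (LinearMap.toContinuousLinearMap
    (Matrix.entryLinearMap ℝ ℂ i j : Matrix m m ℂ →ₗ[ℝ] ℂ)).hasFDerivAt.comp_hasDerivAt (0 : ℝ) h
  simp only [zero_smul, NormedSpace.exp_zero, one_mul] at h2
  refine HasDerivAt.congr_deriv (HasDerivAt.congr_of_eventuallyEq h2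
    (Eventually.of_forall fun ε => ?_)) rfl
  simp only [Function.comp]
  rw [show (Complex.I * (ε : ℂ)) • W = ε • (Complex.I • W) by
    rw [mul_comm, mul_smul]; rfl]
  rfl

theorem isLittleO_of_hasDerivAt {f : ℝ → ℂ} {f' : ℂ} (h : HasDerivAt f f' 0) :
    (fun ε => f ε - f 0 - ε * f') =o[𝓝 0] fun ε : ℝ => ε := by
  have := h.isLittleO
  simpa using this

/-- The unitary `exp (i ε X)` for Hermitian `X`. -/
theorem exp_mem_unitaryGroup {m : Type*} [Fintype m] [DecidableEq m] {X : Matrix m m ℂ}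
    (hX : X.IsHermitian) (ε : ℝ) :
    NormedSpace.exp ((Complex.I * (ε : ℂ)) • X) ∈ Matrix.unitaryGroup m ℂ := by
  rw [Matrix.mem_unitaryGroup_iff, Matrix.star_eq_conjTranspose, ← Matrix.exp_conjTranspose,
    Matrix.conjTranspose_smul, hX.eq]
  have h : star (Complex.I * (ε : ℂ)) • X = -((Complex.I * (ε : ℂ)) • X) := by simp
  rw [h, ← Matrix.exp_add_of_commute _ _ (Commute.refl ((Complex.I * (ε : ℂ)) • X)).neg_right, add_neg_cancel,
    NormedSpace.exp_zero]

/-- An encoding as an operator from `r ⊗ Ā` to `A`. -/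
def reshape (K : Matrix ((l × κ) × β) l ℂ) : Matrix (l × κ) (l × β) ℂ := fun x y => K (x, y.2) y.1

/-- A vector of `A₂ ⊗ Ā` as an operator. -/
def vecMat (χ : κ × β → ℂ) : Matrix κ β ℂ := fun c b => χ (c, b)

theorem reshape_attachResource (χ : κ × β → ℂ) :
    reshape (attachResource (l := l) χ) = (1 : Matrix l l ℂ) ⊗ₖ vecMat χ := by
  ext ⟨i, c⟩ ⟨k, b⟩
  simp [reshape, attachResource, vecMat, Matrix.one_apply]

theorem contract_eq (χ : κ × β → ℂ) (J : Matrix ((l × κ) × β) l ℂ) :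
    contract χ J = reshape J * (reshape (attachResource (l := l) χ))ᴴ := by
  ext x ⟨k, c⟩
  rw [reshape_attachResource, Matrix.mul_apply, Fintype.sum_prod_type, Finset.sum_eq_single k]
  · simp [contract, reshape, vecMat]
  · intro k' _ hk
    simp [hk.symm]
  · simp

theorem reshape_mul (X : Matrix (l × κ) (l × κ) ℂ) (K : Matrix ((l × κ) × β) l ℂ) :
    reshape ((X ⊗ₖ (1 : Matrix β β ℂ)) * K) = X * reshape K := by
  ext x ⟨k, b⟩
  simp only [reshape, Matrix.mul_apply, Fintype.sum_prod_type (f := fun z : (l × κ) × β => _),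
    Matrix.kroneckerMap_apply, Matrix.one_apply]
  refine Finset.sum_congr rfl fun y _ => ?_
  rw [Finset.sum_eq_single b] <;> simp +contextual [eq_comm]

theorem reshape_mul_right (R : Matrix β β ℂ) (K : Matrix ((l × κ) × β) l ℂ) :
    reshape (((1 : Matrix (l × κ) (l × κ) ℂ) ⊗ₖ R) * K) =
      reshape K * ((1 : Matrix l l ℂ) ⊗ₖ Rᵀ) := by
  ext x ⟨k, b⟩
  have hL : (((1 : Matrix (l × κ) (l × κ) ℂ) ⊗ₖ R) * K) (x, b) k = ∑ b', R b b' * K (x, b') k := by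
    rw [Matrix.mul_apply, Fintype.sum_prod_type, Finset.sum_eq_single x]
    · simp
    · intro y _ hy
      simp [hy.symm]
    · simp
  have hR : (reshape K * ((1 : Matrix l l ℂ) ⊗ₖ Rᵀ)) x (k, b) = ∑ b', R b b' * K (x, b') k := by
    rw [Matrix.mul_apply, Fintype.sum_prod_type, Finset.sum_eq_single k]
    · simp [reshape, mul_comm]
    · intro k' _ hk
      simp [hk]
    · simp
  rw [hR, ← hL]
  rfl

/-- Flatness makes the reshaped code a multiple of a coisometry. This right inverse is what lets a
perturbation be written as the code times an operator on r ⊗ Ā. -/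
theorem reshape_flat {χ : κ × β → ℂ} (hχ : IsFlat χ) :
    reshape (attachResource (l := l) χ) * (reshape (attachResource (l := l) χ))ᴴ =
      (Fintype.card κ : ℂ)⁻¹ • (1 : Matrix (l × κ) (l × κ) ℂ) := by
  have h : vecMat χ * (vecMat χ)ᴴ = (Fintype.card κ : ℂ)⁻¹ • (1 : Matrix κ κ ℂ) := by
    ext c c'
    rw [Matrix.mul_apply, Matrix.smul_apply, Matrix.one_apply]
    have := flat_sum hχ c c'
    simp only [smul_eq_mul, mul_ite, mul_one, mul_zero]
    exact this
  rw [reshape_attachResource, Matrix.conjTranspose_kronecker, ← Matrix.mul_kronecker_mul, h,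
    Matrix.conjTranspose_one, Matrix.one_mul, Matrix.kronecker_smul, Matrix.one_kronecker_one]

/-- The first-order perturbation `i W` of the encoding splits into a Hermitian generator `X` of a
recovery on `A`, a change of the resource state, and an irreducible part given by a Hermitian
operator `G` on `r ⊗ Ā` with vanishing partial trace over `r`. -/
theorem exists_normalForm [Nonempty l] [Nonempty κ] {χ : κ × β → ℂ} (hχ : IsFlat χ)
    (W : Matrix ((l × κ) × β) ((l × κ) × β) ℂ) :
    ∃ (X : Matrix (l × κ) (l × κ) ℂ) (J : Matrix ((l × κ) × β) l ℂ)
      (G : Matrix (l × β) (l × β) ℂ) (e : κ × β → ℂ),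
      X.IsHermitian ∧
      J = Complex.I • (W * attachResource (l := l) χ - (X ⊗ₖ (1 : Matrix β β ℂ)) * attachResource (l := l) χ) ∧
      (contract χ J).IsHermitian ∧ G.IsHermitian ∧ (∀ b b', ∑ i, G (i, b) (i, b') = 0) ∧
      reshape J = reshape (attachResource (l := l) χ) * G + reshape (attachResource e) := by
  set d : ℂ := (Fintype.card l : ℂ) with hd
  set k : ℂ := (Fintype.card κ : ℂ) with hk
  have hk0 : k ≠ 0 := by rw [hk]; exact_mod_cast Fintype.card_ne_zero
  have hd0 : d ≠ 0 := by rw [hd]; exact_mod_cast Fintype.card_ne_zero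
  have hks : star k = k := by simp [hk]
  set A₀ := reshape (attachResource (l := l) χ) with hA₀
  have hAA : A₀ * A₀ᴴ = k⁻¹ • (1 : Matrix (l × κ) (l × κ) ℂ) := reshape_flat hχ
  set Y := k • contract χ (W * attachResource (l := l) χ) with hY
  -- X is the Hermitian part of Y. What remains of iW after removing iX contracts to i times the
  -- anti-Hermitian part of Y/k, which is Hermitian.
  set X : Matrix (l × κ) (l × κ) ℂ := (2⁻¹ : ℂ) • (Y + Yᴴ) with hX
  set J : Matrix ((l × κ) × β) l ℂ :=
    Complex.I • (W * attachResource (l := l) χ - (X ⊗ₖ (1 : Matrix β β ℂ)) * attachResource (l := l) χ) with hJ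
  have hXH : X.IsHermitian := by
    rw [hX, Matrix.IsHermitian, Matrix.conjTranspose_smul, Matrix.conjTranspose_add,
      Matrix.conjTranspose_conjTranspose, add_comm]
    simp
  have hrJ : reshape J = Complex.I • (reshape (W * attachResource (l := l) χ) - X * A₀) := by
    rw [hA₀, ← reshape_mul]; rfl
  have hZ : contract χ J = (Complex.I * k⁻¹ * 2⁻¹) • (Y - Yᴴ) := by
    rw [contract_eq, hrJ, ← hA₀, Matrix.smul_mul, Matrix.sub_mul, Matrix.mul_assoc, hAA, hA₀,
      ← contract_eq, hX]
    have : contract χ (W * attachResource (l := l) χ) = k⁻¹ • Y := by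
      rw [hY, smul_smul, inv_mul_cancel₀ hk0, one_smul]
    rw [this, Matrix.mul_smul, Matrix.mul_one]
    module
  have hZH : (contract χ J).IsHermitian := by
    rw [hZ, Matrix.IsHermitian, Matrix.conjTranspose_smul, Matrix.conjTranspose_sub,
      Matrix.conjTranspose_conjTranspose, ← neg_sub Y, smul_neg, ← neg_smul]
    congr 1
    simp [hk]
  set J' := reshape J with hJ'
  set Z := contract χ J with hZdef
  have hZ2 : J' * A₀ᴴ = Z := (contract_eq χ J).symm
  have hZ3 : A₀ * J'ᴴ = Z := by
    rw [← hZH.eq, ← hZ2, Matrix.conjTranspose_mul, Matrix.conjTranspose_conjTranspose]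
  -- A Hermitian solution of A₀G' = J': by A₀A₀† = k⁻¹ and A₀J'† = Z, the product is J' + kZA₀ -
  -- kZA₀.
  set G' : Matrix (l × β) (l × β) ℂ := k • (A₀ᴴ * J' + J'ᴴ * A₀) - k ^ 2 • (A₀ᴴ * Z * A₀) with hG'
  have hG'H : G'.IsHermitian := by
    rw [hG', Matrix.IsHermitian]
    simp only [Matrix.conjTranspose_sub, Matrix.conjTranspose_smul, Matrix.conjTranspose_add,
      Matrix.conjTranspose_mul, Matrix.conjTranspose_conjTranspose, hZH.eq, star_pow, hks,
      Matrix.mul_assoc]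
    rw [add_comm]
  have hAG' : A₀ * G' = J' := by
    rw [hG', Matrix.mul_sub, Matrix.mul_smul, Matrix.mul_smul, Matrix.mul_add, Matrix.mul_assoc A₀ᴴ,
      ← Matrix.mul_assoc A₀, ← Matrix.mul_assoc A₀, ← Matrix.mul_assoc A₀, hAA, hZ3,
      Matrix.smul_mul, Matrix.smul_mul, Matrix.one_mul, Matrix.one_mul]
    rw [smul_add, smul_smul, smul_smul, mul_inv_cancel₀ hk0, one_smul, sq, mul_assoc,
      mul_inv_cancel₀ hk0, mul_one]
    abel
  -- R is the normalized partial trace of G' over r. The product A₀(1 ⊗ R) only changes the resource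
  -- state, so this part of G' can be moved into e.
  obtain ⟨R, hR⟩ : ∃ R : Matrix β β ℂ, ∀ b b', R b b' = d⁻¹ * ∑ i, G' (i, b) (i, b') :=
    ⟨fun b b' => d⁻¹ * ∑ i, G' (i, b) (i, b'), fun _ _ => rfl⟩
  have hRH : R.IsHermitian := by
    ext b b'
    rw [Matrix.conjTranspose_apply, hR, hR, star_mul', star_sum]
    simp only [hG'H.apply]
    simp [hd]
  refine ⟨X, J, G' - (1 : Matrix l l ℂ) ⊗ₖ R, fun x => ∑ b, χ (x.1, b) * R b x.2, hXH, rfl, hZH,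
    hG'H.sub ?_, ?_, ?_⟩
  · rw [Matrix.IsHermitian, Matrix.conjTranspose_kronecker, hRH.eq, Matrix.conjTranspose_one]
  · intro b b'
    simp only [Matrix.sub_apply, Matrix.kroneckerMap_apply, Matrix.one_apply_eq, one_mul,
      Finset.sum_sub_distrib, hR, Finset.sum_const, Finset.card_univ, nsmul_eq_mul]
    rw [← mul_assoc, mul_inv_cancel₀ hd0, one_mul, sub_self]
  · rw [Matrix.mul_sub, hAG']
    have : reshape (attachResource (l := l) fun x : κ × β => ∑ b, χ (x.1, b) * R b x.2) =
        A₀ * ((1 : Matrix l l ℂ) ⊗ₖ R) := by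
      rw [hA₀, reshape_attachResource, reshape_attachResource, ← Matrix.mul_kronecker_mul,
        Matrix.one_mul]
      rfl
    rw [this, sub_add_cancel]

end NormalForm

/-! ### Entanglement fidelity to second order -/

section Fidelity

variable {l κ β : Type*} [Fintype l] [DecidableEq l] [Fintype κ] [DecidableEq κ]
  [Fintype β] [DecidableEq β]

/-- The environment vector onto which the maximally entangled state is best recovered. -/
noncomputable def traceVec (K : Matrix ((l × κ) × β) l ℂ) : κ × β → ℂ :=
  fun y => (kraus K y.1 y.2).trace / Fintype.card l

/-- The part of `K` that does not factor through `attachResource`. -/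
noncomputable def recoveryResidual (K : Matrix ((l × κ) × β) l ℂ) : Matrix ((l × κ) × β) l ℂ :=
  K - attachResource (traceVec K)

theorem sum_kraus_norm_sq {K : Matrix ((l × κ) × β) l ℂ} (hK : Kᴴ * K = 1) :
    ∑ x, ∑ j, ‖K x j‖ ^ 2 = Fintype.card l := by
  apply Complex.ofReal_injective
  rw [sum_norm_sq_eq_trace, hK, Matrix.trace_one]
  simp

/-- Pythagoras for the orthogonal projection onto multiples of the identity. -/
theorem sum_norm_sq_sub_trace [Nonempty l] (M : Matrix l l ℂ) :
    ∑ i, ∑ j, ‖M i j - (if i = j then M.trace / Fintype.card l else 0)‖ ^ 2 =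
      ∑ i, ∑ j, ‖M i j‖ ^ 2 - ‖M.trace‖ ^ 2 / Fintype.card l := by
  set t := M.trace / Fintype.card l with ht
  have hd : (Fintype.card l : ℝ) ≠ 0 := by exact_mod_cast Fintype.card_ne_zero
  have hd' : (Fintype.card l : ℂ) ≠ 0 := by exact_mod_cast Fintype.card_ne_zero
  have h1 : ∀ i j, ‖M i j - (if i = j then t else 0)‖ ^ 2 = ‖M i j‖ ^ 2 +
      if i = j then (‖t‖ ^ 2 - 2 * (M i i * starRingEnd ℂ t).re) else 0 := by
    intro i j
    split_ifs with h
    · subst h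
      rw [← Complex.normSq_eq_norm_sq, Complex.normSq_sub, Complex.normSq_eq_norm_sq,
        Complex.normSq_eq_norm_sq]
      ring
    · simp
  simp_rw [h1, Finset.sum_add_distrib]
  have h2 : ∑ i, (M i i * starRingEnd ℂ t).re = ‖M.trace‖ ^ 2 / Fintype.card l := by
    rw [← Complex.re_sum, ← Finset.sum_mul]
    change (M.trace * starRingEnd ℂ t).re = _
    rw [ht, map_div₀, ← mul_div_assoc, Complex.mul_conj, Complex.normSq_eq_norm_sq, map_natCast,
      ← Complex.ofReal_natCast, ← Complex.ofReal_div, Complex.ofReal_re]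
  have h3 : ‖t‖ ^ 2 * Fintype.card l = ‖M.trace‖ ^ 2 / Fintype.card l := by
    rw [ht, norm_div, Complex.norm_natCast]
    field_simp
  simp only [Finset.sum_ite_eq, Finset.mem_univ, if_true, Finset.sum_sub_distrib, ← Finset.mul_sum,
    h2, Finset.sum_const, Finset.card_univ, nsmul_eq_mul]
  linarith

/-- The infidelity becomes a squared distance, namely from K to the space of maps ψ ↦ ψ ⊗ t. Both
bounds on the infidelity work with it in this form. -/
theorem sum_recoveryResidual_norm_sq [Nonempty l] {K : Matrix ((l × κ) × β) l ℂ} (hK : Kᴴ * K = 1) :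
    ∑ x, ∑ j, ‖recoveryResidual K x j‖ ^ 2 = Fintype.card l * (1 - fid K) := by
  have hd : (Fintype.card l : ℝ) ≠ 0 := by exact_mod_cast Fintype.card_ne_zero
  have hre : ∀ F : ((l × κ) × β) → l → ℝ, ∑ x, ∑ j, F x j =
      ∑ c, ∑ b, ∑ i, ∑ j, F ((i, c), b) j := by
    intro F
    simp only [Fintype.sum_prod_type]
    rw [Finset.sum_comm]
    exact Finset.sum_congr rfl fun c _ => Finset.sum_comm
  have h := sum_kraus_norm_sq hK
  rw [hre] at h ⊢
  have h1 : ∀ c b, ∑ i, ∑ j, ‖recoveryResidual K ((i, c), b) j‖ ^ 2 =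
      ∑ i, ∑ j, ‖K ((i, c), b) j‖ ^ 2 - ‖(kraus K c b).trace‖ ^ 2 / Fintype.card l :=
    fun c b => sum_norm_sq_sub_trace (kraus K c b)
  simp_rw [h1, Finset.sum_sub_distrib, h, fid, ← Finset.sum_div]
  field_simp

theorem fid_le_one [Nonempty l] {K : Matrix ((l × κ) × β) l ℂ} (hK : Kᴴ * K = 1) :
    0 ≤ 1 - fid K := by
  have hd : (0 : ℝ) < Fintype.card l := by exact_mod_cast Fintype.card_pos
  have h := sum_recoveryResidual_norm_sq hK
  refine nonneg_of_mul_nonneg_right (b := 1 - fid K) ?_ hd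
  rw [← h]; positivity

/-- The second-order coefficient of the infidelity of the best recovery. -/
noncomputable def infid (χ : κ × β → ℂ) (G : Matrix (l × β) (l × β) ℂ) : ℝ :=
  (∑ x, ∑ y, ‖(reshape (attachResource (l := l) χ) * G) x y‖ ^ 2) / Fintype.card l

theorem isLittleO_norm_sq {f : ℝ → ℂ} {z : ℂ}
    (h : (fun ε => f ε - ε * z) =o[𝓝 0] fun ε : ℝ => ε) :
    (fun ε => ‖f ε‖ ^ 2 - ε ^ 2 * ‖z‖ ^ 2) =o[𝓝 0] fun ε : ℝ => ε ^ 2 := by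
  have hz : (fun ε : ℝ => (ε : ℂ) * z) =O[𝓝 0] fun ε : ℝ => ε :=
    IsBigO.of_bound ‖z‖ (Eventually.of_forall fun ε => by
      rw [norm_mul, Complex.norm_real, mul_comm])
  have hf : f =O[𝓝 0] fun ε : ℝ => ε := (h.isBigO.add hz).congr_left fun ε => by ring
  have h1 : (fun ε => ‖f ε‖ - ‖(ε : ℂ) * z‖) =o[𝓝 0] fun ε : ℝ => ε :=
    IsBigO.trans_isLittleO (IsBigO.of_bound 1 (Eventually.of_forall fun ε => by
      rw [one_mul]; exact abs_norm_sub_norm_le _ _)) h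
  have h2 := hf.norm_left.add hz.norm_left
  refine (h1.mul_isBigO h2).congr (fun ε => ?_) (fun ε => by ring)
  rw [norm_mul, Complex.norm_real, Real.norm_eq_abs, ← sq_abs ε]
  ring

theorem sum_partialTrace {G : Matrix (l × β) (l × β) ℂ} (hG : ∀ b b', ∑ i, G (i, b) (i, b') = 0)
    (χ : κ × β → ℂ) (c : κ) (b : β) :
    ∑ i, (reshape (attachResource (l := l) χ) * G) (i, c) (i, b) = 0 := by
  have h : ∀ i, (reshape (attachResource (l := l) χ) * G) (i, c) (i, b) =
      ∑ b', χ (c, b') * G (i, b') (i, b) := by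
    intro i
    rw [Matrix.mul_apply, Fintype.sum_prod_type, Finset.sum_eq_single i]
    · simp [reshape, attachResource]
    · intro j _ hj
      simp [reshape, attachResource, hj.symm]
    · simp
  simp_rw [h]
  rw [Finset.sum_comm]
  simp_rw [← Finset.mul_sum, hG, mul_zero, Finset.sum_const_zero]

/-- Because G has no partial trace over r, removing the trace part of K takes away exactly χ + εe to
first order. The residual is εA₀G + o(ε). -/
theorem fid_expansion [Nonempty l] {χ : κ × β → ℂ} {K : ℝ → Matrix ((l × κ) × β) l ℂ}
    (hK : ∀ ε, (K ε)ᴴ * K ε = 1) {J : Matrix ((l × κ) × β) l ℂ}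
    (hKJ : ∀ x j, (fun ε => K ε x j - attachResource χ x j - ε * J x j) =o[𝓝 0] fun ε : ℝ => ε)
    {G : Matrix (l × β) (l × β) ℂ} (hG : ∀ b b', ∑ i, G (i, b) (i, b') = 0) {e : κ × β → ℂ}
    (hJG : reshape J = reshape (attachResource (l := l) χ) * G + reshape (attachResource e)) :
    (fun ε => 1 - fid (K ε) - ε ^ 2 * infid χ G) =o[𝓝 0] fun ε : ℝ => ε ^ 2 := by
  have hd : (Fintype.card l : ℝ) ≠ 0 := by exact_mod_cast Fintype.card_ne_zero
  have hd' : (Fintype.card l : ℂ) ≠ 0 := by exact_mod_cast Fintype.card_ne_zero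
  set N := reshape (attachResource (l := l) χ) * G with hN
  have htJ : ∀ c b, (kraus J c b).trace = Fintype.card l * e (c, b) := by
    intro c b
    have h1 : ∀ i, kraus J c b i i = N (i, c) (i, b) + e (c, b) := by
      intro i
      have := congrFun (congrFun hJG (i, c)) (i, b)
      simpa [reshape, attachResource, kraus] using this
    simp only [Matrix.trace, Matrix.diag_apply, h1, Finset.sum_add_distrib]
    rw [hN, sum_partialTrace hG]
    simp
  have hres : ∀ x j, (fun ε => recoveryResidual (K ε) x j - ε * N x.1 (j, x.2)) =o[𝓝 0]
      fun ε : ℝ => ε := by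
    rintro ⟨⟨i, c⟩, b⟩ j
    have hs := IsLittleO.fun_sum (s := (Finset.univ : Finset l))
      fun k _ => hKJ ((k, c), b) k
    have h2 := (hKJ ((i, c), b) j).sub
      (hs.const_mul_left (if i = j then (Fintype.card l : ℂ)⁻¹ else 0))
    refine h2.congr_left fun ε => ?_
    have hJ2 : J ((i, c), b) j = N (i, c) (j, b) + if i = j then e (c, b) else 0 :=
      congrFun (congrFun hJG (i, c)) (j, b)
    have hsum : ∑ k, (K ε ((k, c), b) k - attachResource χ ((k, c), b) k - ε * J ((k, c), b) k) =
        (kraus (K ε) c b).trace - Fintype.card l * χ (c, b) - ε * (Fintype.card l * e (c, b)) := by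
      rw [← htJ]
      simp only [Finset.sum_sub_distrib, ← Finset.mul_sum]
      simp [attachResource, Matrix.trace, kraus]
    rw [hsum, hJ2]
    simp only [recoveryResidual, Matrix.sub_apply, attachResource, traceVec]
    split_ifs with h
    · field_simp
      ring
    · ring
  have hsq := IsLittleO.fun_sum (s := (Finset.univ : Finset ((l × κ) × β))) fun x _ =>
    IsLittleO.fun_sum (s := (Finset.univ : Finset l)) fun j _ => isLittleO_norm_sq (hres x j)
  have h3 := hsq.const_mul_left (Fintype.card l : ℝ)⁻¹
  refine h3.congr_left fun ε => ?_
  simp only [Finset.sum_sub_distrib, ← Finset.mul_sum]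
  rw [sum_recoveryResidual_norm_sq (hK ε), infid]
  have h4 : ∑ x : (l × κ) × β, ∑ j, ‖N x.1 (j, x.2)‖ ^ 2 = ∑ x, ∑ y, ‖N x y‖ ^ 2 := by
    rw [Fintype.sum_prod_type]
    refine Finset.sum_congr rfl fun x _ => ?_
    rw [Fintype.sum_prod_type, Finset.sum_comm]
  rw [h4]
  field_simp
  rw [hN]

end Fidelity

/-! ### The infidelity of an arbitrary recovery -/

section LowerBound

variable {l κ β : Type*} [Fintype l] [DecidableEq l] [Fintype κ] [DecidableEq κ]
  [Fintype β] [DecidableEq β]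

theorem trace_conjTranspose_mul_eq {a b : Type*} [Fintype a] [Fintype b] (M N : Matrix a b ℂ) :
    (Mᴴ * N).trace = ∑ y, ∑ x, starRingEnd ℂ (M x y) * N x y := by
  simp [Matrix.trace, Matrix.mul_apply]

theorem sq_re_trace_le {a b : Type*} [Fintype a] [Fintype b] (M N : Matrix a b ℂ) :
    (Mᴴ * N).trace.re ^ 2 ≤ (∑ x, ∑ y, ‖M x y‖ ^ 2) * ∑ x, ∑ y, ‖N x y‖ ^ 2 := by
  have h1 : |(Mᴴ * N).trace.re| ≤ ∑ p : b × a, ‖M p.2 p.1‖ * ‖N p.2 p.1‖ := by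
    refine (Complex.abs_re_le_norm _).trans ?_
    rw [trace_conjTranspose_mul_eq, ← Fintype.sum_prod_type']
    refine (norm_sum_le _ _).trans (le_of_eq ?_)
    exact Finset.sum_congr rfl fun p _ => by rw [norm_mul, RCLike.norm_conj]
  have h2 := Finset.sum_mul_sq_le_sq_mul_sq (Finset.univ : Finset (b × a))
    (fun p => ‖M p.2 p.1‖) fun p => ‖N p.2 p.1‖
  have h3 : ∀ L : Matrix a b ℂ, ∑ p : b × a, ‖L p.2 p.1‖ ^ 2 = ∑ x, ∑ y, ‖L x y‖ ^ 2 := by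
    intro L
    rw [Fintype.sum_prod_type, Finset.sum_comm]
  rw [h3, h3] at h2
  refine le_trans ?_ h2
  rw [← sq_abs]
  exact pow_le_pow_left₀ (abs_nonneg _) h1 2

theorem isLittleO_re_trace {a b : Type*} [Fintype a] [Fintype b] {M : ℝ → Matrix a b ℂ}
    {F : ℝ → ℝ} (hM : ∀ x y, (fun ε => M ε x y) =o[𝓝 0] F) (N : Matrix a b ℂ) :
    (fun ε => ((M ε)ᴴ * N).trace.re) =o[𝓝 0] F := by
  refine IsBigO.trans_isLittleO (IsBigO.of_bound 1 (Eventually.of_forall fun ε => ?_))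
    (IsLittleO.fun_sum (s := Finset.univ) fun y _ => IsLittleO.fun_sum (s := Finset.univ) fun x _ =>
      (hM x y).norm_left.mul_isBigO (isBigO_const_const (‖N x y‖) (one_ne_zero (α := ℝ)) _) |>.congr_right
        fun ε => mul_one _)
  rw [one_mul, trace_conjTranspose_mul_eq, Real.norm_eq_abs, Real.norm_eq_abs,
    abs_of_nonneg (a := ∑ _, _) (by positivity)]
  refine (Complex.abs_re_le_norm _).trans ((norm_sum_le _ _).trans (Finset.sum_le_sum fun y _ =>
    (norm_sum_le _ _).trans (Finset.sum_le_sum fun x _ => ?_)))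
  rw [norm_mul, RCLike.norm_conj]

theorem isBigO_re_trace {a b : Type*} [Fintype a] [Fintype b] {M N : ℝ → Matrix a b ℂ}
    {F F' : ℝ → ℝ} (hM : ∀ x y, (fun ε => M ε x y) =O[𝓝 0] F)
    (hN : ∀ x y, (fun ε => N ε x y) =O[𝓝 0] F') :
    (fun ε => ((M ε)ᴴ * N ε).trace.re) =O[𝓝 0] fun ε => F ε * F' ε := by
  refine IsBigO.trans (IsBigO.of_bound 1 (Eventually.of_forall fun ε => ?_))
    (IsBigO.fun_sum (s := Finset.univ) fun y _ => IsBigO.fun_sum (s := Finset.univ) fun x _ =>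
      (hM x y).norm_left.mul (hN x y).norm_left)
  rw [one_mul, trace_conjTranspose_mul_eq, Real.norm_eq_abs, Real.norm_eq_abs,
    abs_of_nonneg (a := ∑ _, _) (by positivity)]
  refine (Complex.abs_re_le_norm _).trans ((norm_sum_le _ _).trans (Finset.sum_le_sum fun y _ =>
    (norm_sum_le _ _).trans (Finset.sum_le_sum fun x _ => ?_)))
  rw [norm_mul, RCLike.norm_conj]

theorem trace_one_kronecker_mul {G : Matrix (l × β) (l × β) ℂ}
    (hG : ∀ b b', ∑ i, G (i, b) (i, b') = 0) (M : Matrix β β ℂ) :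
    (((1 : Matrix l l ℂ) ⊗ₖ M) * G).trace = 0 := by
  have h : ∀ i b, (((1 : Matrix l l ℂ) ⊗ₖ M) * G) (i, b) (i, b) =
      ∑ b', M b b' * G (i, b') (i, b) := by
    intro i b
    rw [Matrix.mul_apply, Fintype.sum_prod_type, Finset.sum_eq_single i]
    · simp
    · intro j _ hj
      simp [hj.symm]
    · simp
  simp only [Matrix.trace, Matrix.diag_apply, Fintype.sum_prod_type, h]
  rw [Finset.sum_comm]
  refine Finset.sum_eq_zero fun b _ => ?_
  rw [Finset.sum_comm]
  simp_rw [← Finset.mul_sum, hG, mul_zero, Finset.sum_const_zero]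

theorem sum_norm_sq_reshape (K : Matrix ((l × κ) × β) l ℂ) :
    ∑ x, ∑ y, ‖reshape K x y‖ ^ 2 = ∑ x, ∑ j, ‖K x j‖ ^ 2 := by
  rw [Fintype.sum_prod_type (f := fun x : (l × κ) × β => _)]
  refine Finset.sum_congr rfl fun x _ => ?_
  rw [Fintype.sum_prod_type, Finset.sum_comm]
  rfl

/-- A product recovery of `attachResource`, applied to a state of the environment. -/
theorem exists_reshape_product (RA : Matrix.unitaryGroup (l × κ) ℂ)
    (RB : Matrix.unitaryGroup β ℂ) (t : κ × β → ℂ) :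
    ∃ M : Matrix β β ℂ,
      (reshape (((RA : Matrix (l × κ) (l × κ) ℂ) ⊗ₖ (RB : Matrix β β ℂ))ᴴ *
          attachResource (l := l) t))ᴴ *
        reshape (((RA : Matrix (l × κ) (l × κ) ℂ) ⊗ₖ (RB : Matrix β β ℂ))ᴴ *
          attachResource (l := l) t) = (1 : Matrix l l ℂ) ⊗ₖ M := by
  set F : Matrix κ β ℂ := vecMat t * ((RB : Matrix β β ℂ)ᴴ)ᵀ with hF
  refine ⟨Fᴴ * F, ?_⟩
  have h : reshape (((RA : Matrix (l × κ) (l × κ) ℂ) ⊗ₖ (RB : Matrix β β ℂ))ᴴ *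
      attachResource (l := l) t) =
      (RA : Matrix (l × κ) (l × κ) ℂ)ᴴ * ((1 : Matrix l l ℂ) ⊗ₖ F) := by
    have h1 : ((RA : Matrix (l × κ) (l × κ) ℂ) ⊗ₖ (RB : Matrix β β ℂ))ᴴ =
        ((RA : Matrix (l × κ) (l × κ) ℂ)ᴴ ⊗ₖ (1 : Matrix β β ℂ)) *
          ((1 : Matrix (l × κ) (l × κ) ℂ) ⊗ₖ (RB : Matrix β β ℂ)ᴴ) := by
      rw [Matrix.conjTranspose_kronecker, ← Matrix.mul_kronecker_mul, mul_one, one_mul]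
    rw [h1, Matrix.mul_assoc, reshape_mul, reshape_mul_right, reshape_attachResource,
      ← Matrix.mul_kronecker_mul, mul_one]
  rw [h, Matrix.conjTranspose_mul, Matrix.conjTranspose_conjTranspose, Matrix.mul_assoc,
    ← Matrix.mul_assoc (RA : Matrix (l × κ) (l × κ) ℂ), unitary_mul_conjTranspose, Matrix.one_mul,
    Matrix.conjTranspose_kronecker, ← Matrix.mul_kronecker_mul, Matrix.conjTranspose_one, one_mul]

/-- The hypothesis is Cauchy-Schwarz against a vector of squared norm S. Dividing by dS gives x ≥
(S/d) ε² up to o(ε²), and the strict gap c < S/d absorbs the error. -/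
theorem eventually_mul_sq_le {x r : ℝ → ℝ} {S d c : ℝ} (hd : 0 < d) (hS : 0 ≤ S)
    (hx : ∀ ε, 0 ≤ x ε) (hr : r =o[𝓝 0] fun ε : ℝ => ε)
    (h : ∀ ε, (ε * S + r ε) ^ 2 ≤ d * x ε * S) (hc : c < S / d) :
    ∀ᶠ ε in 𝓝 (0 : ℝ), c * ε ^ 2 ≤ x ε := by
  rcases le_or_gt c 0 with h0 | h0
  · exact Eventually.of_forall fun ε => (mul_nonpos_of_nonpos_of_nonneg h0 (sq_nonneg ε)).trans (hx ε)
  have hS0 : 0 < S := by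
    by_contra h1
    have : S = 0 := le_antisymm (not_lt.mp h1) hS
    simp [this] at hc
    linarith
  have hcS : c * d < S := (lt_div_iff₀ hd).mp hc
  filter_upwards [hr.bound (c := (S - c * d) / 2) (by linarith)] with ε hε
  rw [Real.norm_eq_abs, Real.norm_eq_abs] at hε
  have h1 : -(|ε| * |r ε|) ≤ ε * r ε := by rw [← abs_mul]; exact neg_abs_le _
  have h2 : |ε| * |r ε| ≤ (S - c * d) / 2 * ε ^ 2 := by
    rw [← sq_abs ε]; nlinarith [mul_le_mul_of_nonneg_left hε (abs_nonneg ε)]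
  have h3 : S * (d * (c * ε ^ 2)) ≤ S * (d * x ε) := by
    nlinarith [h ε, sq_nonneg (r ε), mul_le_mul_of_nonneg_left (h1.trans' (neg_le_neg h2)) hS]
  exact le_of_mul_le_mul_left (le_of_mul_le_mul_left h3 hS0) hd

set_option maxHeartbeats 800000 in
-- Let V be the exactly recoverable encoding closest to K for the given recovery, and N = A₀G. Then
-- ‖K - V‖² is d times the infidelity, and Re⟨K - V, N⟩ = ε‖N‖² + o(ε): K moves along N at rate
-- ‖N‖², whereas V stays on a set whose displacement from A₀ is orthogonal to N up to second order.
-- Cauchy-Schwarz concludes. No regularity of the recoveries in ε is used, only that their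
-- infidelity is O(ε²).
theorem infid_le_of_recovery [Nonempty l] {χ : κ × β → ℂ}
    {W : Matrix ((l × κ) × β) ((l × κ) × β) ℂ} {X : Matrix (l × κ) (l × κ) ℂ}
    {J : Matrix ((l × κ) × β) l ℂ} {G : Matrix (l × β) (l × β) ℂ} {e : κ × β → ℂ}
    (hX : X.IsHermitian)
    (hJ : J = Complex.I • (W * attachResource (l := l) χ - (X ⊗ₖ (1 : Matrix β β ℂ)) * attachResource (l := l) χ))
    (hGh : G.IsHermitian) (hG : ∀ b b', ∑ i, G (i, b) (i, b') = 0)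
    (hJG : reshape J = reshape (attachResource (l := l) χ) * G + reshape (attachResource e))
    {K : ℝ → Matrix ((l × κ) × β) l ℂ} (hK : ∀ ε, (K ε)ᴴ * K ε = 1)
    (hKW : ∀ x j, (fun ε => K ε x j - attachResource χ x j -
      ε * (Complex.I • (W * attachResource (l := l) χ)) x j) =o[𝓝 0] fun ε : ℝ => ε)
    (RA : ℝ → Matrix.unitaryGroup (l × κ) ℂ) (RB : ℝ → Matrix.unitaryGroup β ℂ)
    (hO : (fun ε => 1 - fid (((RA ε : Matrix (l × κ) (l × κ) ℂ) ⊗ₖ (RB ε : Matrix β β ℂ)) * K ε))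
      =O[𝓝 0] fun ε : ℝ => ε ^ 2) {c : ℝ} (hc : c < infid χ G) :
    ∀ᶠ ε in 𝓝 (0 : ℝ), c * ε ^ 2 ≤
      1 - fid (((RA ε : Matrix (l × κ) (l × κ) ℂ) ⊗ₖ (RB ε : Matrix β β ℂ)) * K ε) := by
  have hd : (0 : ℝ) < Fintype.card l := by exact_mod_cast Fintype.card_pos
  set R : ℝ → Matrix ((l × κ) × β) ((l × κ) × β) ℂ :=
    fun ε => (RA ε : Matrix (l × κ) (l × κ) ℂ) ⊗ₖ (RB ε : Matrix β β ℂ) with hR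
  have hRR : ∀ ε, R ε * (R ε)ᴴ = 1 := fun ε => by
    have := Matrix.mem_unitaryGroup_iff.mp (kronecker_unitary (RA ε) (RB ε))
    exact this
  have hRR' : ∀ ε, (R ε)ᴴ * R ε = 1 := fun ε => by
    have := Matrix.mem_unitaryGroup_iff'.mp (kronecker_unitary (RA ε) (RB ε))
    exact this
  have hRK : ∀ ε, (R ε * K ε)ᴴ * (R ε * K ε) = 1 := fun ε => by
    rw [Matrix.conjTranspose_mul, Matrix.mul_assoc, ← Matrix.mul_assoc (R ε)ᴴ, hRR',
      Matrix.one_mul, hK]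
  set V : ℝ → Matrix ((l × κ) × β) l ℂ :=
    fun ε => (R ε)ᴴ * attachResource (l := l) (traceVec (R ε * K ε)) with hV
  have hKV : ∀ ε, K ε - V ε = (R ε)ᴴ * recoveryResidual (R ε * K ε) := fun ε => by
    rw [hV, recoveryResidual, Matrix.mul_sub, ← Matrix.mul_assoc, hRR', Matrix.one_mul]
  have hnorm : ∀ ε, ∑ x, ∑ j, ‖(K ε - V ε) x j‖ ^ 2 =
      Fintype.card l * (1 - fid (R ε * K ε)) := by
    intro ε
    rw [← sum_recoveryResidual_norm_sq (hRK ε)]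
    apply Complex.ofReal_injective
    rw [sum_norm_sq_eq_trace, sum_norm_sq_eq_trace, hKV, Matrix.conjTranspose_mul,
      Matrix.conjTranspose_conjTranspose, Matrix.mul_assoc, ← Matrix.mul_assoc (R ε), hRR,
      Matrix.one_mul]
  have hKVO : ∀ x j, (fun ε => (K ε - V ε) x j) =O[𝓝 0] fun ε : ℝ => ε := by
    intro x j
    have h1 : (fun ε => ‖(K ε - V ε) x j‖ ^ 2) =O[𝓝 0] fun ε : ℝ => ε ^ 2 := by
      refine IsBigO.trans (IsBigO.of_bound 1 (Eventually.of_forall fun ε => ?_))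
        (hO.const_mul_left (Fintype.card l : ℝ))
      rw [one_mul, ← hnorm, Real.norm_eq_abs, Real.norm_eq_abs, abs_of_nonneg (by positivity),
        abs_of_nonneg (by positivity)]
      exact (Finset.single_le_sum (f := fun j => ‖(K ε - V ε) x j‖ ^ 2)
        (fun j _ => by positivity) (Finset.mem_univ j)).trans
        (Finset.single_le_sum (f := fun x => ∑ j, ‖(K ε - V ε) x j‖ ^ 2)
        (fun x _ => by positivity) (Finset.mem_univ x))
    exact (h1.of_pow two_ne_zero).of_norm_left
  set A := reshape (attachResource (l := l) χ) with hA
  set N := A * G with hN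
  set Y := reshape (Complex.I • (W * attachResource (l := l) χ)) with hY
  have hYo : ∀ x y, (fun ε : ℝ => (reshape (K ε) - A - (ε : ℂ) • Y) x y) =o[𝓝 0]
      fun ε : ℝ => ε := fun x y => hKW (x, y.2) y.1
  have hKA : ∀ x y, (fun ε : ℝ => (reshape (K ε) - A) x y) =O[𝓝 0] fun ε : ℝ => ε := by
    intro x y
    have h1 : (fun ε : ℝ => (ε : ℂ) * Y x y) =O[𝓝 0] fun ε : ℝ => ε :=
      IsBigO.of_bound ‖Y x y‖ (Eventually.of_forall fun ε => by
        rw [norm_mul, Complex.norm_real, mul_comm])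
    exact ((hYo x y).isBigO.add h1).congr_left fun ε => by simp
  have hDO : ∀ x y, (fun ε : ℝ => (reshape (V ε) - A) x y) =O[𝓝 0] fun ε : ℝ => ε := by
    intro x y
    exact ((hKA x y).sub (hKVO (x, y.2) y.1)).congr_left fun ε => by
      simp [reshape]
  have hAA : (Aᴴ * A * G).trace = 0 := by
    rw [hA, reshape_attachResource, Matrix.conjTranspose_kronecker, ← Matrix.mul_kronecker_mul,
      Matrix.conjTranspose_one, one_mul]
    exact trace_one_kronecker_mul hG _
  have hVV : ∀ ε, ((reshape (V ε))ᴴ * reshape (V ε) * G).trace = 0 := by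
    intro ε
    obtain ⟨M, hM⟩ : ∃ M : Matrix β β ℂ,
        (reshape (V ε))ᴴ * reshape (V ε) = (1 : Matrix l l ℂ) ⊗ₖ M :=
      exists_reshape_product (RA ε) (RB ε) (traceVec (R ε * K ε))
    rw [hM]
    exact trace_one_kronecker_mul hG M
  -- Both V†V and A†A have the form 1 ⊗ M, so their traces against G vanish. Expanding V = A + D
  -- turns the linear term into minus half the quadratic one, which is O(ε²) since D = O(ε).
  have hDN : ∀ ε, ((reshape (V ε) - A)ᴴ * N).trace.re =
      -(1 / 2) * ((reshape (V ε) - A)ᴴ * ((reshape (V ε) - A) * G)).trace.re := by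
    intro ε
    have h1 := hVV ε
    set D := reshape (V ε) - A with hD
    have hVD : reshape (V ε) = D + A := by rw [hD]; abel
    rw [hVD, Matrix.conjTranspose_add] at h1
    have h2 : (Dᴴ + Aᴴ) * (D + A) * G = Dᴴ * (D * G) + Dᴴ * N + Aᴴ * D * G + Aᴴ * A * G := by
      rw [hN]
      simp only [Matrix.add_mul, Matrix.mul_add, Matrix.mul_assoc]
      abel
    rw [h2] at h1
    simp only [Matrix.trace_add, hAA, add_zero] at h1
    have h3 : (Aᴴ * D * G).trace = star (Dᴴ * N).trace := by
      rw [← Matrix.trace_conjTranspose, Matrix.conjTranspose_mul, Matrix.conjTranspose_conjTranspose,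
        hN, Matrix.conjTranspose_mul, hGh.eq, Matrix.mul_assoc, Matrix.trace_mul_comm,
        Matrix.mul_assoc, Matrix.mul_assoc, Matrix.trace_mul_comm, Matrix.mul_assoc]
    rw [h3] at h1
    have h4 := congrArg Complex.re h1
    simp only [Complex.add_re, Complex.zero_re, Complex.star_def, Complex.conj_re] at h4
    linarith
  have hDGO : ∀ x y, (fun ε : ℝ => ((reshape (V ε) - A) * G) x y) =O[𝓝 0] fun ε : ℝ => ε := by
    intro x y
    simp only [Matrix.mul_apply (M := _ - _)]
    refine IsBigO.fun_sum fun z _ => ?_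
    exact ((hDO x z).const_mul_left (G z y)).congr_left fun ε => mul_comm _ _
  have hDNo : (fun ε => ((reshape (V ε) - A)ᴴ * N).trace.re) =o[𝓝 0] fun ε : ℝ => ε := by
    have h1 := (isBigO_re_trace hDO hDGO).const_mul_left (-(1 / 2))
    simp_rw [hDN]
    refine h1.trans_isLittleO ?_
    have : (fun ε : ℝ => ε ^ 2) =o[𝓝 0] fun ε : ℝ => ε ^ 1 := isLittleO_pow_pow one_lt_two
    simpa [sq] using this
  -- Of the three parts of iW only N itself contributes: the change of resource is orthogonal to N,
  -- and the generator X gives i times the trace of a product of two Hermitian matrices, which is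
  -- imaginary.
  have hYN : (Yᴴ * N).trace.re = ∑ x, ∑ y, ‖N x y‖ ^ 2 := by
    have h1 : Y = N + reshape (attachResource e) + Complex.I • (X * A) := by
      rw [← hJG, hJ, hY]
      have h2 := reshape_mul X (attachResource (l := l) χ)
      rw [← hA] at h2
      rw [← h2]
      ext x y
      simp only [reshape, Matrix.add_apply, Matrix.smul_apply, Matrix.sub_apply, smul_eq_mul]
      ring
    have h2 : ((reshape (attachResource (l := l) e))ᴴ * N).trace = 0 := by
      rw [hN, ← Matrix.mul_assoc, hA, reshape_attachResource, reshape_attachResource,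
        Matrix.conjTranspose_kronecker, ← Matrix.mul_kronecker_mul,
        Matrix.conjTranspose_one, one_mul]
      exact trace_one_kronecker_mul hG _
    have h3 : ((X * A)ᴴ * N).trace.im = 0 := by
      have : star ((X * A)ᴴ * N).trace = ((X * A)ᴴ * N).trace := by
        rw [← Matrix.trace_conjTranspose, Matrix.conjTranspose_mul,
          Matrix.conjTranspose_conjTranspose, hN, Matrix.conjTranspose_mul, hGh.eq,
          Matrix.conjTranspose_mul, hX.eq, Matrix.mul_assoc, Matrix.trace_mul_comm]
        simp only [Matrix.mul_assoc]
      exact Complex.conj_eq_iff_im.mp this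
    rw [h1, Matrix.conjTranspose_add, Matrix.conjTranspose_add, Matrix.conjTranspose_smul,
      Matrix.add_mul, Matrix.add_mul, Matrix.trace_add, Matrix.trace_add, h2, Matrix.smul_mul,
      Matrix.trace_smul, ← sum_norm_sq_eq_trace]
    rw [add_zero, Complex.add_re, Complex.ofReal_re]
    simp only [smul_eq_mul, Complex.mul_re, h3]
    simp
  have hfin : (fun ε => ((reshape (K ε) - reshape (V ε))ᴴ * N).trace.re -
      ε * ∑ x, ∑ y, ‖N x y‖ ^ 2) =o[𝓝 0] fun ε : ℝ => ε := by
    refine ((isLittleO_re_trace hYo N).sub hDNo).congr_left fun ε => ?_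
    rw [← hYN]
    have h1 : reshape (K ε) - reshape (V ε) = (reshape (K ε) - A - (ε : ℂ) • Y) + (ε : ℂ) • Y -
      (reshape (V ε) - A) := by abel
    rw [h1]
    rw [Matrix.conjTranspose_sub (_ + _), Matrix.conjTranspose_add, Matrix.sub_mul, Matrix.add_mul,
      Matrix.trace_sub, Matrix.trace_add, Matrix.conjTranspose_smul, Matrix.smul_mul,
      Matrix.trace_smul, Complex.sub_re, Complex.add_re]
    simp
    ring
  refine eventually_mul_sq_le (x := fun ε => 1 - fid (R ε * K ε)) hd
    (by positivity : 0 ≤ ∑ x, ∑ y, ‖N x y‖ ^ 2) (fun ε => fid_le_one (hRK ε)) hfin (fun ε => ?_) hc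
  rw [add_sub_cancel, ← hnorm, ← sum_norm_sq_reshape]
  exact sq_re_trace_le _ _

end LowerBound

/-! ### Entropy and the largest eigenvalue of a density matrix -/

section TopEigenvalue

open scoped ComplexOrder

variable {m : Type*} [Fintype m] [DecidableEq m]

theorem negMulLog_le_gibbs {x y : ℝ} (hx : 0 ≤ x) (hy : 0 < y) :
    Real.negMulLog x ≤ -x * Real.log y + (y - x) := by
  rcases hx.eq_or_lt with rfl | hx
  · simpa using hy.le
  · have h := Real.log_le_sub_one_of_pos (div_pos hy hx)
    rw [Real.log_div hy.ne' hx.ne'] at h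
    have h2 := mul_le_mul_of_nonneg_left h hx.le
    have h3 : x * (y / x - 1) = y - x := by field_simp
    rw [Real.negMulLog]
    linarith

theorem vnEntropy_le_log_card [Nonempty m] {C : Matrix m m ℂ} (hC : C.PosSemidef)
    (htr : C.trace = 1) : vnEntropy C ≤ Real.log (Fintype.card m) := by
  have hm : (0 : ℝ) < Fintype.card m := by exact_mod_cast Fintype.card_pos
  have hsum : ∑ i, hC.1.eigenvalues i = 1 := by
    have := hC.1.trace_eq_sum_eigenvalues
    rw [htr] at this
    exact Complex.ofReal_injective (by simpa using this.symm)
  rw [vnEntropy_eq_sum hC.1]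
  refine (Finset.sum_le_sum fun i _ =>
    negMulLog_le_gibbs (hC.eigenvalues_nonneg i) (inv_pos.mpr hm)).trans (le_of_eq ?_)
  rw [Finset.sum_add_distrib, ← Finset.sum_mul, Finset.sum_neg_distrib, Finset.sum_sub_distrib,
    hsum, Real.log_inv]
  simp [hm.ne']

/-- The last entropy bound, with y ≥ 1 - t, and the lower bound `negMulLog (1 - t)` have the same
leading term with coefficient one. This sharpness allows the coefficient of ε² in 1 - t to be read
off from entropies. The upper bound is Gibbs' inequality with the common weight y for all
eigenvalues but the top one. -/
theorem exists_topEigenvector [Nonempty m] {C : Matrix m m ℂ} (hC : C.PosSemidef)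
    (htr : C.trace = 1) :
    ∃ (a : m → ℂ) (t : ℝ), ∑ x, ‖a x‖ ^ 2 = 1 ∧ C *ᵥ a = (t : ℂ) • a ∧ 0 < t ∧ t ≤ 1 ∧
      Real.negMulLog (1 - t) ≤ vnEntropy C ∧ -Real.log t ≤ vnEntropy C ∧
      (∀ v : m → ℂ, (star v ⬝ᵥ C *ᵥ v).re ≤ t * ∑ x, ‖v x‖ ^ 2) ∧
      (∀ y, 0 < y → y ≤ 1 → 1 - t ≤ y →
        vnEntropy C ≤ Real.negMulLog y + (Fintype.card m + 1) * y) := by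
  set μ := hC.1.eigenvalues with hμ
  have hμ0 : ∀ i, 0 ≤ μ i := hC.eigenvalues_nonneg
  have hsum : ∑ i, μ i = 1 := by
    have := hC.1.trace_eq_sum_eigenvalues
    rw [htr] at this
    exact Complex.ofReal_injective (by simpa using this.symm)
  obtain ⟨k, hk⟩ := Finite.exists_max μ
  have hrest : ∑ i ∈ Finset.univ.erase k, μ i = 1 - μ k := by
    rw [← hsum, ← Finset.add_sum_erase _ _ (Finset.mem_univ k)]; ring
  have hk0 : 0 < μ k := by
    by_contra h
    have h1 : ∀ i, μ i = 0 := fun i => le_antisymm ((hk i).trans (not_lt.mp h)) (hμ0 i)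
    simp [h1] at hsum
  have hle : ∀ i, μ i ≤ 1 := fun i => by
    rw [← hsum]; exact Finset.single_le_sum (fun j _ => hμ0 j) (Finset.mem_univ i)
  have hS : vnEntropy C = Real.negMulLog (μ k) + ∑ i ∈ Finset.univ.erase k, Real.negMulLog (μ i) := by
    rw [vnEntropy_eq_sum hC.1]
    exact (Finset.add_sum_erase _ (fun i => Real.negMulLog (μ i)) (Finset.mem_univ k)).symm
  refine ⟨hC.1.eigenvectorBasis k, μ k, ?_, ?_, hk0, hle k, ?_, ?_, ?_, ?_⟩
  · have h := hC.1.eigenvectorBasis.orthonormal.1 k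
    rw [EuclideanSpace.norm_eq, Real.sqrt_eq_one] at h
    exact h
  · exact hC.1.mulVec_eigenvectorBasis k
  · rw [hS, ← zero_add (Real.negMulLog (1 - μ k))]
    refine add_le_add (Real.negMulLog_nonneg (hμ0 k) (hle k)) ?_
    rw [Real.negMulLog, ← hrest, ← Finset.sum_neg_distrib, Finset.sum_mul]
    refine Finset.sum_le_sum fun i hi => ?_
    rw [hrest, Real.negMulLog]
    rcases (hμ0 i).eq_or_lt with h0 | h0
    · simp [← h0]
    · have h1 : μ i ≤ 1 - μ k := by
        rw [← hrest]
        exact Finset.single_le_sum (fun j _ => hμ0 j) hi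
      have h2 := Real.log_le_log h0 h1
      nlinarith
  · rw [vnEntropy_eq_sum hC.1]
    calc -Real.log (μ k) = ∑ i, -μ i * Real.log (μ k) := by
          rw [← Finset.sum_mul, Finset.sum_neg_distrib, hsum]; ring
      _ ≤ _ := by
          refine Finset.sum_le_sum fun i _ => ?_
          rw [Real.negMulLog]
          rcases (hμ0 i).eq_or_lt with h0 | h0
          · change -μ i * _ ≤ -μ i * _
            simp [← h0]
          · have h2 := Real.log_le_log h0 (hk i)
            change -μ i * _ ≤ -μ i * _
            nlinarith
  · intro v
    have hpsd : ((μ k : ℂ) • (1 : Matrix m m ℂ) - C).PosSemidef := by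
      have h := hC.1.spectral_theorem
      rw [Unitary.conjStarAlgAut_apply] at h
      have hU : (hC.1.eigenvectorUnitary : Matrix m m ℂ) *
        star (hC.1.eigenvectorUnitary : Matrix m m ℂ) = 1 := Unitary.coe_mul_star_self _
      have h1 : (μ k : ℂ) • (1 : Matrix m m ℂ) - C =
          (hC.1.eigenvectorUnitary : Matrix m m ℂ) *
            Matrix.diagonal (fun i => (μ k : ℂ) - (μ i : ℂ)) *
            (hC.1.eigenvectorUnitary : Matrix m m ℂ)ᴴ := by
        have h2 : Matrix.diagonal (fun i => (μ k : ℂ) - (μ i : ℂ)) =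
            (μ k : ℂ) • (1 : Matrix m m ℂ) - Matrix.diagonal (RCLike.ofReal ∘ hC.1.eigenvalues) := by
          rw [← Matrix.diagonal_one, ← Matrix.diagonal_smul, Matrix.diagonal_sub]
          congr 1
          ext i
          simp [hμ]
        rw [h2, Matrix.mul_sub, Matrix.sub_mul, Matrix.mul_smul, Matrix.mul_one, Matrix.smul_mul,
          ← Matrix.star_eq_conjTranspose, hU, ← h]
      rw [h1]
      refine Matrix.PosSemidef.mul_mul_conjTranspose_same ?_ _
      rw [Matrix.posSemidef_diagonal_iff]
      intro i
      rw [← Complex.ofReal_sub]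
      exact_mod_cast sub_nonneg.mpr (hk i)
    have h := hpsd.re_dotProduct_nonneg v
    rw [Matrix.sub_mulVec, dotProduct_sub, map_sub, Matrix.smul_mulVec, Matrix.one_mulVec,
      dotProduct_smul] at h
    have h2 : star v ⬝ᵥ v = ((∑ x, ‖v x‖ ^ 2 : ℝ) : ℂ) := by
      rw [dotProduct]
      push_cast
      exact Finset.sum_congr rfl fun x _ => Complex.conj_mul' (v x)
    rw [h2, smul_eq_mul, ← Complex.ofReal_mul, RCLike.re_eq_complex_re, Complex.ofReal_re] at h
    linarith
  · intro y hy hy1 hty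
    have h1 : Real.negMulLog (μ k) ≤ 1 - μ k := by
      simpa using negMulLog_le_gibbs hk0.le one_pos
    have h2 : ∑ i ∈ Finset.univ.erase k, Real.negMulLog (μ i) ≤
        -(1 - μ k) * Real.log y + Fintype.card m * y := by
      refine (Finset.sum_le_sum fun i _ => negMulLog_le_gibbs (hμ0 i) hy).trans ?_
      rw [Finset.sum_add_distrib, ← Finset.sum_mul, Finset.sum_neg_distrib,
        Finset.sum_sub_distrib, hrest, Finset.sum_const, nsmul_eq_mul]
      have h3 : ((Finset.univ.erase k).card : ℝ) ≤ Fintype.card m := by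
        exact_mod_cast Finset.card_le_univ _
      have := hle k
      nlinarith
    have h4 := Real.log_nonpos hy.le hy1
    rw [hS, show Real.negMulLog y = -y * Real.log y from rfl]
    nlinarith

end TopEigenvalue

/-! ### The Choi state of the recovered channel -/

section Choi

open scoped ComplexOrder

variable {l κ β : Type*} [Fintype l] [DecidableEq l] [Fintype κ] [DecidableEq κ]
  [Fintype β] [DecidableEq β]

/-- The output of `chan K ⊗ id` on the maximally entangled state. -/
noncomputable def choi (K : Matrix ((l × κ) × β) l ℂ) : Matrix (l × l) (l × l) ℂ :=
  tensorRef (chan K) (ketbra (maxEntangled l))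

/-- The coefficients of the purified Choi state. -/
noncomputable def choiVec (K : Matrix ((l × κ) × β) l ℂ) : Matrix (l × l) (κ × β) ℂ :=
  fun x y => ((Real.sqrt (Fintype.card l))⁻¹ : ℝ) * kraus K y.1 y.2 x.1 x.2

theorem chan_apply (K : Matrix ((l × κ) × β) l ℂ) (σ : Matrix l l ℂ) :
    chan K σ = ∑ y : κ × β, kraus K y.1 y.2 * σ * (kraus K y.1 y.2)ᴴ := by
  ext i j
  rw [Matrix.sum_apply, Fintype.sum_prod_type]
  rfl

theorem choi_eq (K : Matrix ((l × κ) × β) l ℂ) : choi K = choiVec K * (choiVec K)ᴴ := by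
  ext ⟨i, k⟩ ⟨j, m⟩
  change chan K (Matrix.of fun a b => ketbra (maxEntangled l) (a, k) (b, m)) i j = _
  rw [chan_apply, Matrix.sum_apply, Matrix.mul_apply]
  refine Finset.sum_congr rfl fun y _ => ?_
  rw [Matrix.mul_apply, Finset.sum_eq_single m]
  · rw [Matrix.mul_apply, Finset.sum_eq_single k]
    · simp [ketbra, maxEntangled, choiVec, Matrix.vecMulVec_apply]
      ring
    · intro k' _ hk
      simp [ketbra, maxEntangled, Matrix.vecMulVec_apply, hk]
    · simp
  · intro m' _ hm
    rw [Matrix.mul_apply, Finset.sum_eq_zero, zero_mul]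
    intro k' _
    simp [ketbra, maxEntangled, Matrix.vecMulVec_apply, hm]
  · simp

theorem choi_posSemidef (K : Matrix ((l × κ) × β) l ℂ) : (choi K).PosSemidef := by
  rw [choi_eq]
  exact Matrix.posSemidef_self_mul_conjTranspose _

theorem sum_choiVec_norm_sq [Nonempty l] {K : Matrix ((l × κ) × β) l ℂ} (hK : Kᴴ * K = 1) :
    ∑ x, ∑ y, ‖choiVec K x y‖ ^ 2 = 1 := by
  have hd : (0 : ℝ) < Fintype.card l := by exact_mod_cast Fintype.card_pos
  have h := sum_kraus_norm_sq hK
  have h1 : ∀ x y, ‖choiVec K x y‖ ^ 2 = (Fintype.card l : ℝ)⁻¹ * ‖K ((x.1, y.1), y.2) x.2‖ ^ 2 := by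
    intro x y
    rw [choiVec, norm_mul, mul_pow, Complex.norm_real, Real.norm_eq_abs, sq_abs, inv_pow,
      Real.sq_sqrt hd.le]
    rfl
  simp_rw [h1, ← Finset.mul_sum]
  have h2 : ∑ x : l × l, ∑ y : κ × β, ‖K ((x.1, y.1), y.2) x.2‖ ^ 2 = ∑ x, ∑ j, ‖K x j‖ ^ 2 := by
    simp only [Fintype.sum_prod_type]
    refine Finset.sum_congr rfl fun i _ => ?_
    rw [Finset.sum_comm]
    exact Finset.sum_congr rfl fun c _ => Finset.sum_comm
  rw [h2, h, inv_mul_cancel₀ hd.ne']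

theorem choi_trace [Nonempty l] {K : Matrix ((l × κ) × β) l ℂ} (hK : Kᴴ * K = 1) :
    (choi K).trace = 1 := by
  have h := sum_norm_sq_eq_trace (choiVec K)
  rw [sum_choiVec_norm_sq hK, Complex.ofReal_one] at h
  rw [choi_eq, Matrix.trace_mul_comm, ← h]

theorem ptraceSnd_choi (K : Matrix ((l × κ) × β) l ℂ) :
    ptraceSnd (choi K) =
      chan K (Matrix.diagonal fun _ => (((Fintype.card l : ℝ)⁻¹ : ℝ) : ℂ)) := by
  have hd : (0 : ℝ) ≤ Fintype.card l := by positivity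
  have h : (((Real.sqrt (Fintype.card l))⁻¹ : ℝ) : ℂ) * (((Real.sqrt (Fintype.card l))⁻¹ : ℝ) : ℂ) =
      (((Fintype.card l : ℝ)⁻¹ : ℝ) : ℂ) := by
    rw [← Complex.ofReal_mul, ← mul_inv, Real.mul_self_sqrt hd]
  ext i j
  rw [ptraceSnd, chan_apply, Matrix.sum_apply]
  simp_rw [choi_eq, Matrix.mul_apply (M := choiVec K)]
  rw [Finset.sum_comm]
  refine Finset.sum_congr rfl fun y _ => ?_
  rw [Matrix.mul_apply]
  refine Finset.sum_congr rfl fun k _ => ?_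
  rw [Matrix.mul_diagonal, ← h]
  simp only [choiVec, Matrix.conjTranspose_apply, star_mul', Complex.star_def, Complex.conj_ofReal]
  ring

theorem sum_maxEntangled_norm_sq [Nonempty l] : ∑ x, ‖maxEntangled l x‖ ^ 2 = 1 := by
  have hd : (0 : ℝ) < Fintype.card l := by exact_mod_cast Fintype.card_pos
  rw [Fintype.sum_prod_type]
  have h : ∀ i j : l, ‖maxEntangled l (i, j)‖ ^ 2 =
      if i = j then (Fintype.card l : ℝ)⁻¹ else 0 := by
    intro i j
    rw [maxEntangled]
    split_ifs with h
    · rw [Complex.norm_real, Real.norm_eq_abs, sq_abs, inv_pow, Real.sq_sqrt hd.le]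
    · simp
  simp [h, hd.ne']

theorem fid_eq_choi [Nonempty l] (K : Matrix ((l × κ) × β) l ℂ) :
    (star (maxEntangled l) ⬝ᵥ choi K *ᵥ maxEntangled l).re = fid K := by
  have hd : (0 : ℝ) < Fintype.card l := by exact_mod_cast Fintype.card_pos
  have h1 : star (maxEntangled l) ⬝ᵥ choi K *ᵥ maxEntangled l =
      star ((choiVec K)ᴴ *ᵥ maxEntangled l) ⬝ᵥ ((choiVec K)ᴴ *ᵥ maxEntangled l) := by
    rw [choi_eq, ← Matrix.mulVec_mulVec, Matrix.star_mulVec, Matrix.conjTranspose_conjTranspose,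
      Matrix.dotProduct_mulVec]
  have h2 : ∀ y, ((choiVec K)ᴴ *ᵥ maxEntangled l) y =
      ((Fintype.card l : ℝ)⁻¹ : ℝ) * star (kraus K y.1 y.2).trace := by
    intro y
    rw [Matrix.mulVec, dotProduct, Fintype.sum_prod_type, Matrix.trace, star_sum, Finset.mul_sum]
    refine Finset.sum_congr rfl fun i _ => ?_
    rw [Finset.sum_eq_single i]
    · have h : (((Real.sqrt (Fintype.card l))⁻¹ : ℝ) : ℂ) *
          (((Real.sqrt (Fintype.card l))⁻¹ : ℝ) : ℂ) = (((Fintype.card l : ℝ)⁻¹ : ℝ) : ℂ) := by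
        rw [← Complex.ofReal_mul, ← mul_inv, Real.mul_self_sqrt hd.le]
      rw [← h]
      simp only [choiVec, Matrix.conjTranspose_apply, star_mul', Complex.star_def,
        Complex.conj_ofReal, maxEntangled, if_true, Matrix.diag_apply]
      ring
    · intro j _ hj
      simp [maxEntangled, hj.symm]
    · simp
  rw [h1, dotProduct, Complex.re_sum, fid, Finset.sum_div, Fintype.sum_prod_type]
  refine Finset.sum_congr rfl fun c _ => ?_
  rw [Finset.sum_div]
  refine Finset.sum_congr rfl fun b _ => ?_
  rw [Pi.star_apply, h2, Complex.star_def, Complex.conj_mul', ← Complex.ofReal_pow,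
    Complex.ofReal_re, norm_mul, Complex.norm_real, RCLike.norm_conj, Real.norm_eq_abs, mul_pow, sq_abs]
  field_simp

end Choi

/-! ### Recoveries with nearly maximal coherent information -/

section Polar

open scoped ComplexOrder

variable {l : Type*} [Fintype l] [DecidableEq l]

/-- The unitary is the polar part of M, so that u†M = √(1 - Q); τ < 1 makes this root invertible.
The coefficient 1/2 in the trace bound is the sharp one, which the second-order matching of
infidelities needs. -/
theorem exists_polar {M Q : Matrix l l ℂ} (hQ : Q.PosSemidef) {τ : ℝ} (hτ : Q.trace = τ)
    (hτ1 : τ < 1) (h : Mᴴ * M + Q = 1) :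
    ∃ u : Matrix.unitaryGroup l ℂ, (∀ i j, ‖((u : Matrix l l ℂ)ᴴ * M - 1) i j‖ ≤ τ) ∧
      Fintype.card l - τ / 2 - τ ^ 2 / 2 ≤ ((u : Matrix l l ℂ)ᴴ * M).trace.re := by
  set V : Matrix l l ℂ := (hQ.1.eigenvectorUnitary : Matrix l l ℂ) with hV
  set q := hQ.1.eigenvalues with hq
  have hVV : V * Vᴴ = 1 := Unitary.coe_mul_star_self hQ.1.eigenvectorUnitary
  have hVV' : Vᴴ * V = 1 := Unitary.coe_star_mul_self hQ.1.eigenvectorUnitary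
  have hQV : Q = V * Matrix.diagonal (fun i => (q i : ℂ)) * Vᴴ := by
    have h := hQ.1.spectral_theorem
    rw [Unitary.conjStarAlgAut_apply] at h
    exact h
  have hq0 : ∀ i, 0 ≤ q i := hQ.eigenvalues_nonneg
  have hsum : ∑ i, q i = τ := by
    have := hQ.1.trace_eq_sum_eigenvalues
    rw [hτ] at this
    exact Complex.ofReal_injective (by simpa using this.symm)
  have hqτ : ∀ i, q i ≤ τ := fun i => by
    rw [← hsum]; exact Finset.single_le_sum (fun j _ => hq0 j) (Finset.mem_univ i)
  set s : l → ℝ := fun i => Real.sqrt (1 - q i) with hs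
  have hs0 : ∀ i, 0 < s i := fun i => Real.sqrt_pos.mpr (by linarith [hqτ i])
  have hss : ∀ i, s i * s i = 1 - q i := fun i => Real.mul_self_sqrt (by linarith [hqτ i])
  have hs1 : ∀ i, s i ≤ 1 := fun i => by nlinarith [hss i, hs0 i, hq0 i]
  have hsq : ∀ i, 1 - s i ≤ q i := fun i => by nlinarith [hss i, hs0 i, hq0 i, hs1 i]
  set N := M * V with hN
  have hNN : Nᴴ * N = Matrix.diagonal fun i => ((s i : ℂ) * s i) := by
    have h1 : Mᴴ * M = 1 - Q := by rw [← h]; abel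
    rw [hN, Matrix.conjTranspose_mul, Matrix.mul_assoc, ← Matrix.mul_assoc Mᴴ, h1, Matrix.sub_mul,
      Matrix.mul_sub, Matrix.one_mul, hVV', hQV]
    simp only [Matrix.mul_assoc, hVV', Matrix.mul_one]
    rw [← Matrix.mul_assoc, hVV', Matrix.one_mul, ← Matrix.diagonal_one, Matrix.diagonal_sub]
    congr 1
    ext i
    rw [← Complex.ofReal_mul, hss]
    push_cast
    rfl
  set D : Matrix l l ℂ := Matrix.diagonal fun i => ((s i)⁻¹ : ℂ) with hD
  have hDh : Dᴴ = D := by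
    rw [hD, Matrix.diagonal_conjTranspose]
    congr 1
    ext i
    simp
  have hsc : ∀ i, (s i : ℂ) ≠ 0 := fun i => by exact_mod_cast (hs0 i).ne'
  have hu : (N * D * Vᴴ)ᴴ * (N * D * Vᴴ) = 1 := by
    rw [Matrix.conjTranspose_mul, Matrix.conjTranspose_mul, hDh, Matrix.conjTranspose_conjTranspose]
    have h1 : D * (Nᴴ * N) * D = 1 := by
      rw [hNN, hD, Matrix.diagonal_mul_diagonal, Matrix.diagonal_mul_diagonal, ← Matrix.diagonal_one]
      congr 1
      ext i
      have := hsc i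
      field_simp
    calc V * (D * Nᴴ) * (N * D * Vᴴ) = V * (D * (Nᴴ * N) * D) * Vᴴ := by
          simp only [Matrix.mul_assoc]
      _ = 1 := by rw [h1, Matrix.mul_one, hVV]
  refine ⟨⟨N * D * Vᴴ, Matrix.mem_unitaryGroup_iff'.mpr hu⟩, ?_, ?_⟩
  all_goals
    have hP : (N * D * Vᴴ)ᴴ * M = V * Matrix.diagonal (fun i => (s i : ℂ)) * Vᴴ := by
      rw [Matrix.conjTranspose_mul, Matrix.conjTranspose_mul, hDh,
        Matrix.conjTranspose_conjTranspose]
      have h1 : D * (Nᴴ * N) = Matrix.diagonal (fun i => (s i : ℂ)) := by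
        rw [hNN, hD, Matrix.diagonal_mul_diagonal]
        congr 1
        ext i
        have := hsc i
        field_simp
      calc V * (D * Nᴴ) * M = V * (D * Nᴴ) * M * (V * Vᴴ) := by rw [hVV, Matrix.mul_one]
        _ = V * (D * (Nᴴ * N)) * Vᴴ := by simp only [hN, Matrix.mul_assoc]
        _ = _ := by rw [h1]
  · intro i j
    change ‖((N * D * Vᴴ)ᴴ * M - 1) i j‖ ≤ τ
    have h1 : (N * D * Vᴴ)ᴴ * M - 1 = V * Matrix.diagonal (fun i => (s i : ℂ) - 1) * Vᴴ := by
      have h2 : Matrix.diagonal (fun i => (s i : ℂ) - 1) =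
          Matrix.diagonal (fun i => (s i : ℂ)) - 1 := by
        rw [← Matrix.diagonal_one, Matrix.diagonal_sub]
      rw [hP, h2, Matrix.mul_sub, Matrix.sub_mul, Matrix.mul_one, hVV]
    rw [h1, Matrix.mul_apply, ← hsum]
    refine (norm_sum_le _ _).trans (Finset.sum_le_sum fun k _ => ?_)
    rw [Matrix.mul_diagonal, norm_mul, norm_mul, Matrix.conjTranspose_apply, norm_star,
      ← Complex.ofReal_one, ← Complex.ofReal_sub, Complex.norm_real, Real.norm_eq_abs,
      abs_sub_comm, abs_of_nonneg (by linarith [hs1 k])]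
    have h3 := entry_norm_bound_of_unitary hQ.1.eigenvectorUnitary.2 i k
    have h4 := entry_norm_bound_of_unitary hQ.1.eigenvectorUnitary.2 j k
    calc ‖V i k‖ * (1 - s k) * ‖V j k‖ ≤ 1 * (1 - s k) * 1 := by
          have := hs1 k
          gcongr
      _ ≤ q k := by linarith [hsq k]
  · change _ ≤ ((N * D * Vᴴ)ᴴ * M).trace.re
    rw [hP, Matrix.trace_mul_comm, ← Matrix.mul_assoc, hVV', Matrix.one_mul, Matrix.trace_diagonal,
      ← Complex.ofReal_sum, Complex.ofReal_re]
    -- On [0,1] one has √(1 - q) ≥ 1 - q/2 - q²/2. Weakening q² to τq makes the bound linear, so it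
    -- sums to a function of the trace.
    have h1 : ∀ i, 1 - q i / 2 - τ * q i / 2 ≤ s i := by
      intro i
      have h2 : 1 - q i / 2 - q i ^ 2 / 2 ≤ s i := by
        apply Real.le_sqrt_of_sq_le
        have := hq0 i
        have := hqτ i
        nlinarith [mul_nonneg (hq0 i) (hq0 i), mul_nonneg (mul_nonneg (hq0 i) (hq0 i)) (sub_nonneg.mpr ((hqτ i).trans hτ1.le)), mul_nonneg (mul_nonneg (mul_nonneg (hq0 i) (hq0 i)) (hq0 i)) (sub_nonneg.mpr ((hqτ i).trans hτ1.le))]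
      nlinarith [mul_le_mul_of_nonneg_right (hqτ i) (hq0 i)]
    refine le_trans (le_of_eq ?_) (Finset.sum_le_sum fun i _ => h1 i)
    rw [Finset.sum_sub_distrib, Finset.sum_sub_distrib, ← Finset.sum_div, ← Finset.sum_div,
      ← Finset.mul_sum, hsum]
    simp
    ring

end Polar

/-! ### Comparing entropies of size ε² log(1/ε) -/

section Entropic

/-- The entropy s is at least -δ log δ and at most -y log y + O(y) with y slightly above pε². If δ
exceeded ry with r > 1, the surplus (r - 1) y log(1/y) would beat every O(y) term. The error Bε² is
thus harmless and the constant p survives. -/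
theorem eventually_le_of_entropy_le {δ s s₀ x : ℝ → ℝ} {p B m q : ℝ} (hp : 0 ≤ p)
    (h1 : ∀ ε, δ ε ≤ s ε) (h2 : ∀ ε, Real.negMulLog (δ ε) ≤ s ε)
    (h3 : ∀ᶠ ε in 𝓝 (0 : ℝ), s ε ≤ s₀ ε + B * ε ^ 2)
    (h4 : ∀ ε y, 0 < y → y ≤ 1 → x ε ≤ y → s₀ ε ≤ Real.negMulLog y + m * y)
    (hx : (fun ε => x ε - ε ^ 2 * p) =o[𝓝 0] fun ε : ℝ => ε ^ 2) (hq : p < q) :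
    ∀ᶠ ε in 𝓝 (0 : ℝ), δ ε ≤ q * ε ^ 2 := by
  -- The gap between p and q is spent twice: q' > p absorbs the o(ε²) in x, and r = q/q' > 1 leaves
  -- room for the logarithm.
  set q' := (p + q) / 2 with hq'
  have hq0 : 0 < q' := by rw [hq']; linarith
  set r := q / q' with hr
  have hr1 : 1 < r := by rw [hr, one_lt_div hq0]; linarith
  set M := m + B / q' with hM
  have hlim : Tendsto (fun ε : ℝ => q' * ε ^ 2) (𝓝 0) (𝓝 0) := by
    have : Continuous fun ε : ℝ => q' * ε ^ 2 := by fun_prop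
    simpa using this.tendsto 0
  have hxy : ∀ᶠ ε in 𝓝 (0 : ℝ), x ε ≤ q' * ε ^ 2 := by
    filter_upwards [hx.bound (c := (q - p) / 2) (by linarith)] with ε hε
    rw [Real.norm_eq_abs, Real.norm_eq_abs, abs_of_nonneg (sq_nonneg ε)] at hε
    have := (abs_le.mp hε).2
    rw [hq']
    linarith
  have hlim2 : Tendsto (fun ε : ℝ => Real.negMulLog (q' * ε ^ 2) + M * (q' * ε ^ 2)) (𝓝 0) (𝓝 0) := by
    have := (Real.continuous_negMulLog.tendsto 0).comp hlim
    simpa using this.add (hlim.const_mul M)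
  have he : (0 : ℝ) < Real.exp (-1) := Real.exp_pos _
  have hsmall : ∀ᶠ ε in 𝓝 (0 : ℝ), Real.negMulLog (q' * ε ^ 2) + M * (q' * ε ^ 2) < Real.exp (-1) :=
    hlim2.eventually (gt_mem_nhds he)
  have hy1 : ∀ᶠ ε in 𝓝 (0 : ℝ), q' * ε ^ 2 < min 1 (Real.exp (-(M + r * Real.log r) / (r - 1))) :=
    hlim.eventually (gt_mem_nhds (lt_min one_pos (Real.exp_pos _)))
  have hz : ∀ᶠ ε in 𝓝 (0 : ℝ), r * (q' * ε ^ 2) < Real.exp (-1) := by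
    have := hlim.const_mul r
    rw [mul_zero] at this
    exact this.eventually (gt_mem_nhds he)
  -- The neighbourhood filter contains ε = 0, where y = 0 and the logarithmic argument is void;
  -- there y → 0⁺ is taken in `h4`.
  have hzero : δ 0 ≤ 0 := by
    have hx0 : x 0 ≤ 0 := by simpa using hxy.self_of_nhds
    have h5 : s 0 ≤ s₀ 0 := by simpa using h3.self_of_nhds
    have hl : Tendsto (fun y : ℝ => Real.negMulLog y + m * y) (𝓝[>] 0) (𝓝 0) := by
      have hc : Continuous fun y : ℝ => Real.negMulLog y + m * y :=
        Real.continuous_negMulLog.add (continuous_const.mul continuous_id)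
      have := hc.tendsto 0
      simp only [Real.negMulLog_zero, mul_zero, add_zero] at this
      exact this.mono_left nhdsWithin_le_nhds
    refine (h1 0).trans (h5.trans (ge_of_tendsto hl ?_))
    filter_upwards [Ioc_mem_nhdsGT (zero_lt_one (α := ℝ))] with y hy
    exact h4 0 y hy.1 hy.2 (hx0.trans hy.1.le)
  filter_upwards [hxy, hsmall, hy1, hz, h3] with ε e1 e2 e3 e4 e5
  by_cases hε : ε = 0
  · subst hε; simpa using hzero
  have hy0 : 0 < q' * ε ^ 2 := by positivity
  have hqy : q * ε ^ 2 = r * (q' * ε ^ 2) := by rw [hr]; field_simp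
  have hsM : s ε ≤ Real.negMulLog (q' * ε ^ 2) + M * (q' * ε ^ 2) := by
    have h5 := h4 ε _ hy0 (e3.le.trans (min_le_left _ _)) e1
    have h6 : B * ε ^ 2 = B / q' * (q' * ε ^ 2) := by field_simp
    rw [hM]
    linarith
  rw [hqy]
  set y := q' * ε ^ 2 with hy
  by_contra hcon
  rw [not_le] at hcon
  have hry : 0 < r * y := by positivity
  -- x log x decreases on [0, 1/e]; the crude bound δ ≤ s keeps δ in that interval.
  have h6 := Real.mul_log_strictAntiOn.antitoneOn ⟨hry.le, e4.le⟩
    ⟨hry.le.trans hcon.le, ((h1 ε).trans hsM).trans e2.le⟩ hcon.le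
  have h7 := (h2 ε).trans hsM
  rw [Real.negMulLog, Real.negMulLog] at h7
  have h8 : Real.log (r * y) = Real.log r + Real.log y :=
    Real.log_mul (by positivity) hy0.ne'
  simp only [h8] at h6
  have h9 : y * (-(r - 1) * Real.log y) ≤ y * (M + r * Real.log r) := by linarith
  have h10 := le_of_mul_le_mul_left h9 hy0
  have h11 := Real.log_lt_log hy0 (e3.trans_le (min_le_right _ _))
  rw [Real.log_exp, lt_div_iff₀ (by linarith)] at h11
  linarith

end Entropic

/-! ### Splitting Kraus operators along the top eigenvector of the Choi state -/

section Correction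

open scoped ComplexOrder

variable {l κ β : Type*} [Fintype l] [DecidableEq l] [Fintype κ] [DecidableEq κ]
  [Fintype β] [DecidableEq β]

/-- Pythagoras for vectors split along the conjugate of f and its orthogonal complement: the cross
terms vanish. -/
theorem sum_mul_conj_orthogonal {E : Type*} [Fintype E] {f ρ ρ' b b' : E → ℂ} {t α α' : ℂ}
    (ht : ∑ y, starRingEnd ℂ (f y) * f y = t) (hρ : ∑ y, ρ y * f y = 0)
    (hρ' : ∑ y, ρ' y * f y = 0) (hb : ∀ y, b y = α * starRingEnd ℂ (f y) + ρ y)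
    (hb' : ∀ y, b' y = α' * starRingEnd ℂ (f y) + ρ' y) :
    ∑ y, b y * starRingEnd ℂ (b' y) =
      t * (α * starRingEnd ℂ α') + ∑ y, ρ y * starRingEnd ℂ (ρ' y) := by
  have h1 : ∀ y, b y * starRingEnd ℂ (b' y) = (starRingEnd ℂ (f y) * f y) * (α * starRingEnd ℂ α') +
      α * starRingEnd ℂ (ρ' y * f y) + starRingEnd ℂ α' * (ρ y * f y) +
      ρ y * starRingEnd ℂ (ρ' y) := by
    intro y
    rw [hb, hb']
    simp only [map_add, map_mul, Complex.conj_conj]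
    ring
  simp_rw [h1, Finset.sum_add_distrib, ← Finset.sum_mul, ← Finset.mul_sum, ← map_sum, ht, hρ, hρ']
  simp

/-- The part of the Kraus operators of `K` that is proportional to a top eigenvector of the Choi
state is orthogonal to the rest. -/
theorem exists_kraus_decomposition [Nonempty l] {K : Matrix ((l × κ) × β) l ℂ}
    (hK : Kᴴ * K = 1) {a : l × l → ℂ} {t : ℝ} (ha : ∑ x, ‖a x‖ ^ 2 = 1)
    (hat : choi K *ᵥ a = (t : ℂ) • a) :
    ∃ (f : κ × β → ℂ) (A : Matrix l l ℂ) (R : κ × β → Matrix l l ℂ),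
      ∑ y, starRingEnd ℂ (f y) * f y = t ∧ (∀ i k, ∑ y, R y i k * f y = 0) ∧
      (∀ y i k, kraus K y.1 y.2 i k = A i k * starRingEnd ℂ (f y) + R y i k) ∧
      ∑ y, ∑ i, ∑ k, ‖R y i k‖ ^ 2 = Fintype.card l * (1 - t) := by
  have hd : (0 : ℝ) < Fintype.card l := by exact_mod_cast Fintype.card_pos
  set sd : ℝ := Real.sqrt (Fintype.card l) with hsd
  have hsd0 : sd ≠ 0 := (Real.sqrt_pos.mpr hd).ne'
  have hsdc : (sd : ℂ) ≠ 0 := by exact_mod_cast hsd0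
  have hsd2 : sd ^ 2 = Fintype.card l := Real.sq_sqrt hd.le
  set T := choiVec K with hT
  -- Since TT† is the Choi state, Tf = ta and ‖f‖² = t. Hence T - af† annihilates f, and its squared
  -- norm is 1 - t.
  set f : κ × β → ℂ := Tᴴ *ᵥ a with hf
  have hTf : T *ᵥ f = (t : ℂ) • a := by
    rw [hf, Matrix.mulVec_mulVec, ← choi_eq, hat]
  have haa : star a ⬝ᵥ a = 1 := by
    rw [dotProduct, ← Complex.ofReal_one, ← ha]
    push_cast
    exact Finset.sum_congr rfl fun x _ => Complex.conj_mul' (a x)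
  have hff : star f ⬝ᵥ f = t := by
    have : star f = star a ᵥ* T := by
      rw [hf, Matrix.star_mulVec, Matrix.conjTranspose_conjTranspose]
    rw [this, ← Matrix.dotProduct_mulVec, hTf, dotProduct_smul, haa, smul_eq_mul, mul_one]
  set r : Matrix (l × l) (κ × β) ℂ := T - Matrix.vecMulVec a (star f) with hr
  have hrf : r *ᵥ f = 0 := by
    rw [hr, Matrix.sub_mulVec, hTf, Matrix.vecMulVec_mulVec, hff]
    ext x
    simp [mul_comm]
  have hrn : ∑ x, ∑ y, ‖r x y‖ ^ 2 = 1 - t := by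
    have h1 := sum_choiVec_norm_sq hK
    have h2 : ∀ x, ((∑ y, ‖T x y‖ ^ 2 : ℝ) : ℂ) = ((t * ‖a x‖ ^ 2 + ∑ y, ‖r x y‖ ^ 2 : ℝ) : ℂ) := by
      intro x
      have h3 := sum_mul_conj_orthogonal (f := f) (ρ := r x) (ρ' := r x) (b := T x) (b' := T x)
        (t := t) (α := a x) (α' := a x) hff (congrFun hrf x) (congrFun hrf x)
        (fun y => by simp [hr, Matrix.vecMulVec_apply]) (fun y => by simp [hr, Matrix.vecMulVec_apply])
      simp only [Complex.mul_conj'] at h3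
      push_cast
      exact h3
    have h4 : ∑ x, ∑ y, ‖T x y‖ ^ 2 = ∑ x, (t * ‖a x‖ ^ 2 + ∑ y, ‖r x y‖ ^ 2) :=
      Finset.sum_congr rfl fun x _ => Complex.ofReal_injective (h2 x)
    rw [hT, h1, Finset.sum_add_distrib, ← Finset.mul_sum, ha] at h4
    linarith
  refine ⟨f, fun i k => sd * a (i, k), fun y i k => sd * r (i, k) y, hff, ?_, ?_, ?_⟩
  · intro i k
    have := congrFun hrf (i, k)
    simp only [Matrix.mulVec, dotProduct, Pi.zero_apply] at this
    simp only [mul_assoc, ← Finset.mul_sum, this, mul_zero]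
  · intro y i k
    simp only [hr, Matrix.sub_apply, Matrix.vecMulVec_apply, Pi.star_apply, hT, choiVec]
    rw [← hsd]
    push_cast
    field_simp
    simp
  · simp only [norm_mul, mul_pow, Complex.norm_real, Real.norm_eq_abs, sq_abs, hsd2,
      ← Finset.mul_sum]
    rw [← hrn, Finset.sum_comm (f := fun x y => ‖r x y‖ ^ 2)]
    simp only [Fintype.sum_prod_type (f := fun x : l × l => _)]

end Correction

/-! ### Correcting a recovery by a unitary of A₁ -/

section LocalCorrection

open scoped ComplexOrder

variable {l κ β : Type*} [Fintype l] [DecidableEq l] [Fintype κ] [DecidableEq κ]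
  [Fintype β] [DecidableEq β]

/-- `K` followed by a unitary of `A₁`. -/
def correct (u : Matrix.unitaryGroup l ℂ) (K : Matrix ((l × κ) × β) l ℂ) :
    Matrix ((l × κ) × β) l ℂ :=
  (((u : Matrix l l ℂ) ⊗ₖ (1 : Matrix κ κ ℂ)) ⊗ₖ (1 : Matrix β β ℂ)) * K

theorem kraus_correct (u : Matrix.unitaryGroup l ℂ) (K : Matrix ((l × κ) × β) l ℂ) (c : κ) (b : β) :
    kraus (correct u K) c b = (u : Matrix l l ℂ) * kraus K c b := by
  ext i j
  simp only [correct, kraus, Matrix.mul_apply, Fintype.sum_prod_type, Matrix.kroneckerMap_apply,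
    Matrix.one_apply]
  refine Finset.sum_congr rfl fun k _ => ?_
  rw [Finset.sum_eq_single c, Finset.sum_eq_single b]
  · simp
  · intro b' _ hb; simp [hb.symm]
  · simp
  · intro c' _ hc; simp [hc.symm]
  · simp

theorem correct_isometry (u : Matrix.unitaryGroup l ℂ) {K : Matrix ((l × κ) × β) l ℂ}
    (hK : Kᴴ * K = 1) : (correct u K)ᴴ * correct u K = 1 := by
  have h := Matrix.mem_unitaryGroup_iff'.mp (kronecker_unitary ⟨_, kronecker_unitary u
    (1 : Matrix.unitaryGroup κ ℂ)⟩ (1 : Matrix.unitaryGroup β ℂ))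
  rw [correct, Matrix.conjTranspose_mul, Matrix.mul_assoc,
    ← Matrix.mul_assoc (((u : Matrix l l ℂ) ⊗ₖ (1 : Matrix κ κ ℂ)) ⊗ₖ (1 : Matrix β β ℂ))ᴴ]
  rw [show ((((u : Matrix l l ℂ) ⊗ₖ (1 : Matrix κ κ ℂ)) ⊗ₖ (1 : Matrix β β ℂ))ᴴ *
    (((u : Matrix l l ℂ) ⊗ₖ (1 : Matrix κ κ ℂ)) ⊗ₖ (1 : Matrix β β ℂ))) = 1 from h,
    Matrix.one_mul, hK]

theorem norm_sum_mul_mul_le {R σ : Matrix l l ℂ} (hσ : ∀ i j, ‖σ i j‖ ≤ 1) (i j : l) :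
    ‖(R * σ * Rᴴ) i j‖ ≤ Fintype.card l ^ 2 * ∑ i, ∑ k, ‖R i k‖ ^ 2 := by
  set S := ∑ i, ∑ k, ‖R i k‖ ^ 2 with hS
  have hle : ∀ i k, ‖R i k‖ ^ 2 ≤ S := fun i k =>
    (Finset.single_le_sum (f := fun k => ‖R i k‖ ^ 2) (fun j _ => by positivity)
      (Finset.mem_univ k)).trans
      (Finset.single_le_sum (f := fun i => ∑ k, ‖R i k‖ ^ 2) (fun x _ => by positivity)
        (Finset.mem_univ i))
  rw [Matrix.mul_apply]
  simp_rw [Matrix.mul_apply (M := R), Finset.sum_mul]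
  calc _ ≤ ∑ _m : l, ∑ _k : l, S := by
        refine (norm_sum_le _ _).trans (Finset.sum_le_sum fun m _ =>
          (norm_sum_le _ _).trans (Finset.sum_le_sum fun k _ => ?_))
        rw [norm_mul, norm_mul, Matrix.conjTranspose_apply, norm_star]
        have h1 := hle i k
        have h2 := hle j m
        calc ‖R i k‖ * ‖σ k m‖ * ‖R j m‖ ≤ ‖R i k‖ * 1 * ‖R j m‖ := by
              gcongr; exact hσ k m
          _ ≤ S := by nlinarith [sq_nonneg (‖R i k‖ - ‖R j m‖)]
    _ = _ := by simp; ring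

theorem norm_perturb_conj_le {P σ : Matrix l l ℂ} {τ : ℝ} (hτ0 : 0 ≤ τ) (hτ : τ ≤ 1)
    (hP : ∀ i j, ‖(P - 1) i j‖ ≤ τ) (hσ : ∀ i j, ‖σ i j‖ ≤ 1) (i j : l) :
    ‖(P * σ * Pᴴ - σ) i j‖ ≤ (2 * Fintype.card l + Fintype.card l ^ 2) * τ := by
  set E := P - 1 with hE
  have hPE : P = 1 + E := by rw [hE]; abel
  have h1 : P * σ * Pᴴ - σ = E * σ + σ * Eᴴ + E * σ * Eᴴ := by
    rw [hPE, Matrix.conjTranspose_add, Matrix.conjTranspose_one]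
    simp only [Matrix.add_mul, Matrix.mul_add, Matrix.one_mul, Matrix.mul_one]
    abel
  have hEσ : ∀ i j, ‖(E * σ) i j‖ ≤ Fintype.card l * τ := by
    intro i j
    rw [Matrix.mul_apply]
    refine (norm_sum_le _ _).trans ((Finset.sum_le_sum (g := fun _ => τ) fun k _ => ?_).trans
      (le_of_eq (by simp)))
    rw [norm_mul]
    calc _ ≤ τ * 1 := mul_le_mul (hP i k) (hσ k j) (norm_nonneg _) hτ0
      _ = τ := mul_one τ
  have hσE : ‖(σ * Eᴴ) i j‖ ≤ Fintype.card l * τ := by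
    rw [Matrix.mul_apply]
    refine (norm_sum_le _ _).trans ((Finset.sum_le_sum (g := fun _ => τ) fun k _ => ?_).trans
      (le_of_eq (by simp)))
    rw [norm_mul, Matrix.conjTranspose_apply, norm_star]
    calc _ ≤ 1 * τ := mul_le_mul (hσ i k) (hP j k) (norm_nonneg _) zero_le_one
      _ = τ := one_mul τ
  have hEσE : ‖(E * σ * Eᴴ) i j‖ ≤ Fintype.card l ^ 2 * τ := by
    rw [Matrix.mul_apply]
    refine (norm_sum_le _ _).trans ((Finset.sum_le_sum (g := fun _ => Fintype.card l * τ)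
      fun k _ => ?_).trans (le_of_eq (by simp; ring)))
    rw [norm_mul, Matrix.conjTranspose_apply, norm_star]
    calc _ ≤ Fintype.card l * τ * 1 :=
          mul_le_mul (hEσ i k) ((hP j k).trans hτ) (norm_nonneg _) (by positivity)
      _ = _ := mul_one _
  rw [h1, Matrix.add_apply, Matrix.add_apply]
  refine (norm_add₃_le).trans ?_
  linarith [hEσ i j]

set_option maxHeartbeats 1000000 in
-- Isometry gives M†M + Q = 1, where M = √t A is the dominant Kraus operator and Q, of trace d(1 -
-- t), comes from the rest. Undoing the polar part of M leaves a map close to the identity. The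
-- coefficient one of 1 - t in the infidelity bound is essential, while the channel bound only needs
-- the right order.
theorem exists_correction [Nonempty l] {K : Matrix ((l × κ) × β) l ℂ}
    (hK : Kᴴ * K = 1) {a : l × l → ℂ} {t : ℝ} (ha : ∑ x, ‖a x‖ ^ 2 = 1)
    (hat : choi K *ᵥ a = (t : ℂ) • a) (ht0 : 0 < t) (ht1 : t ≤ 1)
    (hsmall : Fintype.card l * (1 - t) < 1) :
    ∃ u : Matrix.unitaryGroup l ℂ,
      1 - fid (correct u K) ≤ (1 - t) + Fintype.card l * (1 - t) ^ 2 ∧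
      ∀ σ : Matrix l l ℂ, (∀ i j, ‖σ i j‖ ≤ 1) → ∀ i j, ‖(chan (correct u K) σ - σ) i j‖ ≤
        (2 * Fintype.card l + 2 * Fintype.card l ^ 2) * (Fintype.card l * (1 - t)) := by
  have hd : (0 : ℝ) < Fintype.card l := by exact_mod_cast Fintype.card_pos
  obtain ⟨f, A, R, hf, hR, hKR, hRn⟩ := exists_kraus_decomposition hK ha hat
  set τ : ℝ := Fintype.card l * (1 - t) with hτ
  have hτ0 : 0 ≤ τ := mul_nonneg hd.le (by linarith)
  set st : ℝ := Real.sqrt t with hst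
  have hst2 : (st : ℂ) * st = t := by
    rw [← Complex.ofReal_mul, hst, Real.mul_self_sqrt ht0.le]
  set M : Matrix l l ℂ := (st : ℂ) • A with hM
  set Q : Matrix l l ℂ := ∑ y, (R y)ᴴ * R y with hQ
  have hQp : Q.PosSemidef := Matrix.posSemidef_sum _ fun y _ =>
    Matrix.posSemidef_conjTranspose_mul_self _
  have hQt : Q.trace = τ := by
    rw [hQ, Matrix.trace_sum, ← hRn]
    push_cast
    refine Finset.sum_congr rfl fun y _ => ?_
    rw [← sum_norm_sq_eq_trace]
    push_cast
    rfl
  -- The Kraus form of K†K = 1; the mixed terms vanish because the remainders are orthogonal to f.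
  have hMQ : Mᴴ * M + Q = 1 := by
    ext i j
    have h1 := congrFun (congrFun hK i) j
    rw [← h1, Matrix.mul_apply, Matrix.add_apply, Matrix.mul_apply, hQ, Matrix.sum_apply]
    have h2 : ∑ x, Kᴴ i x * K x j =
        ∑ k, ∑ y : κ × β, kraus K y.1 y.2 k j * starRingEnd ℂ (kraus K y.1 y.2 k i) := by
      simp only [Fintype.sum_prod_type]
      refine Finset.sum_congr rfl fun k _ => Finset.sum_congr rfl fun c _ =>
        Finset.sum_congr rfl fun b _ => ?_
      rw [mul_comm]
      rfl
    have h3 : ∀ k, ∑ y : κ × β, kraus K y.1 y.2 k j * starRingEnd ℂ (kraus K y.1 y.2 k i) =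
        t * (A k j * starRingEnd ℂ (A k i)) + ∑ y, R y k j * starRingEnd ℂ (R y k i) :=
      fun k => sum_mul_conj_orthogonal hf (hR k j) (hR k i) (fun y => hKR y k j)
        fun y => hKR y k i
    simp_rw [h2, h3, Finset.sum_add_distrib, Matrix.mul_apply]
    congr 1
    · refine Finset.sum_congr rfl fun k _ => ?_
      rw [Matrix.conjTranspose_apply, hM, Matrix.smul_apply, Matrix.smul_apply, smul_eq_mul,
        smul_eq_mul, ← hst2, star_mul', Complex.star_def, Complex.conj_ofReal]
      ring
    · rw [Finset.sum_comm]
      refine Finset.sum_congr rfl fun k _ => Finset.sum_congr rfl fun y _ => ?_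
      rw [Matrix.conjTranspose_apply, mul_comm]
      rfl
  obtain ⟨u, hu1, hu2⟩ := exists_polar hQp hQt hsmall hMQ
  have hkr : ∀ y : κ × β, ∀ i k, kraus (correct (star u) K) y.1 y.2 i k =
      ((u : Matrix l l ℂ)ᴴ * A) i k * starRingEnd ℂ (f y) +
        ((u : Matrix l l ℂ)ᴴ * R y) i k := by
    intro y i k
    rw [kraus_correct]
    change ((u : Matrix l l ℂ)ᴴ * kraus K y.1 y.2) i k = _
    simp only [Matrix.mul_apply, hKR, Finset.sum_mul, mul_add, Finset.sum_add_distrib, mul_assoc]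
  have hR' : ∀ i k, ∑ y, ((u : Matrix l l ℂ)ᴴ * R y) i k * f y = 0 := by
    intro i k
    simp only [Matrix.mul_apply, Finset.sum_mul]
    rw [Finset.sum_comm]
    simp only [mul_assoc, ← Finset.mul_sum, hR, mul_zero, Finset.sum_const_zero]
  have huM : (u : Matrix l l ℂ)ᴴ * M = (st : ℂ) • ((u : Matrix l l ℂ)ᴴ * A) := by
    rw [hM, Matrix.mul_smul]
  refine ⟨star u, ?_, ?_⟩
  · have htr : ∀ y : κ × β, (kraus (correct (star u) K) y.1 y.2).trace =
        ((u : Matrix l l ℂ)ᴴ * A).trace * starRingEnd ℂ (f y) +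
          ((u : Matrix l l ℂ)ᴴ * R y).trace := by
      intro y
      simp only [Matrix.trace, Matrix.diag_apply, hkr, Finset.sum_mul, Finset.sum_add_distrib]
    have hRtr : ∑ y, ((u : Matrix l l ℂ)ᴴ * R y).trace * f y = 0 := by
      simp only [Matrix.trace, Matrix.diag_apply, Finset.sum_mul]
      rw [Finset.sum_comm]
      simp only [hR', Finset.sum_const_zero]
    have h1 := sum_mul_conj_orthogonal hf hRtr hRtr htr htr
    simp only [Complex.mul_conj'] at h1
    have h2 : ∑ y : κ × β, ‖(kraus (correct (star u) K) y.1 y.2).trace‖ ^ 2 =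
        t * ‖((u : Matrix l l ℂ)ᴴ * A).trace‖ ^ 2 +
          ∑ y, ‖((u : Matrix l l ℂ)ᴴ * R y).trace‖ ^ 2 := by
      exact_mod_cast h1
    have h3 : t * ‖((u : Matrix l l ℂ)ᴴ * A).trace‖ ^ 2 =
        ‖((u : Matrix l l ℂ)ᴴ * M).trace‖ ^ 2 := by
      rw [huM, Matrix.trace_smul, norm_smul, mul_pow, Complex.norm_real, Real.norm_eq_abs, sq_abs,
        hst, Real.sq_sqrt ht0.le]
    have h4 : ((u : Matrix l l ℂ)ᴴ * M).trace.re ^ 2 ≤ ‖((u : Matrix l l ℂ)ᴴ * M).trace‖ ^ 2 := by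
      rw [← sq_abs]
      exact pow_le_pow_left₀ (abs_nonneg _) (Complex.abs_re_le_norm _) 2
    have h5 : (((u : Matrix l l ℂ)ᴴ * M).trace.re / Fintype.card l) ^ 2 ≤
        fid (correct (star u) K) := by
      rw [fid, div_pow, ← Fintype.sum_prod_type' (f := fun c b =>
        ‖(kraus (correct (star u) K) c b).trace‖ ^ 2), h2, h3]
      exact div_le_div_of_nonneg_right (h4.trans (le_add_of_nonneg_right
        (Finset.sum_nonneg fun y _ => sq_nonneg _))) (sq_nonneg _)
    have h6 : 1 - (1 - t) / 2 - Fintype.card l * (1 - t) ^ 2 / 2 ≤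
        ((u : Matrix l l ℂ)ᴴ * M).trace.re / Fintype.card l := by
      rw [le_div_iff₀ hd]
      refine le_trans (le_of_eq ?_) hu2
      rw [hτ]
      ring
    generalize ((u : Matrix l l ℂ)ᴴ * M).trace.re / Fintype.card l = z at h5 h6
    -- From z² ≥ 2z - 1 and the lower bound on z.
    nlinarith [sq_nonneg (z - 1)]
  · intro σ hσ i j
    have h1 : chan (correct (star u) K) σ = ((u : Matrix l l ℂ)ᴴ * M) * σ *
        ((u : Matrix l l ℂ)ᴴ * M)ᴴ +
        ∑ y, ((u : Matrix l l ℂ)ᴴ * R y) * σ * ((u : Matrix l l ℂ)ᴴ * R y)ᴴ := by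
      ext i j
      rw [chan_apply, Matrix.sum_apply, Matrix.add_apply, Matrix.sum_apply]
      have h2 : ∀ B : Matrix l l ℂ, (B * σ * Bᴴ) i j =
          ∑ m, ∑ k, σ k m * (B i k * starRingEnd ℂ (B j m)) := by
        intro B
        rw [Matrix.mul_apply]
        refine Finset.sum_congr rfl fun m _ => ?_
        rw [Matrix.mul_apply, Finset.sum_mul]
        refine Finset.sum_congr rfl fun k _ => ?_
        rw [Matrix.conjTranspose_apply, Complex.star_def]
        ring
      simp_rw [h2]
      rw [Finset.sum_comm, Finset.sum_comm (s := (Finset.univ : Finset (κ × β))),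
        ← Finset.sum_add_distrib]
      refine Finset.sum_congr rfl fun m _ => ?_
      rw [Finset.sum_comm, Finset.sum_comm (s := (Finset.univ : Finset (κ × β))),
        ← Finset.sum_add_distrib]
      refine Finset.sum_congr rfl fun k _ => ?_
      rw [← Finset.mul_sum, ← Finset.mul_sum,
        sum_mul_conj_orthogonal hf (hR' i k) (hR' j m) (fun y => hkr y i k) (fun y => hkr y j m),
        huM, ← hst2]
      simp only [Matrix.smul_apply, smul_eq_mul, map_mul, Complex.conj_ofReal]
      ring
    have hRn' : ∀ y, ∑ i, ∑ k, ‖((u : Matrix l l ℂ)ᴴ * R y) i k‖ ^ 2 =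
        ∑ i, ∑ k, ‖R y i k‖ ^ 2 := by
      intro y
      apply Complex.ofReal_injective
      rw [sum_norm_sq_eq_trace, sum_norm_sq_eq_trace, Matrix.conjTranspose_mul,
        Matrix.conjTranspose_conjTranspose, Matrix.mul_assoc,
        ← Matrix.mul_assoc (u : Matrix l l ℂ), unitary_mul_conjTranspose, Matrix.one_mul]
    have h3 : ‖(∑ y, ((u : Matrix l l ℂ)ᴴ * R y) * σ * ((u : Matrix l l ℂ)ᴴ * R y)ᴴ) i j‖ ≤
        Fintype.card l ^ 2 * τ := by
      rw [Matrix.sum_apply, ← hRn, Finset.mul_sum]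
      refine (norm_sum_le _ _).trans (Finset.sum_le_sum fun y _ => ?_)
      rw [← hRn' y]
      exact norm_sum_mul_mul_le hσ i j
    have h4 := norm_perturb_conj_le hτ0 hsmall.le hu1 hσ i j
    rw [h1, add_sub_right_comm, Matrix.add_apply]
    refine (norm_add_le _ _).trans ?_
    linarith

end LocalCorrection

/-! ### Optimal recoveries -/

section Optimal

open scoped ComplexOrder

variable {l κ β : Type*} [Fintype l] [DecidableEq l] [Fintype κ] [DecidableEq κ]
  [Fintype β] [DecidableEq β]

theorem rot_one (K : Matrix ((l × κ) × β) l ℂ) : rot 1 K = K := by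
  ext x j
  simp [rot, conjU, kraus]

theorem isBigO_chan_sub [Nonempty κ] {χ : κ × β → ℂ} (hχ : IsFlat χ)
    {K : ℝ → Matrix ((l × κ) × β) l ℂ} {J : Matrix ((l × κ) × β) l ℂ}
    (hKJ : ∀ x j, (fun ε => K ε x j - attachResource χ x j - ε * J x j) =o[𝓝 0] fun ε : ℝ => ε)
    (hJ : (contract χ J).IsHermitian) (p : l → ℝ) (i j : l) :
    (fun ε => (chan (K ε) (Matrix.diagonal fun i => (p i : ℂ)) -
      Matrix.diagonal fun i => (p i : ℂ)) i j) =O[𝓝 0] fun ε : ℝ => ε := by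
  have hκ : (Fintype.card κ : ℂ) ≠ 0 := by exact_mod_cast Fintype.card_ne_zero
  have h : ∀ x y, (fun ε => (outA (K ε) (Matrix.diagonal fun i => (p i : ℂ)) -
      Matrix.diagonal fun z : l × κ => ((p z.1 / Fintype.card κ : ℝ) : ℂ)) x y) =O[𝓝 0]
      fun ε : ℝ => ε := by
    intro x y
    have h1 := (outA_rot_expansion hχ hKJ hJ p (fun _ => 1) x y).isBigO
    simp only [rot_one] at h1
    set w := ((p x.1 + p y.1 : ℝ) : ℂ) * conjU 1 (block (contract χ J) x.2 y.2) x.1 y.1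
    have h2 : (fun ε : ℝ => (ε : ℂ) * w) =O[𝓝 0] fun ε : ℝ => ε :=
      IsBigO.of_bound ‖w‖ (Eventually.of_forall fun ε => by
        rw [norm_mul, Complex.norm_real, mul_comm])
    exact (h1.add h2).congr_left fun ε => by ring
  refine (IsBigO.fun_sum (s := (Finset.univ : Finset κ)) fun c _ => h (i, c) (j, c)).congr_left
    fun ε => ?_
  simp only [Matrix.sub_apply, Finset.sum_sub_distrib]
  congr 1
  by_cases hij : i = j
  · subst hij
    simp [mul_div_cancel₀ _ hκ]
  · simp [hij]

/-- At the maximally mixed state the linear term is a multiple of the change of trace, which is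
zero. A state displaced by O(ε) therefore loses only O(ε²) of entropy. -/
theorem isBigO_log_card_sub_vnEntropy [Nonempty l] [Nonempty κ] {χ : κ × β → ℂ} (hχ : IsFlat χ)
    {K : ℝ → Matrix ((l × κ) × β) l ℂ} (hK : ∀ ε, (K ε)ᴴ * K ε = 1)
    {J : Matrix ((l × κ) × β) l ℂ}
    (hKJ : ∀ x j, (fun ε => K ε x j - attachResource χ x j - ε * J x j) =o[𝓝 0] fun ε : ℝ => ε)
    (hJ : (contract χ J).IsHermitian) :
    (fun ε => Real.log (Fintype.card l) - vnEntropy (ptraceSnd (choi (K ε)))) =O[𝓝 0]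
      fun ε : ℝ => ε ^ 2 := by
  have hd : (0 : ℝ) < Fintype.card l := by exact_mod_cast Fintype.card_pos
  set p : l → ℝ := fun _ => (Fintype.card l : ℝ)⁻¹ with hp
  have hΔ := isBigO_chan_sub hχ hKJ hJ p
  have hDH : (Matrix.diagonal fun i => (p i : ℂ)).IsHermitian := diagonal_ofReal_isHermitian p
  have h1 := vnEntropy_expansion (fun ε => chan_isHermitian (K ε) hDH)
    (fun i => inv_pos.mpr hd) hΔ
  have hquad : (fun ε => ∑ i, ∑ j, ‖(chan (K ε) (Matrix.diagonal fun i => (p i : ℂ)) -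
      Matrix.diagonal fun i => (p i : ℂ)) i j‖ ^ 2 * negMulLogDD (p i) (p j)) =O[𝓝 0]
      fun ε : ℝ => ε ^ 2 := by
    refine IsBigO.fun_sum fun i _ => IsBigO.fun_sum fun j _ => ?_
    have h2 := ((hΔ i j).norm_left.pow 2).mul
      (isBigO_const_const (negMulLogDD (p i) (p j)) (one_ne_zero' ℝ) (𝓝 0))
    exact h2.congr_right fun ε => mul_one _
  have hS : vnEntropy (Matrix.diagonal fun i => (p i : ℂ)) = Real.log (Fintype.card l) := by
    rw [vnEntropy_diagonal]
    simp only [hp, Finset.sum_const, Finset.card_univ, nsmul_eq_mul, Real.negMulLog, Real.log_inv]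
    field_simp
  refine (h1.isBigO.add hquad).neg_left.congr_left fun ε => ?_
  have hlin : ∑ i, (Real.log (p i) + 1) *
      ((chan (K ε) (Matrix.diagonal fun i => (p i : ℂ)) i i).re - p i) = 0 := by
    have htr := congrArg Complex.re (trace_chan (hK ε) (Matrix.diagonal fun i => (p i : ℂ)))
    rw [Matrix.trace_diagonal, ← Complex.ofReal_sum, Complex.ofReal_re, Matrix.trace,
      Complex.re_sum] at htr
    simp only [hp] at htr ⊢
    rw [← Finset.mul_sum, Finset.sum_sub_distrib, ← htr]
    simp
  rw [hS, hlin, ptraceSnd_choi]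
  simp only [hp]
  ring

theorem vnEntropy_ptraceSnd_choi_le [Nonempty l] {K : Matrix ((l × κ) × β) l ℂ}
    (hK : Kᴴ * K = 1) : vnEntropy (ptraceSnd (choi K)) ≤ Real.log (Fintype.card l) := by
  refine vnEntropy_le_log_card ?_ ?_
  · rw [ptraceSnd_choi, chan_apply]
    refine Matrix.posSemidef_sum _ fun y _ => Matrix.PosSemidef.mul_mul_conjTranspose_same ?_ _
    rw [Matrix.posSemidef_diagonal_iff]
    intro i
    exact_mod_cast inv_nonneg.mpr (Nat.cast_nonneg' _)
  · rw [trace_ptraceSnd, choi_trace hK]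

/-- If the coherent information is at least that of a comparison path of recoveries, then the Choi
state is nearly as pure as on the comparison path. -/
theorem exists_topEigenvector_path [Nonempty l] [Nonempty κ] {χ : κ × β → ℂ} (hχ : IsFlat χ)
    {K₀ : ℝ → Matrix ((l × κ) × β) l ℂ} (hK₀ : ∀ ε, (K₀ ε)ᴴ * K₀ ε = 1)
    {J : Matrix ((l × κ) × β) l ℂ}
    (hKJ : ∀ x j, (fun ε => K₀ ε x j - attachResource χ x j - ε * J x j) =o[𝓝 0]
      fun ε : ℝ => ε)
    (hJ : (contract χ J).IsHermitian) {p : ℝ} (hp : 0 ≤ p)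
    (hfid : (fun ε => 1 - fid (K₀ ε) - ε ^ 2 * p) =o[𝓝 0] fun ε : ℝ => ε ^ 2)
    {K : ℝ → Matrix ((l × κ) × β) l ℂ} (hK : ∀ ε, (K ε)ᴴ * K ε = 1)
    (hopt : ∀ ε, coherentInfo (chan (K₀ ε)) ≤ coherentInfo (chan (K ε))) :
    ∃ (a : ℝ → l × l → ℂ) (t : ℝ → ℝ), (∀ ε, ∑ x, ‖a ε x‖ ^ 2 = 1) ∧
      (∀ ε, choi (K ε) *ᵥ a ε = (t ε : ℂ) • a ε) ∧ (∀ ε, 0 < t ε) ∧ (∀ ε, t ε ≤ 1) ∧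
      ∀ q, p < q → ∀ᶠ ε in 𝓝 (0 : ℝ), 1 - t ε ≤ q * ε ^ 2 := by
  choose a t h1 h2 h3 h4 h5 h6 _ _ using fun ε =>
    exists_topEigenvector (choi_posSemidef (K ε)) (choi_trace (hK ε))
  refine ⟨a, t, h1, h2, h3, h4, fun q hq => ?_⟩
  obtain ⟨B, hB⟩ := (isBigO_log_card_sub_vnEntropy hχ hK₀ hKJ hJ).bound
  refine eventually_le_of_entropy_le (s := fun ε => vnEntropy (choi (K ε)))
    (s₀ := fun ε => vnEntropy (choi (K₀ ε))) (x := fun ε => 1 - fid (K₀ ε)) (B := B)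
    (m := Fintype.card (l × l) + 1) hp (fun ε => ?_) h5 ?_ (fun ε y hy hy1 hxy => ?_) hfid hq
  · have := Real.log_le_sub_one_of_pos (h3 ε)
    linarith [h6 ε]
  -- The marginal entropy is at most log d in general and at least log d - Bε² on the comparison
  -- path. A comparison of coherent informations is thus one of Choi entropies up to Bε².
  · filter_upwards [hB] with ε hε
    have e1 : vnEntropy (ptraceSnd (choi (K₀ ε))) - vnEntropy (choi (K₀ ε)) ≤
      vnEntropy (ptraceSnd (choi (K ε))) - vnEntropy (choi (K ε)) := hopt ε
    have e2 := vnEntropy_ptraceSnd_choi_le (hK ε)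
    rw [Real.norm_eq_abs, Real.norm_eq_abs, abs_of_nonneg (sq_nonneg ε)] at hε
    linarith [(abs_le.mp hε).2]
  · obtain ⟨-, t₀, -, -, -, -, -, -, e1, e2⟩ :=
      exists_topEigenvector (choi_posSemidef (K₀ ε)) (choi_trace (hK₀ ε))
    refine e2 y hy hy1 ?_
    -- The fidelity is a Rayleigh quotient of the Choi state, so it is at most the top eigenvalue.
    have e3 := e1 (maxEntangled l)
    rw [fid_eq_choi, sum_maxEntangled_norm_sq] at e3
    linarith

theorem norm_conj_diagonal_le (U : Matrix.unitaryGroup l ℂ) {p : l → ℝ} (hp : ∀ i, 0 < p i)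
    (hp1 : ∑ i, p i = 1) (i j : l) :
    ‖((U : Matrix l l ℂ) * (Matrix.diagonal fun i => (p i : ℂ)) * (U : Matrix l l ℂ)ᴴ) i j‖ ≤ 1 := by
  rw [Matrix.mul_apply, ← hp1]
  refine (norm_sum_le _ _).trans (Finset.sum_le_sum fun k _ => ?_)
  rw [Matrix.mul_diagonal, norm_mul, norm_mul, Matrix.conjTranspose_apply, norm_star,
    Complex.norm_real, Real.norm_eq_abs, abs_of_pos (hp k)]
  have h3 := entry_norm_bound_of_unitary U.2 i k
  have h4 := entry_norm_bound_of_unitary U.2 j k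
  calc _ ≤ 1 * p k * 1 := by
        have := hp k
        gcongr
    _ = p k := by ring

theorem chan_rot (U : Matrix.unitaryGroup l ℂ) (K : Matrix ((l × κ) × β) l ℂ) (σ : Matrix l l ℂ) :
    chan (rot U K) σ = conjU U (chan K ((U : Matrix l l ℂ) * σ * (U : Matrix l l ℂ)ᴴ)) := by
  rw [rot_eq, chan, outA_mul]
  exact (chan_kronecker_mul _ K _).trans (by rw [conjU, Matrix.conjTranspose_conjTranspose])

/-- The correcting unitary depends on ε alone. The same one serves every distribution r and every
rotation U, as the Haar average requires. -/
theorem exists_correction_path [Nonempty l] [Nonempty κ] {χ : κ × β → ℂ} (hχ : IsFlat χ)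
    {K₀ : ℝ → Matrix ((l × κ) × β) l ℂ} (hK₀ : ∀ ε, (K₀ ε)ᴴ * K₀ ε = 1)
    {J : Matrix ((l × κ) × β) l ℂ}
    (hKJ : ∀ x j, (fun ε => K₀ ε x j - attachResource χ x j - ε * J x j) =o[𝓝 0]
      fun ε : ℝ => ε)
    (hJ : (contract χ J).IsHermitian) {p : ℝ} (hp : 0 ≤ p)
    (hfid : (fun ε => 1 - fid (K₀ ε) - ε ^ 2 * p) =o[𝓝 0] fun ε : ℝ => ε ^ 2)
    {K : ℝ → Matrix ((l × κ) × β) l ℂ} (hK : ∀ ε, (K ε)ᴴ * K ε = 1)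
    (hopt : ∀ ε, coherentInfo (chan (K₀ ε)) ≤ coherentInfo (chan (K ε))) :
    ∃ u : ℝ → Matrix.unitaryGroup l ℂ,
      (∀ q, p < q → ∀ᶠ ε in 𝓝 (0 : ℝ), 1 - fid (correct (u ε) (K ε)) ≤ q * ε ^ 2) ∧
      ∀ r : l → ℝ, (∀ i, 0 < r i) → ∑ i, r i = 1 →
        ∀ (U : ℝ → Matrix.unitaryGroup l ℂ) i j,
        (fun ε => (chan (rot (U ε) (correct (u ε) (K ε))) (Matrix.diagonal fun i => (r i : ℂ)) -
          Matrix.diagonal fun i => (r i : ℂ)) i j) =O[𝓝 0] fun ε : ℝ => ε ^ 2 := by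
  obtain ⟨a, t, h1, h2, h3, h4, h5⟩ :=
    exists_topEigenvector_path hχ hK₀ hKJ hJ hp hfid hK hopt
  set d : ℝ := (Fintype.card l : ℝ) with hd
  have hex : ∀ ε, ∃ u : Matrix.unitaryGroup l ℂ, d * (1 - t ε) < 1 →
      1 - fid (correct u (K ε)) ≤ (1 - t ε) + d * (1 - t ε) ^ 2 ∧
      ∀ σ : Matrix l l ℂ, (∀ i j, ‖σ i j‖ ≤ 1) → ∀ i j, ‖(chan (correct u (K ε)) σ - σ) i j‖ ≤
        (2 * d + 2 * d ^ 2) * (d * (1 - t ε)) := by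
    intro ε
    by_cases h : d * (1 - t ε) < 1
    · obtain ⟨u, hu⟩ := exists_correction (hK ε) (h1 ε) (h2 ε) (h3 ε) (h4 ε) h
      exact ⟨u, fun _ => hu⟩
    · exact ⟨1, fun h' => absurd h' h⟩
  choose u hu using hex
  have hlim : Tendsto (fun ε : ℝ => ε ^ 2) (𝓝 0) (𝓝 0) := by
    have : Continuous fun ε : ℝ => ε ^ 2 := by fun_prop
    simpa using this.tendsto 0
  have hd0 : 0 ≤ d := Nat.cast_nonneg' _
  have hev : ∀ᶠ ε in 𝓝 (0 : ℝ), d * (1 - t ε) < 1 := by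
    have h6 := (hlim.const_mul (d * (p + 1)))
    rw [mul_zero] at h6
    filter_upwards [h5 (p + 1) (by linarith), h6.eventually (gt_mem_nhds one_pos)] with ε e1 e2
    nlinarith [mul_le_mul_of_nonneg_left e1 hd0]
  refine ⟨u, fun q hq => ?_, fun r hr hr1 U i j => ?_⟩
  -- The term d(1 - t)² is O(ε⁴) and fits into the gap between q' and q.
  · set q' := (p + q) / 2 with hq'
    have h6 := (hlim.const_mul (d * q' ^ 2))
    rw [mul_zero] at h6
    have hgap : 0 < (q - p) / 2 := by linarith
    filter_upwards [hev, h5 q' (by rw [hq']; linarith), h6.eventually (gt_mem_nhds hgap)]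
      with ε e1 e2 e3
    refine ((hu ε e1).1).trans ?_
    have e4 : 0 ≤ 1 - t ε := by linarith [h4 ε]
    have e5 : (1 - t ε) ^ 2 ≤ (q' * ε ^ 2) ^ 2 := pow_le_pow_left₀ e4 e2 2
    have e6 : d * (1 - t ε) ^ 2 ≤ d * (q' * ε ^ 2) ^ 2 := mul_le_mul_of_nonneg_left e5 hd0
    have e7 : d * (q' * ε ^ 2) ^ 2 = d * q' ^ 2 * ε ^ 2 * ε ^ 2 := by ring
    have e8 : d * q' ^ 2 * ε ^ 2 * ε ^ 2 ≤ (q - p) / 2 * ε ^ 2 :=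
      mul_le_mul_of_nonneg_right e3.le (sq_nonneg ε)
    have e9 : q' * ε ^ 2 + (q - p) / 2 * ε ^ 2 = q * ε ^ 2 := by rw [hq']; ring
    linarith
  · set D : Matrix l l ℂ := Matrix.diagonal fun i => (r i : ℂ) with hD
    set σ : ℝ → Matrix l l ℂ :=
      fun ε => (U ε : Matrix l l ℂ) * D * (U ε : Matrix l l ℂ)ᴴ with hσ
    have h6 : ∀ i j, (fun ε => (chan (correct (u ε) (K ε)) (σ ε) - σ ε) i j) =O[𝓝 0]
        fun ε : ℝ => ε ^ 2 := by
      intro i j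
      refine IsBigO.of_bound ((2 * d + 2 * d ^ 2) * (d * (p + 1))) ?_
      filter_upwards [hev, h5 (p + 1) (by linarith)] with ε e1 e2
      refine ((hu ε e1).2 (σ ε) (norm_conj_diagonal_le (U ε) hr hr1) i j).trans ?_
      rw [Real.norm_eq_abs, abs_of_nonneg (sq_nonneg ε), mul_assoc, mul_assoc d]
      gcongr
    refine (isBigO_conjU h6 U i j).congr_left fun ε => ?_
    have h7 : conjU (U ε) (chan (correct (u ε) (K ε)) (σ ε) - σ ε) =
        chan (rot (U ε) (correct (u ε) (K ε))) D - D := by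
      rw [chan_rot, conjU, conjU, Matrix.mul_sub, Matrix.sub_mul]
      congr 1
      rw [hσ]
      simp only [Matrix.mul_assoc, unitary_conjTranspose_mul, Matrix.mul_one]
      rw [← Matrix.mul_assoc, unitary_conjTranspose_mul, Matrix.one_mul]
    rw [h7]

end Optimal

/-! ### The average proto-area entropy to second order -/

section ProtoArea

variable {l κ β : Type*} [Fintype l] [DecidableEq l] [Fintype κ] [DecidableEq κ]
  [Fintype β] [DecidableEq β]

theorem attachResource_isometry [Nonempty κ] {χ : κ × β → ℂ} (hχ : IsFlat χ) :
    (attachResource (l := l) χ)ᴴ * attachResource (l := l) χ = 1 := by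
  have hκ : (Fintype.card κ : ℂ) ≠ 0 := by exact_mod_cast Fintype.card_ne_zero
  ext i j
  rw [Matrix.mul_apply, Fintype.sum_prod_type, Fintype.sum_prod_type]
  have h1 : ∀ k c, ∑ b, (attachResource (l := l) χ)ᴴ i ((k, c), b) *
      attachResource (l := l) χ ((k, c), b) j =
      if k = i ∧ k = j then (Fintype.card κ : ℂ)⁻¹ else 0 := by
    intro k c
    have h := flat_sum hχ c c
    rw [if_pos rfl] at h
    by_cases hk : k = i ∧ k = j
    · obtain ⟨rfl, rfl⟩ := hk
      rw [if_pos ⟨rfl, rfl⟩, ← h]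
      exact Finset.sum_congr rfl fun b _ => by
        simp [attachResource, Matrix.conjTranspose_apply, mul_comm]
    · rw [if_neg hk]
      refine Finset.sum_eq_zero fun b _ => ?_
      rcases not_and_or.mp hk with hk | hk <;>
        simp [attachResource, Matrix.conjTranspose_apply, hk]
  simp_rw [h1]
  rw [Matrix.one_apply]
  by_cases hij : i = j
  · subst hij
    simp [hκ]
  · rw [if_neg hij]
    refine Finset.sum_eq_zero fun k _ => Finset.sum_eq_zero fun c _ => if_neg ?_
    rintro ⟨rfl, h⟩
    exact hij h

theorem skewed_isometry {W : Matrix ((l × κ) × β) ((l × κ) × β) ℂ} (hW : W.IsHermitian)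
    {V : Matrix ((l × κ) × β) l ℂ} (hV : Vᴴ * V = 1) (ε : ℝ) :
    (skewed W V ε)ᴴ * skewed W V ε = 1 := by
  have h := Matrix.mem_unitaryGroup_iff'.mp (exp_mem_unitaryGroup hW ε)
  rw [Matrix.star_eq_conjTranspose] at h
  rw [skewed, Matrix.conjTranspose_mul, Matrix.mul_assoc, ← Matrix.mul_assoc (NormedSpace.exp _)ᴴ,
    h, Matrix.one_mul, hV]

theorem hasDerivAt_skewed (W : Matrix ((l × κ) × β) ((l × κ) × β) ℂ)
    (V : Matrix ((l × κ) × β) l ℂ) (x : (l × κ) × β) (j : l) :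
    HasDerivAt (fun ε => skewed W V ε x j) ((Complex.I • (W * V)) x j) 0 := by
  have h := hasDerivAt_matrix_mul (A' := Complex.I • W) (B := fun _ => V) (B' := 0)
    (hasDerivAt_exp_apply W) (fun i j => hasDerivAt_const (0 : ℝ) (V i j)) x j
  simpa [Matrix.smul_mul, skewed] using h

theorem skewed_zero (W : Matrix ((l × κ) × β) ((l × κ) × β) ℂ) (V : Matrix ((l × κ) × β) l ℂ) :
    skewed W V 0 = V := by
  simp [skewed]

/-- The recovery `exp (-i ε X)` on `A`, applied to the skewed code. -/
noncomputable def rotated (X : Matrix (l × κ) (l × κ) ℂ) (K : ℝ → Matrix ((l × κ) × β) l ℂ)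
    (ε : ℝ) : Matrix ((l × κ) × β) l ℂ :=
  (NormedSpace.exp ((Complex.I * (ε : ℂ)) • (-X)) ⊗ₖ (1 : Matrix β β ℂ)) * K ε

theorem rotated_expansion {X : Matrix (l × κ) (l × κ) ℂ}
    {W : Matrix ((l × κ) × β) ((l × κ) × β) ℂ} {V : Matrix ((l × κ) × β) l ℂ}
    (x : (l × κ) × β) (j : l) :
    (fun ε => rotated X (skewed W V) ε x j - V x j -
      ε * (Complex.I • (W * V - (X ⊗ₖ (1 : Matrix β β ℂ)) * V)) x j) =o[𝓝 0] fun ε : ℝ => ε := by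
  have h1 : ∀ x y, HasDerivAt (fun ε : ℝ => (NormedSpace.exp ((Complex.I * (ε : ℂ)) • (-X)) ⊗ₖ
      (1 : Matrix β β ℂ)) x y) (((Complex.I • (-X)) ⊗ₖ (1 : Matrix β β ℂ)) x y) 0 := fun x y =>
    (hasDerivAt_exp_apply (-X) x.1 y.1).mul_const _
  have h2 := isLittleO_of_hasDerivAt (hasDerivAt_matrix_mul h1 (hasDerivAt_skewed W V) x j)
  refine h2.congr_left fun ε => ?_
  have h3 : (((Complex.I • (-X)) ⊗ₖ (1 : Matrix β β ℂ)) * skewed W V 0 +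
      (NormedSpace.exp ((Complex.I * ((0 : ℝ) : ℂ)) • (-X)) ⊗ₖ (1 : Matrix β β ℂ)) *
        (Complex.I • (W * V))) =
      Complex.I • (W * V - (X ⊗ₖ (1 : Matrix β β ℂ)) * V) := by
    rw [skewed_zero]
    simp only [Complex.ofReal_zero, mul_zero, zero_smul, NormedSpace.exp_zero, Matrix.smul_kronecker,
      Matrix.one_kronecker_one, Matrix.one_mul, smul_sub, Matrix.smul_mul]
    rw [show (-X) ⊗ₖ (1 : Matrix β β ℂ) = -(X ⊗ₖ (1 : Matrix β β ℂ)) by ext; simp, Matrix.neg_mul,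
      smul_neg]
    abel
  rw [h3, skewed_zero]
  simp [rotated]

theorem vnEntropy_flat_diagonal [Nonempty κ] {p : l → ℝ} (hp : ∀ i, 0 < p i) (hp1 : ∑ i, p i = 1) :
    vnEntropy (Matrix.diagonal fun z : l × κ => ((p z.1 / Fintype.card κ : ℝ) : ℂ)) =
      vnEntropy (Matrix.diagonal fun i => (p i : ℂ)) + Real.log (Fintype.card κ) := by
  have hκ : (0 : ℝ) < Fintype.card κ := by exact_mod_cast Fintype.card_pos
  rw [vnEntropy_diagonal, vnEntropy_diagonal, Fintype.sum_prod_type,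
    ← mul_one (Real.log (Fintype.card κ)), ← hp1, Finset.mul_sum, ← Finset.sum_add_distrib]
  refine Finset.sum_congr rfl fun i _ => ?_
  simp only [Finset.sum_const, Finset.card_univ, nsmul_eq_mul, Real.negMulLog,
    Real.log_div (hp i).ne' hκ.ne']
  field_simp
  ring

theorem vnEntropy_ptraceSnd_ketbra [Nonempty κ] {χ : κ × β → ℂ} (hχ : IsFlat χ) :
    vnEntropy (ptraceSnd (ketbra χ)) = Real.log (Fintype.card κ) := by
  have hκ : (0 : ℝ) < Fintype.card κ := by exact_mod_cast Fintype.card_pos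
  have h : ptraceSnd (ketbra χ) =
      Matrix.diagonal fun _ : κ => (((Fintype.card κ : ℝ)⁻¹ : ℝ) : ℂ) := by
    rw [hχ, ← Matrix.diagonal_one, ← Matrix.diagonal_smul]
    congr 1
    ext i
    simp
  rw [h, vnEntropy_diagonal, Finset.sum_const, Finset.card_univ, nsmul_eq_mul, Real.negMulLog,
    Real.log_inv]
  field_simp

theorem correct_kronecker_mul (u : Matrix.unitaryGroup l ℂ) (RA : Matrix.unitaryGroup (l × κ) ℂ)
    (RB : Matrix.unitaryGroup β ℂ) (K : Matrix ((l × κ) × β) l ℂ) :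
    correct u (((RA : Matrix (l × κ) (l × κ) ℂ) ⊗ₖ (RB : Matrix β β ℂ)) * K) =
      (((⟨_, kronecker_unitary u (1 : Matrix.unitaryGroup κ ℂ)⟩ * RA :
        Matrix.unitaryGroup (l × κ) ℂ) : Matrix (l × κ) (l × κ) ℂ) ⊗ₖ (RB : Matrix β β ℂ)) * K := by
  rw [correct, ← Matrix.mul_assoc, ← Matrix.mul_kronecker_mul, Matrix.one_mul]
  rfl

theorem kronecker_mul_isometry (RA : Matrix.unitaryGroup (l × κ) ℂ) (RB : Matrix.unitaryGroup β ℂ)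
    {K : Matrix ((l × κ) × β) l ℂ} (hK : Kᴴ * K = 1) :
    (((RA : Matrix (l × κ) (l × κ) ℂ) ⊗ₖ (RB : Matrix β β ℂ)) * K)ᴴ *
      (((RA : Matrix (l × κ) (l × κ) ℂ) ⊗ₖ (RB : Matrix β β ℂ)) * K) = 1 := by
  have h : ((RA : Matrix (l × κ) (l × κ) ℂ) ⊗ₖ (RB : Matrix β β ℂ))ᴴ *
      ((RA : Matrix (l × κ) (l × κ) ℂ) ⊗ₖ (RB : Matrix β β ℂ)) = 1 :=
    Matrix.mem_unitaryGroup_iff'.mp (kronecker_unitary RA RB)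
  rw [Matrix.conjTranspose_mul, Matrix.mul_assoc, ← Matrix.mul_assoc (_ ⊗ₖ _)ᴴ, h, Matrix.one_mul,
    hK]

/-- The entropy of A is evaluated along the comparison path K₀, that of A₁ along the corrected
optimal path K'; neither change alters an entropy. Z is the contraction of J and so depends on W and
χ only, which makes the coefficient independent of the optimal recoveries. -/
theorem avgProtoArea_attachResource_expansion [Nonempty l] [Nonempty κ] {χ : κ × β → ℂ}
    (hχ : IsFlat χ) {W : Matrix ((l × κ) × β) ((l × κ) × β) ℂ} (hW : W.IsHermitian) :
    ∃ Z : Matrix (l × κ) (l × κ) ℂ,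
      ∀ (RA : ℝ → Matrix.unitaryGroup (l × κ) ℂ) (RB : ℝ → Matrix.unitaryGroup β ℂ),
      (∀ ε, IsOptimalRecovery (skewed W (attachResource χ) ε) (RA ε) (RB ε)) →
      ∀ p : l → ℝ, (∀ i, 0 < p i) → ∑ i, p i = 1 →
      (fun ε => avgProtoArea (skewed W (attachResource χ) ε) (RA ε) (RB ε)
          (Matrix.diagonal fun i => (p i : ℂ)) -
        (vnEntropy (ptraceSnd (ketbra χ)) + ε ^ 2 * ∫ U, hessian Z p U ∂(haarUnitary l)))
          =o[𝓝 0] fun ε : ℝ => ε ^ 2 := by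
  obtain ⟨X, J, G, e, hX, hJ, hcJ, hGh, hG, hJG⟩ := exists_normalForm (l := l) hχ W
  refine ⟨contract χ J, fun RA RB hopt p hp hp1 => ?_⟩
  set D : Matrix l l ℂ := Matrix.diagonal fun i => (p i : ℂ) with hD
  have hDH : D.IsHermitian := diagonal_ofReal_isHermitian p
  set KW : ℝ → Matrix ((l × κ) × β) l ℂ := skewed W (attachResource χ) with hKW
  have hKWi : ∀ ε, (KW ε)ᴴ * KW ε = 1 := skewed_isometry hW (attachResource_isometry hχ)
  set E : ℝ → Matrix.unitaryGroup (l × κ) ℂ := fun ε => ⟨_, exp_mem_unitaryGroup hX.neg ε⟩ with hE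
  set K₀ : ℝ → Matrix ((l × κ) × β) l ℂ := rotated X KW with hK₀
  have hK₀E : ∀ ε, K₀ ε = ((E ε : Matrix (l × κ) (l × κ) ℂ) ⊗ₖ
      ((1 : Matrix.unitaryGroup β ℂ) : Matrix β β ℂ)) * KW ε := fun ε => rfl
  have hK₀i : ∀ ε, (K₀ ε)ᴴ * K₀ ε = 1 := fun ε => by
    rw [hK₀E]; exact kronecker_mul_isometry _ _ (hKWi ε)
  have hK₀J : ∀ x j, (fun ε => K₀ ε x j - attachResource χ x j - ε * J x j) =o[𝓝 0]
      fun ε : ℝ => ε := by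
    intro x j
    rw [hJ]
    exact rotated_expansion x j
  have hfid₀ := fid_expansion hK₀i hK₀J hG hJG
  have hinf : 0 ≤ infid χ G := by unfold infid; positivity
  set K : ℝ → Matrix ((l × κ) × β) l ℂ := fun ε =>
    ((RA ε : Matrix (l × κ) (l × κ) ℂ) ⊗ₖ (RB ε : Matrix β β ℂ)) * KW ε with hK
  have hKi : ∀ ε, (K ε)ᴴ * K ε = 1 := fun ε => kronecker_mul_isometry _ _ (hKWi ε)
  -- Optimality is used against one competitor only: exp(-iεX) on A and the identity on Ā.
  have hoptK : ∀ ε, coherentInfo (chan (K₀ ε)) ≤ coherentInfo (chan (K ε)) := fun ε =>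
    hopt ε (E ε) 1
  obtain ⟨u, hu1, hu2⟩ := exists_correction_path hχ hK₀i hK₀J hcJ hinf hfid₀ hKi hoptK
  set K' : ℝ → Matrix ((l × κ) × β) l ℂ := fun ε => correct (u ε) (K ε) with hK'
  have hK'i : ∀ ε, (K' ε)ᴴ * K' ε = 1 := fun ε => correct_isometry _ (hKi ε)
  have hfO : (fun ε => 1 - fid (K' ε)) =O[𝓝 0] fun ε : ℝ => ε ^ 2 := by
    refine IsBigO.of_bound (infid χ G + 1) ?_
    filter_upwards [hu1 (infid χ G + 1) (by linarith)] with ε hε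
    rwa [Real.norm_eq_abs, abs_of_nonneg (fid_le_one (hK'i ε)), Real.norm_eq_abs,
      abs_of_nonneg (sq_nonneg ε)]
  have hK'R : ∀ ε, K' ε = (((⟨_, kronecker_unitary (u ε) (1 : Matrix.unitaryGroup κ ℂ)⟩ * RA ε :
        Matrix.unitaryGroup (l × κ) ℂ) : Matrix (l × κ) (l × κ) ℂ) ⊗ₖ (RB ε : Matrix β β ℂ)) *
        KW ε := fun ε => correct_kronecker_mul _ _ _ _
  have hlow : ∀ c < infid χ G, ∀ᶠ ε in 𝓝 (0 : ℝ), c * ε ^ 2 ≤ 1 - fid (K' ε) := by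
    intro c hc
    have hKWJ : ∀ x j, (fun ε => KW ε x j - attachResource χ x j -
        ε * (Complex.I • (W * attachResource (l := l) χ)) x j) =o[𝓝 0] fun ε : ℝ => ε := by
      intro x j
      have := isLittleO_of_hasDerivAt (hasDerivAt_skewed W (attachResource (l := l) χ) x j)
      rwa [skewed_zero] at this
    simp_rw [hK'R] at hfO ⊢
    exact infid_le_of_recovery hX hJ hGh hG hJG hKWi hKWJ _ RB hfO hc
  have hfid' : (fun ε => 1 - fid (K' ε) - ε ^ 2 * infid χ G) =o[𝓝 0] fun ε : ℝ => ε ^ 2 := by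
    rw [isLittleO_iff]
    intro c hc
    filter_upwards [hu1 (infid χ G + c) (by linarith), hlow (infid χ G - c) (by linarith)]
      with ε e1 e2
    rw [Real.norm_eq_abs, Real.norm_eq_abs, abs_of_nonneg (sq_nonneg ε), abs_le]
    constructor <;> nlinarith
  have hA := average_vnEntropy_outA hχ hK₀i hK₀J hcJ hp hp1
  have hC := average_vnEntropy_chan hK'i hp (hu2 p hp hp1)
  simp_rw [integral_entropyShift (hK₀i _)] at hA
  simp_rw [integral_entropyShift (hK'i _)] at hC
  set s : ℝ := Fintype.card l / ((Fintype.card l : ℝ) ^ 2 - 1) *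
    ∑ i, ∑ j, (Real.log (p i) - Real.log (p j)) * p j with hs
  -- The averaged linear terms differ by s times the difference of the two infidelities, and those
  -- have the same ε² coefficient.
  have hall := (hA.sub hC).add ((hfid'.sub hfid₀).const_mul_left s)
  refine hall.congr_left fun ε => ?_
  have havg : avgProtoArea (KW ε) (RA ε) (RB ε) D =
      ∫ U, vnEntropy (outA (rot U (K₀ ε)) D) ∂(haarUnitary l) -
        ∫ U, vnEntropy (chan (rot U (K' ε)) D) ∂(haarUnitary l) := by
    rw [← integral_sub]
    · refine integral_congr_ae (Eventually.of_forall fun U => ?_)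
      have hσ := isHermitian_conj_unitary (U : Matrix l l ℂ) hDH
      change protoArea _ _ _ _ = vnEntropy _ - vnEntropy _
      rw [vnEntropy_outA_rot U _ hDH, vnEntropy_chan_rot U _ hDH, hK₀E,
        vnEntropy_outA_kronecker _ _ _ hσ]
      have h1 : vnEntropy (chan (K' ε) ((U : Matrix l l ℂ) * D * (U : Matrix l l ℂ)ᴴ)) =
        vnEntropy (chan (K ε) ((U : Matrix l l ℂ) * D * (U : Matrix l l ℂ)ᴴ)) :=
        vnEntropy_chan_kronecker (u ε) (K ε) hσ
      rw [h1]
      rfl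
    · exact integrable_haarUnitary (continuous_vnEntropy
        ((continuous_outA D).comp (continuous_rot (K₀ ε))) fun U => outA_isHermitian _ hDH)
    · exact integrable_haarUnitary (continuous_vnEntropy
        ((continuous_chan D).comp (continuous_rot (K' ε))) fun U => chan_isHermitian _ hDH)
  rw [havg, vnEntropy_flat_diagonal hp hp1, vnEntropy_ptraceSnd_ketbra hχ]
  ring

end ProtoArea

/-! ### Exact codes -/

section ExactCode

variable {l κ β : Type*} [Fintype l] [DecidableEq l] [Fintype κ] [DecidableEq κ]
  [Fintype β] [DecidableEq β]

theorem continuous_choi : Continuous fun K : Matrix ((l × κ) × β) l ℂ => choi K := by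
  have h : Continuous fun K : Matrix ((l × κ) × β) l ℂ => choiVec K :=
    continuous_pi fun _ => continuous_pi fun _ => continuous_const.mul
      (continuous_id.matrix_elem _ _)
  simp_rw [choi_eq]
  exact h.matrix_mul h.matrix_conjTranspose

theorem continuous_coherentInfo :
    Continuous fun K : Matrix ((l × κ) × β) l ℂ => coherentInfo (chan K) :=
  (continuous_vnEntropy (continuous_ptraceSnd.comp continuous_choi)
    fun K => ptraceSnd_isHermitian (choi_posSemidef K).1).sub
    (continuous_vnEntropy continuous_choi fun K => (choi_posSemidef K).1)

theorem recoveryChannel_eq_chan (V : Matrix ((l × κ) × β) l ℂ)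
    (RA : Matrix.unitaryGroup (l × κ) ℂ) (RB : Matrix.unitaryGroup β ℂ) :
    recoveryChannel V RA RB =
      chan (((RA : Matrix (l × κ) (l × κ) ℂ) ⊗ₖ (RB : Matrix β β ℂ)) * V) := rfl

/-- The coherent information is continuous on a compact product of unitary groups. -/
theorem exists_isOptimalRecovery (V : Matrix ((l × κ) × β) l ℂ) :
    ∃ RA RB, IsOptimalRecovery V RA RB := by
  have hc : Continuous fun R : Matrix.unitaryGroup (l × κ) ℂ × Matrix.unitaryGroup β ℂ =>
      coherentInfo (chan (((R.1 : Matrix (l × κ) (l × κ) ℂ) ⊗ₖ (R.2 : Matrix β β ℂ)) * V)) := by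
    refine continuous_coherentInfo.comp ?_
    have h1 : Continuous fun R : Matrix.unitaryGroup (l × κ) ℂ × Matrix.unitaryGroup β ℂ =>
        (R.1 : Matrix (l × κ) (l × κ) ℂ) ⊗ₖ (R.2 : Matrix β β ℂ) := by
      refine continuous_pi fun x => continuous_pi fun y => ?_
      have e1 : Continuous fun R : Matrix.unitaryGroup (l × κ) ℂ × Matrix.unitaryGroup β ℂ =>
        (R.1 : Matrix (l × κ) (l × κ) ℂ) x.1 y.1 :=
        (continuous_subtype_val.comp continuous_fst).matrix_elem _ _
      have e2 : Continuous fun R : Matrix.unitaryGroup (l × κ) ℂ × Matrix.unitaryGroup β ℂ =>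
        (R.2 : Matrix β β ℂ) x.2 y.2 :=
        (continuous_subtype_val.comp continuous_snd).matrix_elem _ _
      exact e1.mul e2
    exact h1.matrix_mul continuous_const
  obtain ⟨R, -, hR⟩ := isCompact_univ.exists_isMaxOn Set.univ_nonempty hc.continuousOn
  refine ⟨R.1, R.2, fun RA' RB' => ?_⟩
  rw [recoveryChannel_eq_chan, recoveryChannel_eq_chan]
  exact isMaxOn_iff.mp hR (RA', RB') (Set.mem_univ _)

theorem recoveryChannel_kronecker_mul (V : Matrix ((l × κ) × β) l ℂ)
    (RA RA₀ : Matrix.unitaryGroup (l × κ) ℂ) (RB RB₀ : Matrix.unitaryGroup β ℂ) :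
    recoveryChannel (((RA₀ : Matrix (l × κ) (l × κ) ℂ) ⊗ₖ (RB₀ : Matrix β β ℂ)) * V) RA RB =
      recoveryChannel V (RA * RA₀) (RB * RB₀) := by
  rw [recoveryChannel_eq_chan, recoveryChannel_eq_chan, ← Matrix.mul_assoc,
    ← Matrix.mul_kronecker_mul]
  rfl

theorem isOptimalRecovery_kronecker_mul {V : Matrix ((l × κ) × β) l ℂ}
    {RA RA₀ : Matrix.unitaryGroup (l × κ) ℂ} {RB RB₀ : Matrix.unitaryGroup β ℂ}
    (h : IsOptimalRecovery
      (((RA₀ : Matrix (l × κ) (l × κ) ℂ) ⊗ₖ (RB₀ : Matrix β β ℂ)) * V) RA RB) :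
    IsOptimalRecovery V (RA * RA₀) (RB * RB₀) := by
  intro RA' RB'
  have h1 := h (RA' * star RA₀) (RB' * star RB₀)
  rw [recoveryChannel_kronecker_mul, recoveryChannel_kronecker_mul] at h1
  have e1 : RA' * star RA₀ * RA₀ = RA' := by rw [mul_assoc, Unitary.star_mul_self, mul_one]
  have e2 : RB' * star RB₀ * RB₀ = RB' := by rw [mul_assoc, Unitary.star_mul_self, mul_one]
  rwa [e1, e2] at h1

theorem avgProtoArea_kronecker_mul (V : Matrix ((l × κ) × β) l ℂ)
    (RA RA₀ : Matrix.unitaryGroup (l × κ) ℂ) (RB RB₀ : Matrix.unitaryGroup β ℂ)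
    {σ : Matrix l l ℂ} (hσ : σ.IsHermitian) :
    avgProtoArea (((RA₀ : Matrix (l × κ) (l × κ) ℂ) ⊗ₖ (RB₀ : Matrix β β ℂ)) * V) RA RB σ =
      avgProtoArea V (RA * RA₀) (RB * RB₀) σ := by
  refine integral_congr_ae (Eventually.of_forall fun U => ?_)
  change protoArea _ _ _ _ = protoArea _ _ _ _
  rw [protoArea, protoArea, recoveryChannel_kronecker_mul]
  congr 1
  exact vnEntropy_outA_kronecker RA₀ RB₀ V (isHermitian_conj_unitary _ hσ)

theorem skewed_conj {m : Type*} [Fintype m] [DecidableEq m] (R : Matrix.unitaryGroup m ℂ)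
    (W : Matrix m m ℂ) (ε : ℝ) :
    NormedSpace.exp ((Complex.I * (ε : ℂ)) • W) * (R : Matrix m m ℂ)ᴴ =
      (R : Matrix m m ℂ)ᴴ * NormedSpace.exp ((Complex.I * (ε : ℂ)) •
        ((R : Matrix m m ℂ) * W * (R : Matrix m m ℂ)ᴴ)) := by
  have h2 : (R : Matrix m m ℂ) * (R : Matrix m m ℂ)ᴴ = 1 := unitary_mul_conjTranspose R
  have hinv : (R : Matrix m m ℂ)⁻¹ = (R : Matrix m m ℂ)ᴴ := Matrix.inv_eq_right_inv h2
  have hu : IsUnit (R : Matrix m m ℂ) := IsUnit.of_mul_eq_one _ h2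
  have h3 := Matrix.exp_conj (R : Matrix m m ℂ) ((Complex.I * (ε : ℂ)) • W) hu
  rw [hinv, Matrix.mul_smul, Matrix.smul_mul] at h3
  rw [h3, ← Matrix.mul_assoc, ← Matrix.mul_assoc, unitary_conjTranspose_mul, Matrix.one_mul]

/-- The decoding unitaries of the unperturbed code pass through exp(iεW) by conjugating W. They are
then absorbed into the recovery, which preserves optimality. -/
theorem avgProtoArea_expansion [Nonempty l] [Nonempty κ] {χ : κ × β → ℂ}
    (hχ : IsFlat χ) {V₀ : Matrix ((l × κ) × β) l ℂ} (hV₀ : IsExactCode V₀ χ)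
    {W : Matrix ((l × κ) × β) ((l × κ) × β) ℂ} (hW : W.IsHermitian) :
    ∃ Z : Matrix (l × κ) (l × κ) ℂ,
      ∀ (RA : ℝ → Matrix.unitaryGroup (l × κ) ℂ) (RB : ℝ → Matrix.unitaryGroup β ℂ),
      (∀ ε, IsOptimalRecovery (skewed W V₀ ε) (RA ε) (RB ε)) →
      ∀ p : l → ℝ, (∀ i, 0 < p i) → ∑ i, p i = 1 →
      (fun ε => avgProtoArea (skewed W V₀ ε) (RA ε) (RB ε)
          (Matrix.diagonal fun i => (p i : ℂ)) -
        (vnEntropy (ptraceSnd (ketbra χ)) + ε ^ 2 * ∫ U, hessian Z p U ∂(haarUnitary l)))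
          =o[𝓝 0] fun ε : ℝ => ε ^ 2 := by
  obtain ⟨RA₀, RB₀, hR⟩ := hV₀
  set R : Matrix.unitaryGroup ((l × κ) × β) ℂ := ⟨_, kronecker_unitary RA₀ RB₀⟩ with hRdef
  have hRc : (R : Matrix ((l × κ) × β) ((l × κ) × β) ℂ)ᴴ =
      ((star RA₀ : Matrix.unitaryGroup (l × κ) ℂ) : Matrix (l × κ) (l × κ) ℂ) ⊗ₖ
        ((star RB₀ : Matrix.unitaryGroup β ℂ) : Matrix β β ℂ) :=
    Matrix.conjTranspose_kronecker _ _
  have hV : V₀ = (R : Matrix ((l × κ) × β) ((l × κ) × β) ℂ)ᴴ * attachResource (l := l) χ := by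
    rw [← hR]
    change V₀ = (R : Matrix ((l × κ) × β) ((l × κ) × β) ℂ)ᴴ *
      ((R : Matrix ((l × κ) × β) ((l × κ) × β) ℂ) * V₀)
    rw [← Matrix.mul_assoc, unitary_conjTranspose_mul, Matrix.one_mul]
  set W' := (R : Matrix ((l × κ) × β) ((l × κ) × β) ℂ) * W *
    (R : Matrix ((l × κ) × β) ((l × κ) × β) ℂ)ᴴ with hW'
  have hsk : ∀ ε, skewed W V₀ ε =
      (((star RA₀ : Matrix.unitaryGroup (l × κ) ℂ) : Matrix (l × κ) (l × κ) ℂ) ⊗ₖ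
        ((star RB₀ : Matrix.unitaryGroup β ℂ) : Matrix β β ℂ)) *
        skewed W' (attachResource χ) ε := by
    intro ε
    rw [← hRc, skewed, skewed, hV, ← Matrix.mul_assoc, skewed_conj R W ε, Matrix.mul_assoc]
  obtain ⟨Z, hZ⟩ := avgProtoArea_attachResource_expansion hχ
    (isHermitian_conj_unitary (R : Matrix ((l × κ) × β) ((l × κ) × β) ℂ) hW)
  refine ⟨Z, fun RA RB hopt p hp hp1 => ?_⟩
  simp_rw [hsk] at hopt ⊢
  simp_rw [avgProtoArea_kronecker_mul _ _ _ _ _ (diagonal_ofReal_isHermitian p)]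
  exact hZ _ _ (fun ε => isOptimalRecovery_kronecker_mul (hopt ε)) p hp hp1

end ExactCode

/-! ### The averaged second-order term -/

section Kernel

/-- The even function `log ((1 + z) / (1 - z)) / z`. -/
noncomputable def logRatio (z : ℝ) : ℝ :=
  if z = 0 then 2 else (Real.log (1 + z) - Real.log (1 - z)) / z

theorem hasSum_logRatio {z : ℝ} (hz : |z| < 1) :
    HasSum (fun k : ℕ => (2 : ℝ) * (1 / (2 * k + 1)) * z ^ (2 * k)) (logRatio z) := by
  rw [logRatio]
  split_ifs with h
  · subst h
    have := hasSum_single (f := fun k : ℕ => (2 : ℝ) * (1 / (2 * k + 1)) * (0 : ℝ) ^ (2 * k)) 0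
      (fun k hk => by simp [hk])
    simpa using this
  · have h1 := (Real.hasSum_log_sub_log_of_abs_lt_one hz).div_const z
    refine h1.congr_fun fun k => ?_
    field_simp
    ring

theorem logRatio_neg (z : ℝ) : logRatio (-z) = logRatio z := by
  rw [logRatio, logRatio]
  by_cases h : z = 0
  · simp [h]
  · rw [if_neg h, if_neg (neg_ne_zero.mpr h), sub_neg_eq_add, ← sub_eq_add_neg, div_neg, ← neg_div,
      neg_sub]

/-- The power series has only even powers with positive coefficients. Each term is convex, and the
z² term is strictly so. -/
theorem strictConvexOn_logRatio : StrictConvexOn ℝ (Set.Ioo (-1) 1) logRatio := by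
  refine ⟨convex_Ioo _ _, fun x hx y hy hxy a b ha hb hab => ?_⟩
  have hz := convex_Ioo (-1 : ℝ) 1 hx hy ha.le hb.le hab
  have h1 := (hasSum_logRatio (abs_lt.mpr hx)).mul_left a
  have h2 := (hasSum_logRatio (abs_lt.mpr hy)).mul_left b
  have h3 := hasSum_logRatio (abs_lt.mpr hz)
  refine hasSum_lt (i := 1) (fun k => ?_) ?_ h3 (h1.add h2)
  · have hk : (0 : ℝ) ≤ 2 * (1 / (2 * k + 1)) := by positivity
    have hc := (even_two_mul k).convexOn_pow (𝕜 := ℝ) |>.2 (Set.mem_univ x) (Set.mem_univ y)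
      ha.le hb.le hab
    simp only [smul_eq_mul] at hc ⊢
    nlinarith [mul_le_mul_of_nonneg_left hc hk]
  · have hc := (even_two_mul 1).strictConvexOn_pow (by norm_num) |>.2 (Set.mem_univ x)
      (Set.mem_univ y) hxy ha hb hab
    simp only [smul_eq_mul] at hc ⊢
    norm_num at hc ⊢
    nlinarith

/-- The kernel of the second-order term: `(x + y)² (log x - log y) / (x - y)`. -/
noncomputable def entropyKernel (x y : ℝ) : ℝ := (x + y) * logRatio ((x - y) / (x + y))

theorem entropyKernel_self (x : ℝ) : entropyKernel x x = 4 * x := by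
  simp [entropyKernel, logRatio]
  ring

theorem entropyKernel_eq {x y : ℝ} (hx : 0 < x) (hy : 0 < y) (h : x ≠ y) :
    entropyKernel x y = (x + y) ^ 2 * ((Real.log x - Real.log y) / (x - y)) := by
  have hxy : x + y ≠ 0 := (add_pos hx hy).ne'
  have hs : x - y ≠ 0 := sub_ne_zero.mpr h
  have h1 : 1 + (x - y) / (x + y) = 2 * x / (x + y) := by field_simp; ring
  have h2 : 1 - (x - y) / (x + y) = 2 * y / (x + y) := by field_simp; ring
  rw [entropyKernel, logRatio, if_neg (div_ne_zero hs hxy), h1, h2, Real.log_div (by positivity) hxy,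
    Real.log_div (by positivity) hxy, Real.log_mul two_ne_zero hx.ne',
    Real.log_mul two_ne_zero hy.ne']
  field_simp
  ring

theorem entropyKernel_symm (x y : ℝ) : entropyKernel x y = entropyKernel y x := by
  rw [entropyKernel, entropyKernel, ← logRatio_neg, ← neg_div, neg_sub, add_comm]

/-- The averaged weights are symmetric in i and j, so only this symmetrized divided difference
matters; it turns the quadratic term into the kernel. Division by k, the dimension of A₂, only
rescales. -/
theorem sq_mul_negMulLogDD_add {x y k : ℝ} (hx : 0 < x) (hy : 0 < y) (hk : 0 < k) :
    (x + y) ^ 2 * (negMulLogDD (x / k) (y / k) + negMulLogDD (y / k) (x / k)) =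
      -k * entropyKernel x y := by
  by_cases h : x = y
  · subst h
    rw [entropyKernel_self]
    simp only [negMulLogDD, if_true]
    field_simp
    ring
  · have h1 : y / k ≠ x / k := fun h' => h ((div_left_inj' hk.ne').mp h').symm
    have hs : y - x ≠ 0 := sub_ne_zero.mpr (Ne.symm h)
    have hs' : x - y ≠ 0 := sub_ne_zero.mpr h
    rw [negMulLogDD_add_of_ne h1, entropyKernel_eq hx hy h, Real.log_div hy.ne' hk.ne',
      Real.log_div hx.ne' hk.ne']
    have h2 : y / k - x / k = -(x - y) / k := by ring
    rw [h2]
    field_simp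
    ring

end Kernel

/-! ### The Haar average of the quadratic term -/

section IntegralHessian

variable {l κ : Type*} [Fintype l] [DecidableEq l] [Fintype κ] [DecidableEq κ]

theorem exists_sum_haarSq_block (Z : Matrix (l × κ) (l × κ) ℂ) :
    ∃ q q' : ℝ, 0 ≤ q ∧ ∀ i j, ∑ c, ∑ c', haarSq (block Z c c') i j = if i = j then q' else q := by
  have hdiag : ∃ q', ∀ i, ∑ c, ∑ c', haarSq (block Z c c') i i = q' := by
    rcases isEmpty_or_nonempty l with h | ⟨⟨k⟩⟩
    · exact ⟨0, fun i => isEmptyElim i⟩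
    · exact ⟨_, fun i => Finset.sum_congr rfl fun c _ => Finset.sum_congr rfl fun c' _ =>
        haarSq_diag _ i k⟩
  obtain ⟨q', hq'⟩ := hdiag
  by_cases h : ∃ k m : l, k ≠ m
  · obtain ⟨k, m, hkm⟩ := h
    refine ⟨∑ c, ∑ c', haarSq (block Z c c') k m, q', ?_, fun i j => ?_⟩
    · exact Finset.sum_nonneg fun c _ => Finset.sum_nonneg fun c' _ => haarSq_nonneg _ _ _
    · split_ifs with hij
      · subst hij; exact hq' i
      · exact Finset.sum_congr rfl fun c _ => Finset.sum_congr rfl fun c' _ =>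
          haarSq_offDiag _ hij hkm
  · push Not at h
    -- With at most one index there are no off-diagonal entries, and q is set to zero.
    exact ⟨0, q', le_rfl, fun i j => by rw [if_pos (h i j), h i j]; exact hq' j⟩

theorem integral_hessian_eq (Z : Matrix (l × κ) (l × κ) ℂ) (p : l → ℝ) :
    ∫ U, hessian Z p U ∂(haarUnitary l) = ∑ i, ∑ j, (p i + p j) ^ 2 *
      negMulLogDD (p i / Fintype.card κ) (p j / Fintype.card κ) *
      ∑ c, ∑ c', haarSq (block Z c c') i j := by
  have hc : ∀ x y : l × κ, Continuous fun U : Matrix.unitaryGroup l ℂ =>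
      ((p x.1 + p y.1) * ‖conjU U (block Z x.2 y.2) x.1 y.1‖) ^ 2 *
        negMulLogDD (p x.1 / Fintype.card κ) (p y.1 / Fintype.card κ) := fun x y =>
    ((continuous_const.mul
      (continuous_conjU_apply (block Z x.2 y.2) x.1 y.1).norm).pow 2).mul continuous_const
  unfold hessian
  rw [integral_finsetSum _ fun x _ => integrable_haarUnitary
    (continuous_finsetSum _ fun y _ => hc x y)]
  simp_rw [integral_finsetSum _ fun y _ => integrable_haarUnitary (hc _ y), mul_pow,
    integral_mul_const, integral_const_mul]
  simp only [Fintype.sum_prod_type]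
  refine Finset.sum_congr rfl fun i _ => ?_
  rw [Finset.sum_comm]
  refine Finset.sum_congr rfl fun j _ => ?_
  rw [Finset.mul_sum]
  refine Finset.sum_congr rfl fun c _ => ?_
  rw [Finset.mul_sum]
  refine Finset.sum_congr rfl fun c' _ => ?_
  rw [haarSq]
  ring

/-- Symmetrizing in i and j produces the kernel. Its diagonal values 4pᵢ add up to 4 for every
distribution, so the different diagonal weight q' affects only the constant C. -/
theorem exists_integral_hessian [Nonempty κ] (Z : Matrix (l × κ) (l × κ) ℂ) :
    ∃ q C : ℝ, 0 ≤ q ∧ ∀ p : l → ℝ, (∀ i, 0 < p i) → ∑ i, p i = 1 →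
      ∫ U, hessian Z p U ∂(haarUnitary l) = C - q * ∑ i, ∑ j, entropyKernel (p i) (p j) := by
  obtain ⟨q, q', hq, h⟩ := exists_sum_haarSq_block Z
  set k : ℝ := (Fintype.card κ : ℝ) with hk
  have hk0 : 0 < k := by rw [hk]; exact_mod_cast Fintype.card_pos
  refine ⟨k / 2 * q, -(k / 2) * ((q' - q) * 4), by positivity, fun p hp hp1 => ?_⟩
  set F : l → l → ℝ := fun i j => (p i + p j) ^ 2 * negMulLogDD (p i / k) (p j / k) *
    ∑ c, ∑ c', haarSq (block Z c c') i j with hF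
  have h2 : ∀ i j, F i j + F j i = -k * (q * entropyKernel (p i) (p j) +
      if i = j then (q' - q) * (4 * p i) else 0) := by
    intro i j
    have h3 := sq_mul_negMulLogDD_add (hp i) (hp j) hk0
    simp only [hF, h]
    by_cases hij : i = j
    · subst hij
      simp only [if_true]
      rw [← entropyKernel_self (p i)]
      linear_combination q' * h3
    · rw [if_neg hij, if_neg (Ne.symm hij), if_neg hij]
      linear_combination q * h3
  have h4 : ∑ i, ∑ j, F i j + ∑ i, ∑ j, F i j =
      -k * (q * ∑ i, ∑ j, entropyKernel (p i) (p j) + (q' - q) * 4) := by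
    nth_rewrite 2 [Finset.sum_comm]
    simp_rw [← Finset.sum_add_distrib, h2, ← Finset.mul_sum, Finset.sum_add_distrib,
      ← Finset.mul_sum]
    simp only [Finset.sum_ite_eq, Finset.mem_univ, if_true, ← Finset.mul_sum, hp1, mul_one]
  rw [integral_hessian_eq]
  change ∑ i, ∑ j, F i j = _
  linarith

end IntegralHessian

/-! ### Product states of qubits -/

section Bulk

/-- The kernel is the perspective of a convex function in mass x + y and ratio (x - y)/(x + y). The
ratio of a mixture is the average of the ratios weighted by mass, with weights w₁ and w₂. -/
theorem entropyKernel_mix_le {x₁ y₁ x₂ y₂ μ : ℝ} (hx₁ : 0 < x₁) (hy₁ : 0 < y₁) (hx₂ : 0 < x₂)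
    (hy₂ : 0 < y₂) (hμ0 : 0 ≤ μ) (hμ1 : μ ≤ 1) :
    entropyKernel ((1 - μ) * x₁ + μ * x₂) ((1 - μ) * y₁ + μ * y₂) ≤
      (1 - μ) * entropyKernel x₁ y₁ + μ * entropyKernel x₂ y₂ := by
  set w₁ := (1 - μ) * (x₁ + y₁) with hw₁
  set w₂ := μ * (x₂ + y₂) with hw₂
  have h1 : 0 < x₁ + y₁ := by positivity
  have h2 : 0 < x₂ + y₂ := by positivity
  have hw1 : 0 ≤ w₁ := mul_nonneg (by linarith) h1.le
  have hw2 : 0 ≤ w₂ := mul_nonneg hμ0 h2.le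
  have hw : 0 < w₁ + w₂ := by
    rcases hμ0.eq_or_lt with h | h
    · rw [hw₁, hw₂, ← h]; simpa using h1
    · exact add_pos_of_nonneg_of_pos hw1 (mul_pos h h2)
  have hz : ∀ {x y : ℝ}, 0 < x → 0 < y → (x - y) / (x + y) ∈ Set.Ioo (-1 : ℝ) 1 := by
    intro x y hx hy
    have := add_pos hx hy
    constructor
    · rw [lt_div_iff₀ this]; linarith
    · rw [div_lt_one this]; linarith
  have hc := strictConvexOn_logRatio.convexOn.2 (hz hx₁ hy₁) (hz hx₂ hy₂)
    (div_nonneg hw1 hw.le) (div_nonneg hw2 hw.le) (by rw [← add_div, div_self hw.ne'])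
  simp only [smul_eq_mul] at hc
  have e1 : (1 - μ) * x₁ + μ * x₂ + ((1 - μ) * y₁ + μ * y₂) = w₁ + w₂ := by rw [hw₁, hw₂]; ring
  have e2 : w₁ / (w₁ + w₂) * ((x₁ - y₁) / (x₁ + y₁)) + w₂ / (w₁ + w₂) * ((x₂ - y₂) / (x₂ + y₂)) =
      ((1 - μ) * x₁ + μ * x₂ - ((1 - μ) * y₁ + μ * y₂)) / (w₁ + w₂) := by
    have e3 : w₁ * ((x₁ - y₁) / (x₁ + y₁)) = (1 - μ) * (x₁ - y₁) := by rw [hw₁]; field_simp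
    have e4 : w₂ * ((x₂ - y₂) / (x₂ + y₂)) = μ * (x₂ - y₂) := by rw [hw₂]; field_simp
    rw [div_mul_eq_mul_div, div_mul_eq_mul_div, e3, e4, ← add_div]
    congr 1
    ring
  rw [e2] at hc
  have h5 := mul_le_mul_of_nonneg_left hc hw.le
  rw [entropyKernel, entropyKernel, entropyKernel, e1]
  refine h5.trans (le_of_eq ?_)
  rw [mul_add, ← mul_assoc, ← mul_assoc, mul_div_cancel₀ _ hw.ne', mul_div_cancel₀ _ hw.ne', hw₁,
    hw₂]
  ring

/-- Mixing (x, y) with (y, x) keeps the mass and mixes the ratio z with -z ≠ z. The values at z and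
-z agree by evenness, so strict convexity lowers the kernel. -/
theorem entropyKernel_swap_lt {x y μ : ℝ} (hx : 0 < x) (hy : 0 < y) (hxy : x ≠ y) (hμ0 : 0 < μ)
    (hμ1 : μ < 1) :
    entropyKernel ((1 - μ) * x + μ * y) ((1 - μ) * y + μ * x) < entropyKernel x y := by
  have hs := add_pos hx hy
  have hz : (x - y) / (x + y) ∈ Set.Ioo (-1 : ℝ) 1 := by
    constructor
    · rw [lt_div_iff₀ hs]; linarith
    · rw [div_lt_one hs]; linarith
  have hz' : -((x - y) / (x + y)) ∈ Set.Ioo (-1 : ℝ) 1 :=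
    ⟨by linarith [hz.2], by linarith [hz.1]⟩
  have hne : (x - y) / (x + y) ≠ -((x - y) / (x + y)) := by
    intro h
    have h0 : (x - y) / (x + y) = 0 := by linarith
    rw [div_eq_zero_iff] at h0
    rcases h0 with h0 | h0
    · exact hxy (sub_eq_zero.mp h0)
    · exact hs.ne' h0
  have hc := strictConvexOn_logRatio.2 hz hz' hne (sub_pos.mpr hμ1) hμ0 (by ring)
  simp only [smul_eq_mul, logRatio_neg] at hc
  have e1 : (1 - μ) * x + μ * y + ((1 - μ) * y + μ * x) = x + y := by ring
  have e2 : (1 - μ) * ((x - y) / (x + y)) + μ * -((x - y) / (x + y)) =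
      ((1 - μ) * x + μ * y - ((1 - μ) * y + μ * x)) / (x + y) := by ring
  rw [e2] at hc
  rw [entropyKernel, entropyKernel, e1]
  refine mul_lt_mul_of_pos_left (hc.trans_eq ?_) hs
  ring

variable {n : ℕ}

/-- The probability of `i` for a bit that is `0` with probability `a`. -/
def bitProb (a : ℝ) (i : Fin 2) : ℝ := if i = 0 then a else 1 - a

/-- The distribution of independent bits. -/
def prodProb (a : Fin n → ℝ) (x : Fin n → Fin 2) : ℝ := ∏ k, bitProb (a k) (x k)

theorem bitProb_pos {a : ℝ} (ha : a ∈ Set.Ioo (0 : ℝ) 1) (i : Fin 2) : 0 < bitProb a i := by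
  rw [bitProb]
  split_ifs
  · exact ha.1
  · linarith [ha.2]

theorem prodProb_pos {a : Fin n → ℝ} (ha : ∀ k, a k ∈ Set.Ioo (0 : ℝ) 1) (x : Fin n → Fin 2) :
    0 < prodProb a x :=
  Finset.prod_pos fun k _ => bitProb_pos (ha k) _

theorem sum_bitProb (a : ℝ) : ∑ i, bitProb a i = 1 := by
  simp [bitProb, Fin.sum_univ_two]

theorem sum_prod_bits (f : Fin n → Fin 2 → ℝ) :
    ∑ x : Fin n → Fin 2, ∏ k, f k (x k) = ∏ k, ∑ i, f k i := by
  rw [Finset.prod_univ_sum, Fintype.piFinset_univ]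

theorem sum_prodProb (a : Fin n → ℝ) : ∑ x, prodProb a x = 1 := by
  unfold prodProb
  rw [sum_prod_bits fun k => bitProb (a k)]
  simp only [sum_bitProb, Finset.prod_const_one]

theorem sum_negMulLog_bitProb (a : ℝ) :
    ∑ i, Real.negMulLog (bitProb a i) = Real.binEntropy a := by
  rw [Real.binEntropy_eq_negMulLog_add_negMulLog_one_sub, Fin.sum_univ_two]
  simp [bitProb]

/-- Additivity of entropy: the logarithm of the product splits over the bits, and in each summand
the other marginals sum to one. -/
theorem sum_negMulLog_prodProb {a : Fin n → ℝ} (ha : ∀ k, a k ∈ Set.Ioo (0 : ℝ) 1) :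
    ∑ x, Real.negMulLog (prodProb a x) = ∑ k, Real.binEntropy (a k) := by
  have h1 : ∀ x, Real.negMulLog (prodProb a x) =
      ∑ k, ∏ j, if j = k then Real.negMulLog (bitProb (a j) (x j)) else bitProb (a j) (x j) := by
    intro x
    rw [Real.negMulLog, prodProb, Real.log_prod fun k _ => (bitProb_pos (ha k) _).ne',
      Finset.mul_sum]
    refine Finset.sum_congr rfl fun k _ => ?_
    rw [← Finset.mul_prod_erase _ _ (Finset.mem_univ k),
      ← Finset.mul_prod_erase _ (fun j => if j = k then _ else _) (Finset.mem_univ k), if_pos rfl,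
      Finset.prod_congr rfl fun j hj => if_neg (Finset.ne_of_mem_erase hj), Real.negMulLog]
    ring
  simp_rw [h1]
  rw [Finset.sum_comm]
  refine Finset.sum_congr rfl fun k _ => ?_
  rw [sum_prod_bits fun j i => if j = k then Real.negMulLog (bitProb (a j) i) else bitProb (a j) i,
    ← Finset.mul_prod_erase _ _ (Finset.mem_univ k),
    Finset.prod_congr rfl (g := fun _ => (1 : ℝ)) fun j hj => ?_]
  · simp only [if_true, sum_negMulLog_bitProb, Finset.prod_const_one, mul_one]
  · simp only [if_neg (Finset.ne_of_mem_erase hj), sum_bitProb]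

/-- The kernel summed over all pairs of bit strings. -/
noncomputable def kernelSum (a : Fin n → ℝ) : ℝ :=
  ∑ x, ∑ y, entropyKernel (prodProb a x) (prodProb a y)

/-- The flip of the `k`-th bit. -/
def flipBit (k : Fin n) : (Fin n → Fin 2) ≃ (Fin n → Fin 2) :=
  Equiv.piCongrRight fun j => if j = k then Equiv.swap 0 1 else Equiv.refl _

theorem prodProb_eq_mul (a : Fin n → ℝ) (k : Fin n) (x : Fin n → Fin 2) :
    prodProb a x = bitProb (a k) (x k) * ∏ j ∈ Finset.univ.erase k, bitProb (a j) (x j) :=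
  (Finset.mul_prod_erase _ _ (Finset.mem_univ k)).symm

theorem prodProb_update (a : Fin n → ℝ) (k : Fin n) (b : ℝ) (x : Fin n → Fin 2) :
    prodProb (Function.update a k b) x =
      bitProb b (x k) * ∏ j ∈ Finset.univ.erase k, bitProb (a j) (x j) := by
  rw [prodProb_eq_mul _ k, Function.update_self]
  congr 1
  exact Finset.prod_congr rfl fun j hj => by
    rw [Function.update_of_ne (Finset.ne_of_mem_erase hj)]

theorem bitProb_swap (a : ℝ) (i : Fin 2) : bitProb a (Equiv.swap 0 1 i) = bitProb (1 - a) i := by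
  fin_cases i <;> simp [bitProb]

theorem prodProb_flipBit (a : Fin n → ℝ) (k : Fin n) (x : Fin n → Fin 2) :
    prodProb a (flipBit k x) =
      bitProb (1 - a k) (x k) * ∏ j ∈ Finset.univ.erase k, bitProb (a j) (x j) := by
  rw [prodProb_eq_mul _ k]
  congr 1
  · rw [← bitProb_swap]
    simp [flipBit]
  · exact Finset.prod_congr rfl fun j hj => by simp [flipBit, Finset.ne_of_mem_erase hj]

theorem bitProb_mix (a μ : ℝ) (i : Fin 2) :
    bitProb ((1 - μ) * a + μ * (1 - a)) i =
      (1 - μ) * bitProb a i + μ * bitProb (1 - a) i := by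
  rw [bitProb, bitProb, bitProb]
  split_ifs <;> ring

theorem prodProb_mix (a : Fin n → ℝ) (k : Fin n) (μ : ℝ) (x : Fin n → Fin 2) :
    prodProb (Function.update a k ((1 - μ) * a k + μ * (1 - a k))) x =
      (1 - μ) * prodProb a x + μ * prodProb a (flipBit k x) := by
  rw [prodProb_update, prodProb_flipBit, prodProb_eq_mul a k, bitProb_mix]
  ring

/-- Moving aₖ towards 1 - aₖ mixes the product distribution with its image under the flip of bit k.
The flip permutes bit strings and preserves the double sum, so joint convexity of the kernel gives
the bound. -/
theorem kernelSum_mix_le {a : Fin n → ℝ} (ha : ∀ k, a k ∈ Set.Ioo (0 : ℝ) 1) (k : Fin n) {μ : ℝ}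
    (hμ0 : 0 ≤ μ) (hμ1 : μ ≤ 1) :
    kernelSum (Function.update a k ((1 - μ) * a k + μ * (1 - a k))) ≤ kernelSum a ∧
      (0 < μ → μ < 1 → a k ≠ 1 / 2 →
        kernelSum (Function.update a k ((1 - μ) * a k + μ * (1 - a k))) < kernelSum a) := by
  have hflip : ∑ x, ∑ y, entropyKernel (prodProb a (flipBit k x)) (prodProb a (flipBit k y)) =
      kernelSum a := by
    rw [kernelSum, ← Equiv.sum_comp (flipBit k) fun x =>
      ∑ y, entropyKernel (prodProb a x) (prodProb a y)]
    exact Finset.sum_congr rfl fun x _ =>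
      Equiv.sum_comp (flipBit k) fun y => entropyKernel (prodProb a (flipBit k x)) (prodProb a y)
  have hsum : kernelSum a = ∑ x, ∑ y, ((1 - μ) * entropyKernel (prodProb a x) (prodProb a y) +
      μ * entropyKernel (prodProb a (flipBit k x)) (prodProb a (flipBit k y))) := by
    simp_rw [Finset.sum_add_distrib, ← Finset.mul_sum, hflip]
    rw [kernelSum]
    ring
  have hle : ∀ x y, entropyKernel (prodProb (Function.update a k ((1 - μ) * a k + μ * (1 - a k))) x)
      (prodProb (Function.update a k ((1 - μ) * a k + μ * (1 - a k))) y) ≤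
      (1 - μ) * entropyKernel (prodProb a x) (prodProb a y) +
        μ * entropyKernel (prodProb a (flipBit k x)) (prodProb a (flipBit k y)) := by
    intro x y
    rw [prodProb_mix, prodProb_mix]
    exact entropyKernel_mix_le (prodProb_pos ha _) (prodProb_pos ha _) (prodProb_pos ha _)
      (prodProb_pos ha _) hμ0 hμ1
  refine ⟨?_, fun h0 h1 hne => ?_⟩
  · rw [hsum]
    exact Finset.sum_le_sum fun x _ => Finset.sum_le_sum fun y _ => hle x y
  · rw [hsum]
    -- Strictness needs a single pair: the zero string and its flip, which the flip exchanges and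
    -- whose probabilities differ when aₖ ≠ 1/2.
    refine Finset.sum_lt_sum (fun x _ => Finset.sum_le_sum fun y _ => hle x y)
      ⟨fun _ => 0, Finset.mem_univ _, Finset.sum_lt_sum (fun y _ => hle _ y)
        ⟨flipBit k fun _ => 0, Finset.mem_univ _, ?_⟩⟩
    have hff : flipBit k (flipBit k fun _ => 0) = fun _ => (0 : Fin 2) := by
      ext j
      by_cases hj : j = k <;> simp [flipBit, hj]
    have hxy : prodProb a (fun _ => 0) ≠ prodProb a (flipBit k fun _ => 0) := by
      rw [prodProb_flipBit, prodProb_eq_mul a k]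
      intro h
      have hpos : 0 < ∏ j ∈ Finset.univ.erase k, bitProb (a j) ((fun _ => 0 : Fin n → Fin 2) j) :=
        Finset.prod_pos fun j _ => bitProb_pos (ha j) _
      have h2 := mul_right_cancel₀ hpos.ne' h
      simp only [bitProb, if_true] at h2
      exact hne (by linarith)
    rw [prodProb_mix, prodProb_mix, hff, entropyKernel_symm (prodProb a (flipBit k _)) (prodProb a _)]
    refine (entropyKernel_swap_lt (prodProb_pos ha _) (prodProb_pos ha _) hxy h0 h1).trans_eq ?_
    ring

/-- Binary entropy is symmetric about 1/2 and increasing up to it. Larger entropy thus means being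
closer to 1/2, that is, lying between a and 1 - a. -/
theorem exists_mix {a b : ℝ} (ha : a ∈ Set.Ioo (0 : ℝ) 1) (hb : b ∈ Set.Ioo (0 : ℝ) 1)
    (h : Real.binEntropy a ≤ Real.binEntropy b) :
    ∃ μ, 0 ≤ μ ∧ μ ≤ 1 ∧ b = (1 - μ) * a + μ * (1 - a) ∧
      (Real.binEntropy a < Real.binEntropy b → 0 < μ ∧ μ < 1 ∧ a ≠ 1 / 2) := by
  have key : ∀ {c : ℝ}, c ∈ Set.Ioo (0 : ℝ) 1 → ∃ m, m ∈ Set.Icc (0 : ℝ) 2⁻¹ ∧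
      Real.binEntropy c = Real.binEntropy m ∧ (c = m ∨ c = 1 - m) := by
    intro c hc
    rcases le_total c 2⁻¹ with h | h
    · exact ⟨c, ⟨hc.1.le, h⟩, rfl, Or.inl rfl⟩
    · refine ⟨1 - c, ⟨by linarith [hc.2], by norm_num at h ⊢; linarith⟩,
        (Real.binEntropy_one_sub c).symm, Or.inr (by ring)⟩
  obtain ⟨m, hm, hHm, hcm⟩ := key ha
  obtain ⟨m', hm', hHm', hcm'⟩ := key hb
  rw [hHm, hHm'] at h ⊢
  have hle : m ≤ m' := (Real.binEntropy_strictMonoOn.le_iff_le hm hm').mp h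
  have hlt : Real.binEntropy m < Real.binEntropy m' → m < m' :=
    (Real.binEntropy_strictMonoOn.lt_iff_lt hm hm').mp
  have hm2 := hm'.2
  rcases eq_or_ne m 2⁻¹ with h2 | h2
  · have h3 : m' = 2⁻¹ := le_antisymm hm2 (h2 ▸ hle)
    refine ⟨0, le_rfl, zero_le_one, ?_, fun h4 => ?_⟩
    · rcases hcm with rfl | rfl <;> rcases hcm' with rfl | rfl <;> rw [h2, h3] <;> norm_num
    · exact absurd (hlt h4) (by rw [h2, h3]; exact lt_irrefl _)
  have hmlt : m < 2⁻¹ := lt_of_le_of_ne hm.2 h2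
  norm_num at hm2 hmlt
  have hne : a ≠ 1 / 2 := by
    rcases hcm with rfl | rfl
    · exact hmlt.ne
    · intro h5; linarith
  have hden : 1 - 2 * a ≠ 0 := fun h5 => hne (by linarith)
  -- The solution of b = a + μ(1 - 2a).
  refine ⟨(b - a) / (1 - 2 * a), ?_, ?_, ?_, fun h4 => ⟨?_, ?_, hne⟩⟩
  · rcases hcm with rfl | rfl <;> rcases hcm' with rfl | rfl
    · exact div_nonneg (by linarith) (by linarith)
    · exact div_nonneg (by linarith) (by linarith)
    · exact div_nonneg_of_nonpos (by linarith) (by linarith)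
    · exact div_nonneg_of_nonpos (by linarith) (by linarith)
  · rcases hcm with rfl | rfl
    · rw [div_le_one (by linarith)]
      rcases hcm' with rfl | rfl <;> linarith
    · rw [div_le_one_of_neg (by linarith)]
      rcases hcm' with rfl | rfl <;> linarith
  · linear_combination -div_mul_cancel₀ (b - a) hden
  · have := hlt h4
    rcases hcm with rfl | rfl <;> rcases hcm' with rfl | rfl
    · exact div_pos (by linarith) (by linarith)
    · exact div_pos (by linarith) (by linarith)
    · exact div_pos_of_neg_of_neg (by linarith) (by linarith)
    · exact div_pos_of_neg_of_neg (by linarith) (by linarith)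
  · have := hlt h4
    rcases hcm with rfl | rfl
    · rw [div_lt_one (by linarith)]
      rcases hcm' with rfl | rfl <;> linarith
    · rw [div_lt_one_of_neg (by linarith)]
      rcases hcm' with rfl | rfl <;> linarith

theorem kernelSum_update_le {a : Fin n → ℝ} (ha : ∀ k, a k ∈ Set.Ioo (0 : ℝ) 1) (k : Fin n) {b : ℝ}
    (hb : b ∈ Set.Ioo (0 : ℝ) 1) (h : Real.binEntropy (a k) ≤ Real.binEntropy b) :
    kernelSum (Function.update a k b) ≤ kernelSum a ∧
      (Real.binEntropy (a k) < Real.binEntropy b →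
        kernelSum (Function.update a k b) < kernelSum a) := by
  obtain ⟨μ, h0, h1, rfl, h2⟩ := exists_mix (ha k) hb h
  obtain ⟨e1, e2⟩ := kernelSum_mix_le ha k h0 h1
  exact ⟨e1, fun h3 => e2 (h2 h3).1 (h2 h3).2.1 (h2 h3).2.2⟩

/-- The coordinates are changed one at a time; a single strict step makes the chain strict. -/
theorem kernelSum_le {a b : Fin n → ℝ} (ha : ∀ k, a k ∈ Set.Ioo (0 : ℝ) 1)
    (hb : ∀ k, b k ∈ Set.Ioo (0 : ℝ) 1)
    (h : ∀ k, Real.binEntropy (a k) ≤ Real.binEntropy (b k)) :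
    kernelSum b ≤ kernelSum a ∧
      ((∃ k, Real.binEntropy (a k) < Real.binEntropy (b k)) → kernelSum b < kernelSum a) := by
  have key : ∀ s : Finset (Fin n), kernelSum (s.piecewise b a) ≤ kernelSum a ∧
      ((∃ k ∈ s, Real.binEntropy (a k) < Real.binEntropy (b k)) →
        kernelSum (s.piecewise b a) < kernelSum a) := by
    intro s
    induction s using Finset.induction_on with
    | empty => simp
    | insert k s hk ih =>
      have hpa : ∀ j, s.piecewise b a j ∈ Set.Ioo (0 : ℝ) 1 := by
        intro j
        by_cases hj : j ∈ s
        · rw [Finset.piecewise_eq_of_mem _ _ _ hj]; exact hb j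
        · rw [Finset.piecewise_eq_of_notMem _ _ _ hj]; exact ha j
      have hak : s.piecewise b a k = a k := Finset.piecewise_eq_of_notMem _ _ _ hk
      obtain ⟨e1, e2⟩ := kernelSum_update_le hpa k (hb k) (by rw [hak]; exact h k)
      rw [Finset.piecewise_insert]
      refine ⟨e1.trans ih.1, ?_⟩
      rintro ⟨j, hj, hlt⟩
      rcases Finset.mem_insert.mp hj with rfl | hj
      · exact (e2 (by rw [hak]; exact hlt)).trans_le ih.1
      · exact e1.trans_lt (ih.2 ⟨j, hj, hlt⟩)
  have h1 := key Finset.univ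
  rw [Finset.piecewise_univ] at h1
  exact ⟨h1.1, fun ⟨k, hk⟩ => h1.2 ⟨k, Finset.mem_univ k, hk⟩⟩

theorem bulkState_eq (θ : Fin n → ℝ) :
    bulkState θ = Matrix.diagonal fun x => (prodProb (fun k => Real.cos (θ k) ^ 2) x : ℂ) := by
  have hne : ∀ x z : Fin n → Fin 2, x ≠ z → bellLike θ (x, z) = 0 := by
    intro x z hxz
    obtain ⟨k, hk⟩ := Function.ne_iff.mp hxz
    exact Finset.prod_eq_zero (Finset.mem_univ k) (if_neg hk)
  ext x y
  rw [bulkState, ptraceSnd, Finset.sum_eq_single x]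
  · rw [ketbra, Matrix.vecMulVec_apply, Pi.star_apply]
    by_cases hxy : x = y
    · subst hxy
      rw [Matrix.diagonal_apply_eq, Complex.star_def, Complex.mul_conj, Complex.normSq_eq_norm_sq,
        bellLike, norm_prod, ← Finset.prod_pow, prodProb]
      congr 1
      refine Finset.prod_congr rfl fun k _ => ?_
      rw [if_pos rfl, bitProb, ← Real.sin_sq]
      split_ifs <;> rw [Complex.norm_real, Real.norm_eq_abs, sq_abs]
    · rw [hne y x (Ne.symm hxy), Matrix.diagonal_apply_ne _ hxy]
      simp
  · intro z _ hz
    rw [ketbra, Matrix.vecMulVec_apply, hne x z hz.symm, zero_mul]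
  · simp

theorem cos_sq_mem {t : ℝ} (ht : t ∈ Set.Ioo 0 (Real.pi / 2)) :
    Real.cos t ^ 2 ∈ Set.Ioo (0 : ℝ) 1 := by
  have h1 : 0 < Real.cos t := Real.cos_pos_of_mem_Ioo ⟨by linarith [ht.1, Real.pi_pos], ht.2⟩
  have h2 : 0 < Real.sin t := Real.sin_pos_of_pos_of_lt_pi ht.1 (by linarith [ht.2, Real.pi_pos])
  exact ⟨by positivity, by nlinarith [Real.sin_sq_add_cos_sq t]⟩

theorem vnEntropy_bulkState {θ : Fin n → ℝ} (hθ : θ ∈ fullRankAngles n) :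
    vnEntropy (bulkState θ) = ∑ k, Real.binEntropy (Real.cos (θ k) ^ 2) := by
  rw [bulkState_eq, vnEntropy_diagonal, sum_negMulLog_prodProb fun k => cos_sq_mem (hθ k)]

theorem pairEntropy_eq {t : ℝ} (ht : t ∈ Set.Ioo 0 (Real.pi / 2)) :
    pairEntropy t = Real.binEntropy (Real.cos t ^ 2) := by
  rw [pairEntropy, vnEntropy_bulkState fun _ => ht]
  simp

end Bulk

/-! ### The main theorem -/

theorem mainTheorem6 {n : ℕ} {κ β : Type*} [Fintype κ] [DecidableEq κ] [Nonempty κ]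
    [Fintype β] [DecidableEq β]
    (χ : κ × β → ℂ) (hχ : IsFlat χ)
    (V₀ : Matrix (((Fin n → Fin 2) × κ) × β) (Fin n → Fin 2) ℂ) (hV₀ : IsExactCode V₀ χ)
    (W : Matrix (((Fin n → Fin 2) × κ) × β) (((Fin n → Fin 2) × κ) × β) ℂ)
    (hW : W.IsHermitian) :
    (∀ ε : ℝ, ∃ RA RB, IsOptimalRecovery (skewed W V₀ ε) RA RB) ∧
    ∃ G : (Fin n → ℝ) → ℝ,
      (∀ (RA : ℝ → Matrix.unitaryGroup ((Fin n → Fin 2) × κ) ℂ)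
          (RB : ℝ → Matrix.unitaryGroup β ℂ),
        (∀ ε, IsOptimalRecovery (skewed W V₀ ε) (RA ε) (RB ε)) →
        ∀ θ ∈ fullRankAngles n,
          (fun ε : ℝ => avgProtoArea (skewed W V₀ ε) (RA ε) (RB ε) (bulkState θ) -
              (vnEntropy (ptraceSnd (ketbra χ)) + ε ^ 2 * G θ))
            =o[𝓝 0] fun ε : ℝ => ε ^ 2) ∧
      (∀ θ ∈ fullRankAngles n, ∀ θ' ∈ fullRankAngles n,
        (∀ k, pairEntropy (θ k) ≤ pairEntropy (θ' k)) → G θ ≤ G θ') ∧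
      ((∀ θ ∈ fullRankAngles n, ∀ θ' ∈ fullRankAngles n, G θ = G θ') ∨
        (∀ θ ∈ fullRankAngles n, ∀ θ' ∈ fullRankAngles n,
          (∀ k, pairEntropy (θ k) ≤ pairEntropy (θ' k)) →
          (∃ k, pairEntropy (θ k) < pairEntropy (θ' k)) → G θ < G θ')) ∧
      (∀ t ∈ Set.Ioo (0 : ℝ) (Real.pi / 2), ∀ t' ∈ Set.Ioo (0 : ℝ) (Real.pi / 2),
        vnEntropy (bulkState fun _ : Fin n => t) ≤ vnEntropy (bulkState fun _ : Fin n => t') →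
        G (fun _ => t) ≤ G (fun _ => t')) := by
  refine ⟨fun ε => exists_isOptimalRecovery _, ?_⟩
  obtain ⟨Z, hZ⟩ := avgProtoArea_expansion hχ hV₀ hW
  obtain ⟨q, C, hq, hC⟩ := exists_integral_hessian (κ := κ) Z
  have hmem : ∀ θ ∈ fullRankAngles n, ∀ k, Real.cos (θ k) ^ 2 ∈ Set.Ioo (0 : ℝ) 1 :=
    fun θ hθ k => cos_sq_mem (hθ k)
  have hle : ∀ θ ∈ fullRankAngles n, ∀ θ' ∈ fullRankAngles n,
      (∀ k, pairEntropy (θ k) ≤ pairEntropy (θ' k)) →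
      ∀ k, Real.binEntropy (Real.cos (θ k) ^ 2) ≤ Real.binEntropy (Real.cos (θ' k) ^ 2) := by
    intro θ hθ θ' hθ' h k
    rw [← pairEntropy_eq (hθ k), ← pairEntropy_eq (hθ' k)]
    exact h k
  have hmono : ∀ θ ∈ fullRankAngles n, ∀ θ' ∈ fullRankAngles n,
      (∀ k, pairEntropy (θ k) ≤ pairEntropy (θ' k)) →
      C - q * kernelSum (fun k => Real.cos (θ k) ^ 2) ≤
        C - q * kernelSum (fun k => Real.cos (θ' k) ^ 2) := by
    intro θ hθ θ' hθ' h
    have := mul_le_mul_of_nonneg_left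
      (kernelSum_le (hmem θ hθ) (hmem θ' hθ') (hle θ hθ θ' hθ' h)).1 hq
    linarith
  refine ⟨fun θ => C - q * kernelSum (fun k => Real.cos (θ k) ^ 2), ?_, hmono, ?_, ?_⟩
  · intro RA RB hR θ hθ
    have hp := prodProb_pos (hmem θ hθ)
    have hs := sum_prodProb fun k => Real.cos (θ k) ^ 2
    have := hZ RA RB hR _ hp hs
    rw [hC _ hp hs, ← bulkState_eq θ] at this
    exact this
  -- The dichotomy is q = 0 against q > 0; q is the off-diagonal weight of Z after averaging.
  · rcases hq.eq_or_lt with rfl | hq'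
    · left
      intro θ _ θ' _
      simp
    · right
      rintro θ hθ θ' hθ' h ⟨k, hk⟩
      have hk' : Real.binEntropy (Real.cos (θ k) ^ 2) < Real.binEntropy (Real.cos (θ' k) ^ 2) := by
        rw [← pairEntropy_eq (hθ k), ← pairEntropy_eq (hθ' k)]
        exact hk
      have := mul_lt_mul_of_pos_left
        ((kernelSum_le (hmem θ hθ) (hmem θ' hθ') (hle θ hθ θ' hθ' h)).2 ⟨k, hk'⟩) hq'
      change C - q * _ < C - q * _
      linarith
  · intro t ht t' ht' h
    rw [vnEntropy_bulkState fun _ => ht, vnEntropy_bulkState fun _ => ht'] at h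
    refine hmono _ (fun _ => ht) _ (fun _ => ht') fun k => ?_
    rw [pairEntropy_eq ht, pairEntropy_eq ht']
    -- The bulk entropy of identical pairs is n times that of one pair. The index k shows n > 0, and
    -- for n = 0 there is nothing to compare.
    have hn : (0 : ℝ) < n := Nat.cast_pos.2 k.pos
    simp only [Finset.sum_const, Finset.card_univ, Fintype.card_fin, nsmul_eq_mul] at h
    exact le_of_mul_le_mul_left h hn
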